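/- **Metric complexes.** Let $X$ be a flag simplicial complex whose triangles are (nondegenerate) Euclidean triangles, with lengths agreeing on common edges. For a vertex $x$, the link of $x$ is the full subgraph of $X^{(1)}$ spanned by the neighbours of $x$; the angular length of an edge $ab$ of it is the angle $\angle_x(a,b)$ at $x$ of the triangle $xab$, and the angular length of a path or cycle is the sum over its edges. Assume that $\angle_x(a,c)\le\angle_x(a,b)+\angle_x(b,c)$ for every vertex $x$ and pairwise adjacent $a,b,c$ in its link. A simple cycle of length at least $4$ in a link is $2$-full if no two vertices having a common neighbour in the cycle are joined by an edge. $X$ is *metrically systolic* if it is simply connected and every $2$-full simple cycle in every link has angular length at least $2\pi$. **Diagrams.** A *cycle* $C$ in $X$ is a closed edge path with at least one edge. A *singular disc* $D$ is a finite connected and simply connected subcomplex of a triangulation of the plane, with its boundary cycle. A *singular disc diagram* for $C$ is a simplicial map $f\colon D\to X$ from a singular disc, mapping the boundary cycle of $D$ to $C$. It is *nondegenerate* if $f$ is injective on every simplex, and *reduced* if distinct triangles sharing an edge have distinct images. Its *area* is the number of triangles of $D$, and it is *minimal* if its area is least among all singular disc diagrams for $C$ in $X$. A vertex of $D$ is *interior*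 if its link in $D$ is a cycle. Angles in $D$ are those of the image in $X$. A nondegenerate diagram is *CAT(0)* if the link of every interior vertex has angular length at least $2\pi$; an interior vertex is *flat* if this length is exactly $2\pi$. **Moves.** Each of the following turns $f\colon D\to X$ into a new singular disc diagram for $C$; unless stated otherwise, the map is unchanged on the vertices that are kept. - *A-move*: $u,v,w\in D$ are pairwise adjacent but do not bound a triangle of $D$. All vertices inside the region bounded by the three edges are removed (with all simplices containing them), and the triangle $uvw$ is inserted. B-, C- and D-moves are made only if every three pairwise adjacent vertices of $D$ bound a triangle. - *B-move*: $uvw$ and $uvz$ are triangles, $w\ne z$ and $f(w)=f(z)$. The edge $uv$ is replaced by the edge $wz$ (and the triangles $uvw,uvz$ by $uwz,vwz$). - *C-move*: $u_1u_2$ is an edge with $f(u_1)=f(u_2)$. It is collapsed to a vertex $u$ with $f'(u)=f(u_1)$; thus $u$ is adjacent to all other vertices that were adjacent to $u_1$ or $u_2$. - *D-move*: $v$ is an interior vertex, $u$ is adjacent to two distinct vertices $w,z$ in the link of $v$, and $f(w),f(z)$ are adjacent. The edge $vu$ is replaced by the edge $wz$. E- and F-moves are made only if no A-, B- or C-move is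 possible and there are an interior vertex $v$ and two distinct vertices $w,z$ in its link with $f(w)=f(z)$. - *E-move*: $v$ is the only common neighbour of $w,z$, and both arcs between $w$ and $z$ in the link of $v$ have angular length less than $2\pi$. The vertices $w,z$ are identified to a vertex $x$ with image $f(w)$, and $v$ is replaced by two copies with image $f(v)$, each joined to $x$ and to one of the two arcs. Then the two copies are removed, and their links are filled by triangles with vertices in these links. - *F-move*: there is $u\neq v$ adjacent to both $w,z$. The vertices $w,z$ are joined by an edge, and $v$ is replaced by two copies with image $f(v)$, one on each side of this edge, each joined to $w$, $z$ and to the vertices of one of the two arcs between them in the link of $v$. Then the A-move on $u,w,z$ is performed. **Theorem 2.9 (CAT(0) disc diagram II).** Let $f\colon D\to X$ be a singular disc diagram for a cycle $C$ in a metrically systolic complex $X$. By a finite number of A-, B-, C-, D-, E- and F-moves it can be modified to a CAT(0), nondegenerate, reduced singular disc diagram $f'\colon D'\to X$ for $C$ such that, for every flat vertex $v$ of $D'$, the restriction of $f'$ to the star of $v$ is injective. Furthermore: 1. $f'$ uses no new vertices: there is an injective map $i$ from the vertex set of $D'$ to the vertex set of $D$ with $f'=f\circ i$ on the vertices of $D'$;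 2. the number of triangles of $D'$ is at most the number of triangles of $D$; 3. every minimal singular disc diagram for $C$ is CAT(0), nondegenerate and reduced, and is injective on the star of each of its flat vertices. -/

import Mathlib

universe u v

/-! ### Two-dimensional simplicial complexes and simple connectivity -/

/-- A simplicial complex of dimension at most two with vertex set `V`: its edges are recorded by a
simple graph, its triangles by their vertex sets. -/
structure TwoComplex (V : Type u) where
  graph : SimpleGraph V
  triangles : Set (Set V)
  is_triangle : ∀ t ∈ triangles, ∃ a b c, graph.Adj a b ∧ graph.Adj b c ∧ graph.Adj a c ∧
    t = {a, b, c}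

/-- The two-skeleton of the flag simplicial complex with one-skeleton `G`: every triple of pairwise
adjacent vertices spans a triangle. -/
def flagTwoSkeleton {V : Type u} (G : SimpleGraph V) : TwoComplex V where
  graph := G
  triangles := {t | ∃ a b c, G.Adj a b ∧ G.Adj b c ∧ G.Adj a c ∧ t = {a, b, c}}
  is_triangle := fun _ h => h

namespace TwoComplex

variable {V : Type u}

/-- Homotopy of edge paths relative to the endpoints: the congruence generated by deleting a
backtrack `a b a` and by replacing two consecutive sides of a triangle by the third side. -/
inductive Homotopic (K : TwoComplex V) : ∀ {a b : V}, K.graph.Walk a b → K.graph.Walk a b → Prop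
  | refl {a b : V} (p : K.graph.Walk a b) : Homotopic K p p
  | symm {a b : V} {p q : K.graph.Walk a b} : Homotopic K p q → Homotopic K q p
  | trans {a b : V} {p q r : K.graph.Walk a b} :
      Homotopic K p q → Homotopic K q r → Homotopic K p r
  | cons {a b c : V} (h : K.graph.Adj a b) {p q : K.graph.Walk b c} :
      Homotopic K p q → Homotopic K (SimpleGraph.Walk.cons h p) (SimpleGraph.Walk.cons h q)
  | backtrack {a b c : V} (h : K.graph.Adj a b) (h' : K.graph.Adj b a) (p : K.graph.Walk a c) :
      Homotopic K (SimpleGraph.Walk.cons h (SimpleGraph.Walk.cons h' p)) p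
  | triangle {a b c d : V} (hab : K.graph.Adj a b) (hbc : K.graph.Adj b c) (hac : K.graph.Adj a c)
      (ht : ({a, b, c} : Set V) ∈ K.triangles) (p : K.graph.Walk c d) :
      Homotopic K (SimpleGraph.Walk.cons hab (SimpleGraph.Walk.cons hbc p))
        (SimpleGraph.Walk.cons hac p)

/-- The complex is (nonempty,) connected, and its edge-path group is trivial. -/
def SimplyConnected (K : TwoComplex V) : Prop :=
  K.graph.Connected ∧ ∀ (a : V) (p : K.graph.Walk a a), K.Homotopic p SimpleGraph.Walk.nil

/-- The link of `x` is a cycle, enumerated cyclically by `l`. -/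
structure IsLinkCycle (K : TwoComplex V) (x : V) {k : ℕ} (l : ZMod k → V) : Prop where
  three_le : 3 ≤ k
  injective : Function.Injective l
  adj_iff : ∀ a, K.graph.Adj x a ↔ a ∈ Set.range l
  triangle_iff : ∀ a b, ({x, a, b} : Set V) ∈ K.triangles ↔ ∃ i, s(a, b) = s(l i, l (i + 1))

/-- Interior vertices of a singular disc: the vertices whose link is a cycle. -/
def IsInterior (K : TwoComplex V) (x : V) : Prop :=
  ∃ (k : ℕ) (l : ZMod k → V), K.IsLinkCycle x l

/-- Every triple of pairwise adjacent vertices bounds a triangle. -/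
def NoEmptyTriangle (K : TwoComplex V) : Prop :=
  ∀ a b c, K.graph.Adj a b → K.graph.Adj b c → K.graph.Adj a c → ({a, b, c} : Set V) ∈ K.triangles

/-- `R` is a region (a set of triangles) bounded by the set of edges `E`: the edges that lie in an
odd number of triangles of `R` are exactly the edges in `E`. In a singular disc, there is exactly
one such region if `E` is the set of edges of a simple cycle, namely the one enclosed by it. -/
def IsRegion (K : TwoComplex V) (R : Set (Set V)) (E : Set (Sym2 V)) : Prop :=
  R ⊆ K.triangles ∧
    ∀ a b, K.graph.Adj a b → (Odd {t ∈ R | a ∈ t ∧ b ∈ t}.ncard ↔ s(a, b) ∈ E)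

end TwoComplex

/-! ### Metric simplicial complexes -/

/-- The angle between the sides of lengths `p`, `q` in a Euclidean triangle whose third side has
length `r`. -/
noncomputable def euclideanAngle (p q r : ℝ) : ℝ :=
  Real.arccos ((p ^ 2 + q ^ 2 - r ^ 2) / (2 * p * q))

/-- A metric simplicial complex: a flag simplicial complex (given by its one-skeleton) whose
triangles are Euclidean triangles. The piecewise Euclidean metric is given by the edge lengths.
The last field is the weak triangle inequality for angles in links. -/
structure MetricComplex (W : Type v) where
  graph : SimpleGraph W
  len : Sym2 W → ℝ
  len_pos : ∀ a b, graph.Adj a b → 0 < len s(a, b)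
  len_triangle : ∀ a b c, graph.Adj a b → graph.Adj b c → graph.Adj a c →
    len s(a, c) < len s(a, b) + len s(b, c)
  angle_triangle : ∀ x a b c, graph.Adj x a → graph.Adj x b → graph.Adj x c →
    graph.Adj a b → graph.Adj b c → graph.Adj a c →
    euclideanAngle (len s(x, a)) (len s(x, c)) (len s(a, c)) ≤
      euclideanAngle (len s(x, a)) (len s(x, b)) (len s(a, b)) +
        euclideanAngle (len s(x, b)) (len s(x, c)) (len s(b, c))

namespace MetricComplex

variable {W : Type v}

/-- The angle at `x` in the triangle `x a b`, i.e. the angular length of the edge `a b` of the link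
of `x`. -/
noncomputable def angle (X : MetricComplex W) (x a b : W) : ℝ :=
  euclideanAngle (X.len s(x, a)) (X.len s(x, b)) (X.len s(a, b))

/-- The angular length, in the link of `x`, of the path `c i, c (i + 1), …, c j`. -/
noncomputable def angularLength (X : MetricComplex W) (x : W) {k : ℕ} (c : ZMod k → W) (i j : ℕ) :
    ℝ :=
  ∑ m ∈ Finset.Ico i j, X.angle x (c (m : ZMod k)) (c ((m : ZMod k) + 1))

/-- In every link, every `2`-full simple cycle (of length at least four) has angular length at
least `2π`. A cycle is `2`-full if no two vertices with a common neighbour in the cycle are joined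
by an edge. -/
def LocallyLarge (X : MetricComplex W) : Prop :=
  ∀ (x : W) (k : ℕ) (c : ZMod k → W), 4 ≤ k → Function.Injective c →
    (∀ i, X.graph.Adj x (c i)) → (∀ i, X.graph.Adj (c i) (c (i + 1))) →
    (∀ i, ¬ X.graph.Adj (c i) (c (i + 2))) →
    2 * Real.pi ≤ X.angularLength x c 0 k

/-- Simply connected and locally `2π`-large. -/
def MetricallySystolic (X : MetricComplex W) : Prop :=
  (flagTwoSkeleton X.graph).SimplyConnected ∧ X.LocallyLarge

/-- A cycle of length `n` in `X`, i.e. a closed edge path. -/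
def IsCycle (X : MetricComplex W) {n : ℕ} (C : ZMod n → W) : Prop :=
  ∀ i, X.graph.Adj (C i) (C (i + 1))

end MetricComplex

/-! ### Singular discs and disc diagrams -/

/-- A singular disc together with its boundary cycle `bd` of length `n`: a finite, connected and
simply connected subcomplex of a triangulation of the plane, with the closed path `bd` running
around it.

Planarity is expressed combinatorially: when a two-cell (the outside of the disc) is glued to the
complex along `bd`, one obtains a closed surface. That is, every edge has exactly two sides,
counting the triangles containing it and the passages of `bd` through it, and the edges at a vertex
`x` form a single cycle, consecutive ones being joined by a triangle at `x` or by a passage of `bd`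
through `x`. As the complex is simply connected, this surface is a sphere, and the complex is the
complement of an open disc in it. -/
structure SingularDisc (n : ℕ) where
  V : Type u
  finite : Finite V
  cx : TwoComplex V
  bd : ZMod n → V
  simplyConnected : cx.SimplyConnected
  bd_adj : ∀ i, cx.graph.Adj (bd i) (bd (i + 1))
  two_sides : ∀ a b, cx.graph.Adj a b →
    {t ∈ cx.triangles | a ∈ t ∧ b ∈ t}.ncard + {i | s(bd i, bd (i + 1)) = s(a, b)}.ncard = 2
  link_connected : ∀ x a b, cx.graph.Adj x a → cx.graph.Adj x b →
    Relation.ReflTransGen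
      (fun p q => ({x, p, q} : Set V) ∈ cx.triangles ∨
        ∃ i, bd (i + 1) = x ∧ s(bd i, bd (i + 2)) = s(p, q)) a b

/-- A singular disc diagram for the cycle `C` in `X`: a simplicial map from a singular disc to `X`
which maps the boundary cycle to `C`. (As `X` is flag, a map of vertices is simplicial if it maps
adjacent vertices to adjacent or equal vertices.) -/
structure DiscDiagram {W : Type v} (X : MetricComplex W) {n : ℕ} (C : ZMod n → W) extends
    SingularDisc.{u} n where
  f : V → W
  simplicial : ∀ a b, cx.graph.Adj a b → X.graph.Adj (f a) (f b) ∨ f a = f b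
  f_bd : ∀ i, f (bd i) = C i

namespace DiscDiagram

variable {W : Type v} {X : MetricComplex W} {n : ℕ} {C : ZMod n → W}

/-- The number of triangles. -/
noncomputable def area (D : DiscDiagram.{u} X C) : ℕ := D.cx.triangles.ncard

/-- Minimal area among the singular disc diagrams for `C`. -/
def Minimal (D : DiscDiagram.{u} X C) : Prop :=
  ∀ D' : DiscDiagram.{u} X C, D.area ≤ D'.area

/-- The map is injective on all simplices, i.e. on all edges. -/
def Nondegenerate (D : DiscDiagram.{u} X C) : Prop :=
  ∀ a b, D.cx.graph.Adj a b → D.f a ≠ D.f b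

/-- Distinct triangles sharing an edge have distinct images. -/
def Reduced (D : DiscDiagram.{u} X C) : Prop :=
  ∀ s ∈ D.cx.triangles, ∀ t ∈ D.cx.triangles, s ≠ t → (s ∩ t).Nontrivial → D.f '' s ≠ D.f '' t

/-- The angular length of the path `l i, …, l j` in the link of `x`, where the simplices of the
disc carry the metric pulled back from `X`. -/
noncomputable def angularLength (D : DiscDiagram.{u} X C) (x : D.V) {k : ℕ} (l : ZMod k → D.V)
    (i j : ℕ) : ℝ :=
  X.angularLength (D.f x) (fun m => D.f (l m)) i j

/-- The link of every interior vertex has angular length at least `2π`. -/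
def IsCAT0 (D : DiscDiagram.{u} X C) : Prop :=
  ∀ (x : D.V) (k : ℕ) (l : ZMod k → D.V), D.cx.IsLinkCycle x l →
    2 * Real.pi ≤ D.angularLength x l 0 k

/-- A flat vertex: an interior vertex whose link has angular length exactly `2π`. -/
def IsFlat (D : DiscDiagram.{u} X C) (x : D.V) : Prop :=
  ∃ (k : ℕ) (l : ZMod k → D.V), D.cx.IsLinkCycle x l ∧ D.angularLength x l 0 k = 2 * Real.pi

/-- The map is injective on the vertices of the star of `x` (hence, being simplicial, on the
star). -/
def InjectiveOnStar (D : DiscDiagram.{u} X C) (x : D.V) : Prop :=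
  Set.InjOn D.f {y | y = x ∨ D.cx.graph.Adj x y}

/-- CAT(0), nondegenerate, reduced, and injective on the star of every flat vertex. -/
def FlatInjectiveCAT0 (D : DiscDiagram.{u} X C) : Prop :=
  D.IsCAT0 ∧ D.Nondegenerate ∧ D.Reduced ∧ ∀ x, D.IsFlat x → D.InjectiveOnStar x

/-! ### Moves

The result of each move is described up to isomorphism of diagrams. -/

/-- `D'` results from `D` by the A-move on `u, v, w`: these vertices are pairwise adjacent but do
not bound a triangle; all other vertices of the region bounded by the three edges are removed (with
all simplices containing them), and the triangle `u v w` is inserted. -/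
def AMoveOn (D D' : DiscDiagram.{u} X C) (u v w : D.V) : Prop :=
  D.cx.graph.Adj u v ∧ D.cx.graph.Adj v w ∧ D.cx.graph.Adj u w ∧
  ({u, v, w} : Set D.V) ∉ D.cx.triangles ∧
  ∃ R : Set (Set D.V), D.cx.IsRegion R {s(u, v), s(v, w), s(u, w)} ∧
  ∃ e : D'.V → D.V, Function.Injective e ∧
    (∀ x, x ∈ Set.range e ↔ x ∈ ({u, v, w} : Set D.V) ∨ ∀ t ∈ R, x ∉ t) ∧
    (∀ x, D'.f x = D.f (e x)) ∧
    (∀ i, e (D'.bd i) = D.bd i) ∧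
    (∀ a b, D'.cx.graph.Adj a b ↔ D.cx.graph.Adj (e a) (e b)) ∧
    (∀ t, t ∈ D'.cx.triangles ↔ e '' t ∈ D.cx.triangles ∨ e '' t = {u, v, w})

/-- An A-move. -/
def AMove (D D' : DiscDiagram.{u} X C) : Prop :=
  ∃ u v w, AMoveOn D D' u v w

/-- `D'` results from `D` by removing the edge `u v`, common to the triangles `u v w` and `u v z`,
and adding the edge `w z`; the map on the vertices is unchanged. -/
def IsFlip (D D' : DiscDiagram.{u} X C) (u v w z : D.V) : Prop :=
  ∃ e : D.V ≃ D'.V,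
    (∀ x, D'.f (e x) = D.f x) ∧
    (∀ i, D'.bd i = e (D.bd i)) ∧
    (∀ a b, D'.cx.graph.Adj (e a) (e b) ↔
      (D.cx.graph.Adj a b ∧ s(a, b) ≠ s(u, v)) ∨ s(a, b) = s(w, z)) ∧
    (∀ t : Set D.V, e '' t ∈ D'.cx.triangles ↔
      (t ∈ D.cx.triangles ∧ t ≠ {u, v, w} ∧ t ≠ {u, v, z}) ∨ t = {u, w, z} ∨ t = {v, w, z})

/-- A B-move: a flip of the edge `u v` in two triangles `u v w`, `u v z` such that `w`, `z` have the
same image. -/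
def BMove (D D' : DiscDiagram.{u} X C) : Prop :=
  D.cx.NoEmptyTriangle ∧ ∃ u v w z, ({u, v, w} : Set D.V) ∈ D.cx.triangles ∧
    ({u, v, z} : Set D.V) ∈ D.cx.triangles ∧ w ≠ z ∧ D.f w = D.f z ∧ IsFlip D D' u v w z

/-- A C-move: an edge `u₁ u₂` whose endpoints have the same image is collapsed to a vertex. The map
`q` is the quotient map on vertices. -/
def CMove (D D' : DiscDiagram.{u} X C) : Prop :=
  D.cx.NoEmptyTriangle ∧ ∃ u₁ u₂, D.cx.graph.Adj u₁ u₂ ∧ D.f u₁ = D.f u₂ ∧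
  ∃ q : D.V → D'.V, Function.Surjective q ∧
    (∀ a b, q a = q b ↔ a = b ∨ s(a, b) = s(u₁, u₂)) ∧
    (∀ x, D'.f (q x) = D.f x) ∧
    (∀ i, D'.bd i = q (D.bd i)) ∧
    (∀ x y, D'.cx.graph.Adj x y ↔ x ≠ y ∧ ∃ a b, D.cx.graph.Adj a b ∧ q a = x ∧ q b = y) ∧
    (∀ t, t ∈ D'.cx.triangles ↔
      ∃ s ∈ D.cx.triangles, ¬ (u₁ ∈ s ∧ u₂ ∈ s) ∧ t = q '' s)

/-- A D-move: a flip of an edge `v u`, where `v` is an interior vertex and the neighbours `w`, `z`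
of `u` in the link of `v` have adjacent images. -/
def DMove (D D' : DiscDiagram.{u} X C) : Prop :=
  D.cx.NoEmptyTriangle ∧ ∃ v u w z, D.cx.IsInterior v ∧ ({v, u, w} : Set D.V) ∈ D.cx.triangles ∧
    ({v, u, z} : Set D.V) ∈ D.cx.triangles ∧ w ≠ z ∧ X.graph.Adj (D.f w) (D.f z) ∧
    IsFlip D D' v u w z

/-- No A-, B- or C-move may be performed. -/
def NoABC (D : DiscDiagram.{u} X C) : Prop :=
  D.cx.NoEmptyTriangle ∧
  (∀ u v w z, ({u, v, w} : Set D.V) ∈ D.cx.triangles → ({u, v, z} : Set D.V) ∈ D.cx.triangles →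
    w ≠ z → D.f w ≠ D.f z) ∧
  (∀ a b, D.cx.graph.Adj a b → D.f a ≠ D.f b)

/-- The common first part of E- and F-moves, in which an interior vertex `v` is doubled. The
vertices of `D''` other than the copy `v₂` of `v` are the images under `r` of the vertices of `D`
(and `r v` is the other copy of `v`). The triangles of `D` in `S` (those containing `v` along one
of the two arcs of its link) get `v₂` in place of `v`, all other triangles are kept, and the
triangles in `extra` are added. -/
structure IsDoubling (D D'' : DiscDiagram.{u} X C) (v : D.V) (S : Set (Set D.V))
    (r : D.V → D''.V) (v₂ : D''.V) (extra : Set (Set D''.V)) : Prop where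
  copy_notMem : ∀ a, r a ≠ v₂
  cover : ∀ x, x = v₂ ∨ ∃ a, r a = x
  map_eq : ∀ a, D''.f (r a) = D.f a
  map_copy : D''.f v₂ = D.f v
  bd_eq : ∀ i, D''.bd i = r (D.bd i)
  triangles_iff : ∀ t, t ∈ D''.cx.triangles ↔
    (∃ s ∈ D.cx.triangles, s ∉ S ∧ t = r '' s) ∨
    (∃ s ∈ S, t = insert v₂ (r '' (s \ {v}))) ∨ t ∈ extra
  adj_iff : ∀ x y, D''.cx.graph.Adj x y ↔ x ≠ y ∧
    ((∃ a b, a ≠ v ∧ b ≠ v ∧ D.cx.graph.Adj a b ∧ r a = x ∧ r b = y) ∨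
      ∃ t ∈ D''.cx.triangles, x ∈ t ∧ y ∈ t)

/-- The triangles `x, l j, l (j + 1)` with `i ≤ j < k`. -/
def fan {V : Type u} (x : V) {k : ℕ} (l : ZMod k → V) (i : ℕ) : Set (Set V) :=
  {t | ∃ j : ℕ, i ≤ j ∧ j < k ∧ t = {x, l (j : ZMod k), l ((j : ZMod k) + 1)}}

/-- `D'` results from `D` by removing the vertex `x` and filling its link without new vertices: `D'`
is the union of the full subcomplex of `D` spanned by all vertices except `x`, and of triangles with
vertices in the link of `x`. The map `e` is the inclusion of the vertices. -/
def IsLinkFilling (D D' : DiscDiagram.{u} X C) (x : D.V) (e : D'.V → D.V) : Prop :=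
  Function.Injective e ∧ (∀ y, y ∈ Set.range e ↔ y ≠ x) ∧
  (∀ y, D'.f y = D.f (e y)) ∧
  (∀ i, e (D'.bd i) = D.bd i) ∧
  ∃ T : Set (Set D'.V), (∀ t ∈ T, ∀ y ∈ t, D.cx.graph.Adj x (e y)) ∧
    (∀ t, t ∈ D'.cx.triangles ↔ e '' t ∈ D.cx.triangles ∨ t ∈ T) ∧
    (∀ a b, D'.cx.graph.Adj a b ↔
      D.cx.graph.Adj (e a) (e b) ∨ (a ≠ b ∧ ∃ t ∈ T, a ∈ t ∧ b ∈ t))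

/-- An E-move. Here `v` is an interior vertex with two vertices `w = l 0`, `z = l m` in its link
having the same image and no common neighbour besides `v`, such that both arcs between them in the
link have angular length less than `2π`. In `D''`, the vertices `w`, `z` are identified and `v` is
doubled; afterwards, the links of the two copies of `v` are filled without interior vertices. -/
def EMove (D D' : DiscDiagram.{u} X C) : Prop :=
  D.NoABC ∧ ∃ (v : D.V) (k : ℕ) (l : ZMod k → D.V) (m : ℕ),
    D.cx.IsLinkCycle v l ∧ 0 < m ∧ m < k ∧ D.f (l 0) = D.f (l (m : ZMod k)) ∧
    (∀ y, D.cx.graph.Adj y (l 0) → D.cx.graph.Adj y (l (m : ZMod k)) → y = v) ∧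
    D.angularLength v l 0 m < 2 * Real.pi ∧ D.angularLength v l m k < 2 * Real.pi ∧
    ∃ (D'' : DiscDiagram.{u} X C) (r : D.V → D''.V) (v₂ : D''.V),
      (∀ a b, r a = r b ↔ a = b ∨ s(a, b) = s(l 0, l (m : ZMod k))) ∧
      IsDoubling D D'' v (fan v l m) r v₂ ∅ ∧
      ∃ (D₃ : DiscDiagram.{u} X C) (e : D₃.V → D''.V), IsLinkFilling D'' D₃ (r v) e ∧
        ∃ (y : D₃.V) (e' : D'.V → D₃.V), e y = v₂ ∧ IsLinkFilling D₃ D' y e'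

/-- An F-move. Here `v` is an interior vertex with two vertices `w = l 0`, `z = l m` in its link
having the same image and a common neighbour `u` besides `v`. In `D''`, the vertices `w`, `z` are
joined by an edge, and `v` is doubled, one copy on each side of this edge; afterwards, the A-move on
`u, w, z` is performed. -/
def FMove (D D' : DiscDiagram.{u} X C) : Prop :=
  D.NoABC ∧ ∃ (v : D.V) (k : ℕ) (l : ZMod k → D.V) (m : ℕ) (u : D.V),
    D.cx.IsLinkCycle v l ∧ 0 < m ∧ m < k ∧ D.f (l 0) = D.f (l (m : ZMod k)) ∧
    u ≠ v ∧ D.cx.graph.Adj u (l 0) ∧ D.cx.graph.Adj u (l (m : ZMod k)) ∧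
    ∃ (D'' : DiscDiagram.{u} X C) (r : D.V → D''.V) (v₂ : D''.V),
      Function.Injective r ∧
      IsDoubling D D'' v (fan v l m) r v₂
        {{r v, r (l 0), r (l (m : ZMod k))}, {v₂, r (l 0), r (l (m : ZMod k))}} ∧
      AMoveOn D'' D' (r u) (r (l 0)) (r (l (m : ZMod k)))

/-- One of the moves A, B, C, D, E, F. -/
def Move (D D' : DiscDiagram.{u} X C) : Prop :=
  AMove D D' ∨ BMove D D' ∨ CMove D D' ∨ DMove D D' ∨ EMove D D' ∨ FMove D D'

end DiscDiagram

/-! Call a diagram improvable if finitely many moves turn it into one of smaller area without new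
vertices. The theorem reduces to `improvable_of_not_flatInjectiveCAT0`: a diagram lacking one of the
desired properties is improvable. Strong induction on the area then produces the required diagram,
and a minimal diagram, being unimprovable, has all the properties. A-, B-, C- and D-moves suffice
for every improvement.

An empty triangle is improved by an A-move, and an edge with equal end images by an A- or C-move. If
two triangles share an edge and their opposite vertices have the same image (a fold), either these
vertices are already adjacent or a B-move makes them so, and the previous case applies. This settles
nondegeneracy and reducedness.

Now let the link of an interior vertex `x` be too short. A simple cycle of angular length less than
2π in a link of X is a 3-cycle or is not 2-full, so a chord cuts off one of its vertices. The
triangle inequality for angles keeps the remaining cycle short, and induction yields `exists_ear`: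
such a chord exists whose cut-off vertex avoids the ends of a prescribed edge. A D-move realizes
this chord in the diagram. The area is unchanged, and the link of `x` loses one vertex without
becoming longer. If the map is injective on the link, repetition leads to a link of three vertices,
which form an empty triangle (`improvable_of_injOn`). If two link vertices have the same image, the
arc between them is shortened in the same way until its ends are adjacent or form a fold
(`improvable_of_arc`). At a flat vertex the latter still applies, because an arc omitting an edge of
positive angle is shorter than 2π.

The rest shows that the moves can be carried out, that is, that filling, flipping and collapsing
yield singular discs. Planarity amounts to counting the sides of edges and to connectivity of links.
Simple connectivity is tested by one-cocycles with values in arbitrary groups: all of them are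
coboundaries exactly when a connected complex is simply connected. Unlike null-homotopies, cocycles
are easily transported between complexes that differ locally. -/

namespace TwoComplex

variable {V : Type u} {K : TwoComplex V}

/-! ### Edge-path homotopy and elementary facts on triangles. -/

theorem Homotopic.append_right {a b c : V} {p p' : K.graph.Walk a b} (h : K.Homotopic p p')
    (q : K.graph.Walk b c) : K.Homotopic (p.append q) (p'.append q) := by
  induction h with
  | refl p => exact .refl _
  | symm _ ih => exact .symm (ih q)
  | trans _ _ ih₁ ih₂ => exact .trans (ih₁ q) (ih₂ q)
  | cons h _ ih => exact .cons h (ih q)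
  | backtrack h h' p => exact .backtrack h h' _
  | triangle hab hbc hac ht p => exact .triangle hab hbc hac ht _

theorem Homotopic.append_left {a b c : V} (q : K.graph.Walk a b) {p p' : K.graph.Walk b c}
    (h : K.Homotopic p p') : K.Homotopic (q.append p) (q.append p') := by
  induction q with
  | nil => exact h
  | cons hab _ ih => exact .cons hab (ih h)

theorem Homotopic.append_reverse {a b : V} (q : K.graph.Walk a b) :
    K.Homotopic (q.append q.reverse) .nil := by
  induction q with
  | nil => exact .refl _
  | cons hab q ih =>
    rw [SimpleGraph.Walk.reverse_cons, SimpleGraph.Walk.cons_append,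
      SimpleGraph.Walk.append_assoc]
    exact (Homotopic.cons hab (ih.append_right _)).trans (.backtrack hab hab.symm .nil)

theorem Homotopic.reverse_append {a b : V} (q : K.graph.Walk a b) :
    K.Homotopic (q.reverse.append q) .nil := by
  simpa using Homotopic.append_reverse q.reverse

theorem Homotopic.cancel_middle {a b c d : V} (p : K.graph.Walk a b) (q : K.graph.Walk c b)
    (r : K.graph.Walk b d) :
    K.Homotopic ((p.append q.reverse).append (q.append r)) (p.append r) := by
  rw [← SimpleGraph.Walk.append_assoc, SimpleGraph.Walk.append_assoc q.reverse]
  exact Homotopic.append_left p ((Homotopic.reverse_append q).append_right r)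

/-- A triangle, being spanned by pairwise adjacent vertices, has three elements, so any enumeration
of it by three vertices is without repetition. -/
theorem ne_of_triangle {a b c : V} (h : ({a, b, c} : Set V) ∈ K.triangles) :
    a ≠ b ∧ b ≠ c ∧ a ≠ c := by
  obtain ⟨x, y, z, hxy, hyz, hxz, e⟩ := K.is_triangle _ h
  have hcard : ({a, b, c} : Set V).ncard = 3 := by
    rw [e, Set.ncard_eq_three]
    exact ⟨x, y, z, hxy.ne, hxz.ne, hyz.ne, rfl⟩
  refine ⟨?_, ?_, ?_⟩ <;> rintro rfl
  · rw [Set.insert_eq_of_mem (by simp)] at hcard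
    have := Set.ncard_insert_le a ({c} : Set V)
    simp at this; omega
  · rw [Set.pair_eq_singleton] at hcard
    have := Set.ncard_insert_le a ({b} : Set V)
    simp at this; omega
  · rw [Set.insert_eq_of_mem (by simp)] at hcard
    have := Set.ncard_insert_le b ({a} : Set V)
    simp at this; omega

theorem adj_of_mem_triangle {t : Set V} (ht : t ∈ K.triangles) {a b : V} (ha : a ∈ t) (hb : b ∈ t)
    (hab : a ≠ b) : K.graph.Adj a b := by
  obtain ⟨x, y, z, hxy, hyz, hxz, rfl⟩ := K.is_triangle _ ht
  simp only [Set.mem_insert_iff, Set.mem_singleton_iff] at ha hb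
  rcases ha with rfl | rfl | rfl <;> rcases hb with rfl | rfl | rfl <;>
    first | exact absurd rfl hab | assumption | (apply SimpleGraph.Adj.symm; assumption)

theorem exists_third {t : Set V} (ht : t ∈ K.triangles) {a b : V} (ha : a ∈ t) (hb : b ∈ t)
    (hab : a ≠ b) : ∃ c, t = {a, b, c} := by
  obtain ⟨x, y, z, hxy, hyz, hxz, rfl⟩ := K.is_triangle _ ht
  simp only [Set.mem_insert_iff, Set.mem_singleton_iff] at ha hb
  rcases ha with rfl | rfl | rfl <;> rcases hb with rfl | rfl | rfl
  · exact absurd rfl hab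
  · exact ⟨z, rfl⟩
  · exact ⟨y, by grind⟩
  · exact ⟨z, by grind⟩
  · exact absurd rfl hab
  · exact ⟨x, by grind⟩
  · exact ⟨y, by grind⟩
  · exact ⟨x, by grind⟩
  · exact absurd rfl hab

theorem exists_other_two {t : Set V} (ht : t ∈ K.triangles) {a : V} (ha : a ∈ t) :
    ∃ b c, t = {a, b, c} := by
  obtain ⟨x, y, z, hxy, hyz, hxz, rfl⟩ := K.is_triangle _ ht
  simp only [Set.mem_insert_iff, Set.mem_singleton_iff] at ha
  rcases ha with rfl | rfl | rfl
  · exact ⟨y, z, rfl⟩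
  · exact ⟨x, z, by grind⟩
  · exact ⟨x, y, by grind⟩

/-! ### Simple connectivity through nonabelian one-cocycles. -/

/-- A one-cocycle with values in a group. -/
structure IsCocycle {G : Type*} [Group G] (K : TwoComplex V) (φ : V → V → G) : Prop where
  mul_swap : ∀ a b, K.graph.Adj a b → φ a b * φ b a = 1
  mul_triangle : ∀ a b c, ({a, b, c} : Set V) ∈ K.triangles → φ a b * φ b c = φ a c

/-- A cochain is the coboundary of a function on the vertices. -/
def IsCoboundary {G : Type*} [Group G] (K : TwoComplex V) (φ : V → V → G) : Prop :=
  ∃ h : V → G, ∀ a b, K.graph.Adj a b → φ a b = (h a)⁻¹ * h b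

/-- The product of the values of a cochain along a walk. -/
def holonomy {G : Type*} [Group G] (φ : V → V → G) {H : SimpleGraph V} :
    ∀ {a b : V}, H.Walk a b → G
  | _, _, .nil => 1
  | _, _, @SimpleGraph.Walk.cons _ _ a b _ _ p => φ a b * holonomy φ p

section Holonomy

variable {G : Type*} [Group G] {φ : V → V → G}

theorem holonomy_append {H : SimpleGraph V} {a b c : V} (p : H.Walk a b) (q : H.Walk b c) :
    holonomy φ (p.append q) = holonomy φ p * holonomy φ q := by
  induction p with
  | nil => simp [holonomy]
  | cons h p ih => simp [holonomy, ih, mul_assoc]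

/-- The two cocycle conditions are exactly invariance of the holonomy under the two generating
homotopies, backtracks and triangles. -/
theorem IsCocycle.holonomy_eq (hφ : K.IsCocycle φ) {a b : V} {p q : K.graph.Walk a b}
    (h : K.Homotopic p q) : holonomy φ p = holonomy φ q := by
  induction h with
  | refl p => rfl
  | symm _ ih => exact ih.symm
  | trans _ _ ih₁ ih₂ => exact ih₁.trans ih₂
  | cons h _ ih => simp [holonomy, ih]
  | backtrack h h' p => simp [holonomy, ← mul_assoc, hφ.mul_swap _ _ h]
  | triangle hab hbc hac ht p => simp [holonomy, ← mul_assoc, hφ.mul_triangle _ _ _ ht]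

/-- A potential at `x` is the holonomy along a chosen walk from a base point. It is compatible with
every edge because closed walks, being null-homotopic, have trivial holonomy. -/
theorem SimplyConnected.isCoboundary (hK : K.SimplyConnected) (hφ : K.IsCocycle φ) :
    K.IsCoboundary φ := by
  obtain ⟨a⟩ := hK.1.nonempty
  have w : ∀ x, K.graph.Walk a x := fun x => (hK.1.preconnected a x).some
  have closed : ∀ p : K.graph.Walk a a, holonomy φ p = 1 := fun p => hφ.holonomy_eq (hK.2 a p)
  refine ⟨fun x => holonomy φ (w x), fun x y hxy => ?_⟩
  have h₁ := closed (((w x).append (.cons hxy .nil)).append (w y).reverse)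
  have h₂ := closed ((w y).append (w y).reverse)
  rw [holonomy_append] at h₁ h₂
  rw [← h₂] at h₁
  have h₃ := mul_right_cancel h₁
  rw [holonomy_append] at h₃
  change _ = (holonomy φ (w x))⁻¹ * holonomy φ (w y)
  rw [← h₃]
  simp [holonomy]

end Holonomy

theorem isEquivalence_homotopic (a b : V) :
    Equivalence (fun p q : K.graph.Walk a b => K.Homotopic p q) :=
  ⟨.refl, .symm, .trans⟩

/-- Closed walks up to homotopy. -/
def LoopClass (K : TwoComplex V) (a : V) : Type u :=
  Quotient (⟨_, isEquivalence_homotopic (K := K) a a⟩ : Setoid (K.graph.Walk a a))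

/-- The class of a closed walk. -/
def LoopClass.mk {a : V} (p : K.graph.Walk a a) : K.LoopClass a := Quotient.mk _ p

theorem LoopClass.mk_eq_mk {a : V} {p q : K.graph.Walk a a} :
    LoopClass.mk p = LoopClass.mk q ↔ K.Homotopic p q :=
  ⟨fun h => Quotient.exact h, fun h => Quotient.sound h⟩

/-- Multiplication by a closed walk. -/
def LoopClass.mulLeft {a : V} (p : K.graph.Walk a a) : K.LoopClass a → K.LoopClass a :=
  Quotient.map (fun q => p.append q) fun _ _ h => Homotopic.append_left p h

theorem LoopClass.mulLeft_mulLeft {a : V} {p q r : K.graph.Walk a a}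
    (h : K.Homotopic (p.append q) r) (x : K.LoopClass a) :
    mulLeft p (mulLeft q x) = mulLeft r x := by
  induction x using Quotient.inductionOn with
  | h s =>
    refine Quotient.sound ?_
    change K.Homotopic (p.append (q.append s)) (r.append s)
    rw [SimpleGraph.Walk.append_assoc]
    exact h.append_right s

theorem LoopClass.mulLeft_of_null {a : V} {p : K.graph.Walk a a} (h : K.Homotopic p .nil)
    (x : K.LoopClass a) : mulLeft p x = x := by
  induction x using Quotient.inductionOn with
  | h s => exact Quotient.sound (h.append_right s)

/-- Multiplication by a closed walk, as a permutation. -/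
def LoopClass.perm {a : V} (p : K.graph.Walk a a) : Equiv.Perm (K.LoopClass a) where
  toFun := mulLeft p
  invFun := mulLeft p.reverse
  left_inv x := by
    rw [mulLeft_mulLeft (.refl _), mulLeft_of_null (Homotopic.reverse_append p)]
  right_inv x := by
    rw [mulLeft_mulLeft (.refl _), mulLeft_of_null (Homotopic.append_reverse p)]

theorem LoopClass.perm_mul {a : V} {p q r : K.graph.Walk a a}
    (h : K.Homotopic (p.append q) r) : perm p * perm q = perm r :=
  Equiv.ext fun x => mulLeft_mulLeft h x

theorem LoopClass.perm_eq_one {a : V} {p : K.graph.Walk a a}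
    (h : K.Homotopic p .nil) : perm p = 1 :=
  Equiv.ext fun x => mulLeft_of_null h x

open Classical in
-- The test cocycle is the tautological one. An edge is closed up to a loop through chosen walks
-- from a base point, and acts on homotopy classes of loops by concatenation. Permutations of
-- `LoopClass` serve as coefficients, so the fundamental group need not be constructed. If this
-- cocycle is a coboundary, every loop acts trivially, and its action on the class of the constant
-- loop shows that it is null-homotopic.
theorem simplyConnected_of_isCoboundary (hc : K.graph.Connected)
    (H : ∀ (G : Type u) [Group G] (φ : V → V → G), K.IsCocycle φ → K.IsCoboundary φ) :
    K.SimplyConnected := by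
  refine ⟨hc, fun a p => ?_⟩
  have w : ∀ x, K.graph.Walk a x := fun x => (hc.preconnected a x).some
  let L : ∀ {x y : V}, K.graph.Walk x y → K.graph.Walk a a :=
    fun {x y} r => ((w x).append r).append (w y).reverse
  have L_mul : ∀ {x y z : V} (r : K.graph.Walk x y) (s : K.graph.Walk y z),
      LoopClass.perm (L r) * LoopClass.perm (L s) = LoopClass.perm (L (r.append s)) := by
    intro x y z r s
    apply LoopClass.perm_mul
    have := Homotopic.cancel_middle ((w x).append r) (w y) (s.append (w z).reverse)
    simpa only [L, SimpleGraph.Walk.append_assoc] using this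
  have L_congr : ∀ {x y : V} {r s : K.graph.Walk x y}, K.Homotopic r s →
      LoopClass.perm (L r) = LoopClass.perm (L s) := by
    intro x y r s h
    have e : K.Homotopic (L r) (L s) := (Homotopic.append_left _ h).append_right _
    rw [← LoopClass.perm_mul (p := L r) (q := .nil) (r := L s) (by simpa using e),
      LoopClass.perm_eq_one (.refl _), mul_one]
  have L_nil : ∀ x, LoopClass.perm (L (.nil : K.graph.Walk x x)) = 1 := fun x =>
    LoopClass.perm_eq_one (by simpa [L] using Homotopic.append_reverse (w x))
  let φ : V → V → Equiv.Perm (K.LoopClass a) := fun x y =>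
    if h : K.graph.Adj x y then LoopClass.perm (L (.cons h .nil)) else 1
  have φ_adj : ∀ {x y} (h : K.graph.Adj x y), φ x y = LoopClass.perm (L (.cons h .nil)) :=
    fun h => dif_pos h
  have hφ : K.IsCocycle φ := by
    refine ⟨fun x y h => ?_, fun x y z h => ?_⟩
    · rw [φ_adj h, φ_adj h.symm, L_mul, ← L_nil x]
      exact L_congr (.backtrack h h.symm .nil)
    · obtain ⟨h₁, h₂, h₃⟩ := ne_of_triangle h
      have hxy := adj_of_mem_triangle h (a := x) (b := y) (by simp) (by simp) h₁
      have hyz := adj_of_mem_triangle h (a := y) (b := z) (by simp) (by simp) h₂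
      have hxz := adj_of_mem_triangle h (a := x) (b := z) (by simp) (by simp) h₃
      rw [φ_adj hxy, φ_adj hyz, φ_adj hxz, L_mul]
      exact L_congr (.triangle hxy hyz hxz h .nil)
  obtain ⟨g, hg⟩ := H _ φ hφ
  have hol : ∀ {x y : V} (r : K.graph.Walk x y), LoopClass.perm (L r) = (g x)⁻¹ * g y := by
    intro x y r
    induction r with
    | nil => simp [L_nil]
    | cons h r ih =>
      have := L_mul (.cons h .nil) r
      rw [SimpleGraph.Walk.cons_append, SimpleGraph.Walk.nil_append] at this
      rw [← this, ih, ← φ_adj h, hg _ _ h]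
      group
  have h1 : LoopClass.perm (L p) = 1 := by rw [hol]; group
  have h2 : LoopClass.mk (L p) = LoopClass.mk .nil := by
    have := congrArg (fun e => e (LoopClass.mk .nil)) h1
    change LoopClass.mk ((L p).append .nil) = LoopClass.mk .nil at this
    simpa using this
  have h3 := LoopClass.mk_eq_mk.1 h2
  -- The chosen walk `w a` need not be constant, so `L p` is only a conjugate of `p`; the
  -- conjugation is undone here.
  have h4 := (Homotopic.append_left (w a).reverse h3).append_right (w a)
  have h5 : K.Homotopic (((w a).reverse.append (L p)).append (w a)) p := by
    have e1 : (((w a).reverse.append (L p)).append (w a)) =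
        ((w a).reverse.append (w a)).append (p.append ((w a).reverse.append (w a))) := by
      simp only [L, SimpleGraph.Walk.append_assoc]
    rw [e1]
    refine ((Homotopic.reverse_append (w a)).append_right _).trans ?_
    rw [SimpleGraph.Walk.nil_append]
    simpa using Homotopic.append_left p (Homotopic.reverse_append (w a))
  refine h5.symm.trans (h4.trans ?_)
  simpa using Homotopic.reverse_append (w a)

end TwoComplex

/-! ### Homology modulo two and the region inside a triangle of edges. -/

namespace TwoComplex

variable {V : Type u} {K : TwoComplex V}

open Classical in
/-- The coefficient of the edge `a b` in the boundary of a two-chain modulo two. -/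
noncomputable def boundaryCoeff [Fintype V] (c : Set V → ZMod 2) (a b : V) : ZMod 2 :=
  ∑ t : Set V, if a ∈ t ∧ b ∈ t then c t else 0

open Classical in
/-- Homotopic walks are homologous modulo two. -/
theorem Homotopic.exists_chain [Fintype V] {x y : V} {p q : K.graph.Walk x y}
    (h : K.Homotopic p q) :
    ∃ c : Set V → ZMod 2, (∀ t, c t ≠ 0 → t ∈ K.triangles) ∧ ∀ a b, a ≠ b →
      boundaryCoeff c a b = (p.edges.count s(a, b) : ZMod 2) + q.edges.count s(a, b) := by
  have two : ∀ z : ZMod 2, z + z = 0 := by decide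
  induction h with
  | refl p => exact ⟨0, by simp, fun a b _ => by simp [boundaryCoeff, two]⟩
  | symm _ ih =>
    obtain ⟨c, h₁, h₂⟩ := ih
    exact ⟨c, h₁, fun a b hab => by rw [h₂ a b hab, add_comm]⟩
  | trans _ _ ih₁ ih₂ =>
    obtain ⟨c, h₁, h₂⟩ := ih₁
    obtain ⟨d, h₃, h₄⟩ := ih₂
    refine ⟨c + d, fun t ht => ?_, fun a b hab => ?_⟩
    · by_cases hc : c t = 0
      · exact h₃ t (by simpa [hc] using ht)
      · exact h₁ t hc
    · have : boundaryCoeff (c + d) a b = boundaryCoeff c a b + boundaryCoeff d a b := by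
        rw [boundaryCoeff, boundaryCoeff, boundaryCoeff, ← Finset.sum_add_distrib]
        exact Finset.sum_congr rfl fun t _ => by split_ifs <;> simp
      rw [this, h₂ a b hab, h₄ a b hab]
      have := two (List.count s(a, b) (SimpleGraph.Walk.edges ‹_›) : ZMod 2)
      grind
  | cons h _ ih =>
    obtain ⟨c, h₁, h₂⟩ := ih
    refine ⟨c, h₁, fun a b hab => ?_⟩
    rw [h₂ a b hab, SimpleGraph.Walk.edges_cons, SimpleGraph.Walk.edges_cons, List.count_cons,
      List.count_cons]
    push_cast
    split_ifs
    · linear_combination -two 1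
    · ring
  | @backtrack x y _ h h' p =>
    refine ⟨0, by simp, fun a b _ => ?_⟩
    rw [SimpleGraph.Walk.edges_cons, SimpleGraph.Walk.edges_cons, List.count_cons,
      List.count_cons, Sym2.eq_swap (a := y) (b := x)]
    push_cast
    have h2 := two (List.count s(a, b) p.edges)
    simp only [boundaryCoeff, Pi.zero_apply, ite_self, Finset.sum_const_zero]
    split_ifs
    · linear_combination -two 1 - h2
    · linear_combination - h2
  | @triangle x y z _ hab hbc hac ht p =>
    -- The chain is the single triangle across which the walk is pushed; its boundary consists of
    -- the three edges by which the two walks differ.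
    refine ⟨Pi.single {x, y, z} 1, fun t h => ?_, fun a b hne => ?_⟩
    · by_contra h'
      refine h (Pi.single_eq_of_ne ?_ _)
      rintro rfl
      exact h' ht
    · have e : boundaryCoeff (Pi.single {x, y, z} 1) a b =
          if a ∈ ({x, y, z} : Set V) ∧ b ∈ ({x, y, z} : Set V) then 1 else 0 := by
        rw [boundaryCoeff, Finset.sum_eq_single {x, y, z}]
        · simp
        · intro t _ h; simp [Pi.single_eq_of_ne h]
        · simp
      rw [e, SimpleGraph.Walk.edges_cons, SimpleGraph.Walk.edges_cons,
        SimpleGraph.Walk.edges_cons, List.count_cons, List.count_cons, List.count_cons]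
      push_cast
      have h2 := two (List.count s(a, b) p.edges)
      have n1 := hab.ne
      have n2 := hbc.ne
      have n3 := hac.ne
      simp only [Set.mem_insert_iff, Set.mem_singleton_iff, beq_iff_eq, Sym2.eq_iff]
      have h3 := two 1
      have key : (if (a = x ∨ a = y ∨ a = z) ∧ (b = x ∨ b = y ∨ b = z) then (1 : ZMod 2) else 0) =
          (if y = a ∧ z = b ∨ y = b ∧ z = a then 1 else 0) +
          (if x = a ∧ y = b ∨ x = b ∧ y = a then 1 else 0) +
          (if x = a ∧ z = b ∨ x = b ∧ z = a then 1 else 0) := by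
        split_ifs <;> grind
      rw [key]
      linear_combination -h2

theorem natCast_zmod_two_eq_one_iff (m : ℕ) : (m : ZMod 2) = 1 ↔ Odd m := by
  exact ZMod.natCast_eq_one_iff_odd

/-- In a simply connected complex, every triple of pairwise adjacent vertices bounds a region. -/
theorem SimplyConnected.exists_isRegion [Finite V] (hK : K.SimplyConnected) {u v w : V}
    (huv : K.graph.Adj u v) (hvw : K.graph.Adj v w) (huw : K.graph.Adj u w) :
    ∃ R, K.IsRegion R {s(u, v), s(v, w), s(u, w)} := by
  classical
  have := Fintype.ofFinite V
  -- The closed walk around the three edges is null-homotopic, hence bounds a two-chain modulo two;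
  -- the region is the support of that chain.
  obtain ⟨c, h₁, h₂⟩ := (hK.2 u (.cons huv (.cons hvw (.cons huw.symm .nil)))).exists_chain
  refine ⟨{t | c t = 1}, fun t ht => h₁ t ?_, ?_⟩
  · have ht : c t = 1 := ht
    rw [ht]; decide
  intro a b hab
  rw [← natCast_zmod_two_eq_one_iff]
  have e : (({t ∈ {t | c t = 1} | a ∈ t ∧ b ∈ t}.ncard : ℕ) : ZMod 2) = boundaryCoeff c a b := by
    rw [boundaryCoeff, Set.ncard_eq_toFinset_card', Finset.card_eq_sum_ones]
    push_cast
    rw [← Finset.sum_filter, Set.toFinset_ofPred]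
    simp only [Set.mem_ofPred_eq]
    rw [Finset.sum_filter, Finset.sum_filter]
    refine Finset.sum_congr rfl fun t _ => ?_
    have : ∀ z : ZMod 2, z = 0 ∨ z = 1 := by decide
    rcases this (c t) with h | h <;> simp [h]
  rw [e, h₂ a b hab.ne]
  have n1 := huv.ne
  have n2 := hvw.ne
  have n3 := huw.ne
  simp only [SimpleGraph.Walk.edges_cons, SimpleGraph.Walk.edges_nil, List.count_cons,
    List.count_nil, beq_iff_eq, Sym2.eq_iff, Set.mem_insert_iff, Set.mem_singleton_iff]
  push_cast
  have := hab.ne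
  split_ifs <;> grind

theorem pair_mem_triangle_comm (a b c : V) : ({a, b, c} : Set V) = {a, c, b} := by
  grind

end TwoComplex

/-! ### Sides of edges, and the absence of closed subsurfaces. -/

namespace SingularDisc

variable {n : ℕ} (D : SingularDisc.{u} n)

/-- The triangles containing `a` and `b`. -/
def trianglesAt (a b : D.V) : Set (Set D.V) := {t ∈ D.cx.triangles | a ∈ t ∧ b ∈ t}

/-- The passages of the boundary cycle through the edge `a b`. -/
def passages (a b : D.V) : Set (ZMod n) := {i | s(D.bd i, D.bd (i + 1)) = s(a, b)}

theorem trianglesAt_comm (a b : D.V) : D.trianglesAt a b = D.trianglesAt b a := by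
  simp only [trianglesAt, and_comm]

theorem passages_comm (a b : D.V) : D.passages a b = D.passages b a := by
  simp only [passages, Sym2.eq_swap (a := a) (b := b)]

/-- Two neighbours of `x` are consecutive in the link of `x` (closed up by the outer face). -/
def LinkRel (x p q : D.V) : Prop :=
  ({x, p, q} : Set D.V) ∈ D.cx.triangles ∨ ∃ i, D.bd (i + 1) = x ∧ s(D.bd i, D.bd (i + 2)) = s(p, q)

theorem finite_triangles : D.cx.triangles.Finite :=
  have := D.finite
  Set.toFinite _

theorem finite_trianglesAt (a b : D.V) : (D.trianglesAt a b).Finite :=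
  D.finite_triangles.subset fun _ h => h.1

variable {D}

theorem ncard_add_ncard {a b : D.V} (h : D.cx.graph.Adj a b) :
    (D.trianglesAt a b).ncard + (D.passages a b).ncard = 2 :=
  D.two_sides a b h

theorem LinkRel.symm {x p q : D.V} (h : D.LinkRel x p q) : D.LinkRel x q p := by
  rcases h with h | ⟨i, h, e⟩
  · exact .inl (by rwa [TwoComplex.pair_mem_triangle_comm])
  · exact .inr ⟨i, h, e.trans Sym2.eq_swap⟩

theorem bd_adj_succ (D : SingularDisc.{u} n) (i : ZMod n) :
    D.cx.graph.Adj (D.bd (i + 1)) (D.bd (i + 2)) := by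
  have := D.bd_adj (i + 1)
  rwa [add_assoc, one_add_one_eq_two] at this

theorem mem_passages_succ (D : SingularDisc.{u} n) (i : ZMod n) :
    i + 1 ∈ D.passages (D.bd (i + 1)) (D.bd (i + 2)) := by
  change s(_, D.bd (i + 1 + 1)) = _
  rw [add_assoc, one_add_one_eq_two]

theorem passages_nonempty_of_bd {x p q : D.V} {i : ZMod n} (h : D.bd (i + 1) = x)
    (e : s(D.bd i, D.bd (i + 2)) = s(p, q)) :
    (D.passages x p).Nonempty ∧ (D.passages x q).Nonempty := by
  subst h
  have h₁ : i ∈ D.passages (D.bd (i + 1)) (D.bd i) := by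
    rw [passages_comm]; rfl
  have h₂ := D.mem_passages_succ i
  rcases Sym2.eq_iff.1 e with ⟨rfl, rfl⟩ | ⟨rfl, rfl⟩
  · exact ⟨⟨_, h₁⟩, ⟨_, h₂⟩⟩
  · exact ⟨⟨_, h₂⟩, ⟨_, h₁⟩⟩

/-- Consecutive neighbours are joined by a triangle or both edges lie on the boundary. -/
theorem LinkRel.triangle_or_passages {x p q : D.V} (h : D.LinkRel x p q) :
    ({x, p, q} : Set D.V) ∈ D.cx.triangles ∨
      ((D.passages x p).Nonempty ∧ (D.passages x q).Nonempty) :=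
  h.imp id fun ⟨_, h, e⟩ => passages_nonempty_of_bd h e

theorem LinkRel.adj {x p q : D.V} (h : D.LinkRel x p q) :
    D.cx.graph.Adj x p ∧ D.cx.graph.Adj x q := by
  rcases h with h | ⟨i, rfl, e⟩
  · obtain ⟨h₁, h₂, h₃⟩ := TwoComplex.ne_of_triangle h
    exact ⟨TwoComplex.adj_of_mem_triangle h (by simp) (by simp) h₁,
      TwoComplex.adj_of_mem_triangle h (by simp) (by simp) h₃⟩
  · have h₁ := (D.bd_adj i).symm
    have h₂ := D.bd_adj_succ i
    rcases Sym2.eq_iff.1 e with ⟨rfl, rfl⟩ | ⟨rfl, rfl⟩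
    · exact ⟨h₁, h₂⟩
    · exact ⟨h₂, h₁⟩

theorem finite_passages [NeZero n] (D : SingularDisc.{u} n) (a b : D.V) : (D.passages a b).Finite :=
  Set.toFinite _

theorem passages_eq_empty_of_two [NeZero n] {a b : D.V} (hab : a ≠ b) {s t : Set D.V}
    (hs : s ∈ D.trianglesAt a b) (ht : t ∈ D.trianglesAt a b) (hst : s ≠ t) : D.passages a b = ∅ := by
  have h := ncard_add_ncard (TwoComplex.adj_of_mem_triangle hs.1 hs.2.1 hs.2.2 hab)
  have h₁ : 2 ≤ (D.trianglesAt a b).ncard := by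
    rw [← Set.ncard_pair hst]
    exact Set.ncard_le_ncard (by grind) (D.finite_trianglesAt a b)
  rw [← Set.ncard_eq_zero (D.finite_passages a b)]
  omega

theorem trianglesAt_eq_pair {a b : D.V} (hab : a ≠ b) {s t : Set D.V} (hs : s ∈ D.trianglesAt a b)
    (ht : t ∈ D.trianglesAt a b) (hst : s ≠ t) : D.trianglesAt a b = {s, t} := by
  have h := ncard_add_ncard (TwoComplex.adj_of_mem_triangle hs.1 hs.2.1 hs.2.2 hab)
  symm
  refine Set.eq_of_subset_of_ncard_le (by grind) ?_ (D.finite_trianglesAt a b)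
  rw [Set.ncard_pair hst]
  omega

/-- An edge not on the boundary lies in exactly two triangles. -/
theorem exists_two_triangles {a b : D.V} (h : D.cx.graph.Adj a b) (hp : D.passages a b = ∅) :
    ∃ c d, c ≠ d ∧ D.trianglesAt a b = {{a, b, c}, {a, b, d}} := by
  have h₁ := ncard_add_ncard h
  rw [hp, Set.ncard_empty, add_zero, Set.ncard_eq_two] at h₁
  obtain ⟨s, t, hst, e⟩ := h₁
  have hs : s ∈ D.trianglesAt a b := by simp [e]
  have ht : t ∈ D.trianglesAt a b := by simp [e]
  obtain ⟨c, rfl⟩ := TwoComplex.exists_third hs.1 hs.2.1 hs.2.2 h.ne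
  obtain ⟨d, rfl⟩ := TwoComplex.exists_third ht.1 ht.2.1 ht.2.2 h.ne
  exact ⟨c, d, fun e => hst (by rw [e]), e⟩

/-- A singular disc contains no closed subsurface. -/
theorem not_closed_subsurface [NeZero n] {S : Set (Set D.V)} (hS : S ⊆ D.cx.triangles)
    (hne : S.Nonempty)
    (hcl : ∀ t ∈ S, ∀ a ∈ t, ∀ b ∈ t, a ≠ b → ∃ s ∈ S, s ≠ t ∧ a ∈ s ∧ b ∈ s) : False := by
  -- Two triangles of `S` already use up both sides of the edge, so no other triangle and no
  -- boundary passage is left.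
  have two : ∀ a b, a ≠ b → (∃ t ∈ S, a ∈ t ∧ b ∈ t) →
      D.passages a b = ∅ ∧ D.trianglesAt a b ⊆ S := by
    rintro a b hab ⟨t, ht, ha, hb⟩
    obtain ⟨s, hs, hst, ha', hb'⟩ := hcl t ht a ha b hb hab
    have h₁ : s ∈ D.trianglesAt a b := ⟨hS hs, ha', hb'⟩
    have h₂ : t ∈ D.trianglesAt a b := ⟨hS ht, ha, hb⟩
    refine ⟨passages_eq_empty_of_two hab h₁ h₂ hst, ?_⟩
    rw [trianglesAt_eq_pair hab h₁ h₂ hst]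
    grind
  -- Walking around the connected link never leaves `S`, since one could leave only across an edge
  -- of `S`.
  have star : ∀ x, (∃ t ∈ S, x ∈ t) → ∀ b, D.cx.graph.Adj x b → ∃ t ∈ S, x ∈ t ∧ b ∈ t := by
    rintro x ⟨t, ht, hx⟩ b hb
    obtain ⟨a, c, rfl⟩ := TwoComplex.exists_other_two (hS ht) hx
    have hxa := (TwoComplex.ne_of_triangle (hS ht)).1
    have := D.link_connected x a b
      (TwoComplex.adj_of_mem_triangle (hS ht) (by simp) (by simp) hxa) hb
    induction this with
    | refl => exact ⟨_, ht, by simp, by simp⟩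
    | @tail p q _ hpq ih =>
      have hpq : D.LinkRel x p q := hpq
      have ih := ih hpq.adj.1
      obtain ⟨h₁, h₂⟩ := two x p hpq.adj.1.ne ih
      rcases hpq.triangle_or_passages with h | h
      · exact ⟨_, h₂ ⟨h, by simp, by simp⟩, by simp, by simp⟩
      · simp [h₁] at h
  -- Connectedness spreads `S` over the whole disc. Then the boundary edge starting at `bd 0` has
  -- both sides in `S`, although the boundary passes through it.
  have all : ∀ x, ∃ t ∈ S, x ∈ t := by
    obtain ⟨t, ht⟩ := hne
    obtain ⟨a, b, c, -, -, -, rfl⟩ := D.cx.is_triangle t (hS ht)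
    intro x
    obtain ⟨p⟩ := D.simplyConnected.1.preconnected a x
    have ha : ∃ t ∈ S, a ∈ t := ⟨_, ht, by simp⟩
    clear ht
    induction p with
    | nil => exact ha
    | cons h p ih =>
      obtain ⟨t, ht, -, hb⟩ := star _ ha _ h
      exact ih ⟨t, ht, hb⟩
  have h := D.bd_adj 0
  have := (two _ _ h.ne (star _ (all _) _ h)).1
  have h0 : (0 : ZMod n) ∈ D.passages (D.bd 0) (D.bd (0 + 1)) := rfl
  rw [this] at h0
  exact h0

/-- A singular disc does not contain the boundary of a tetrahedron. -/
theorem not_tetrahedron [NeZero n] {a b c d : D.V} (h₁ : ({a, b, c} : Set D.V) ∈ D.cx.triangles)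
    (h₂ : ({a, b, d} : Set D.V) ∈ D.cx.triangles) (h₃ : ({a, c, d} : Set D.V) ∈ D.cx.triangles)
    (h₄ : ({b, c, d} : Set D.V) ∈ D.cx.triangles) : False := by
  obtain ⟨n1, n2, n3⟩ := TwoComplex.ne_of_triangle h₁
  obtain ⟨-, n4, n5⟩ := TwoComplex.ne_of_triangle h₂
  obtain ⟨-, n6, -⟩ := TwoComplex.ne_of_triangle h₃
  have mem : ∀ e ∈ ({a, b, c, d} : Set D.V), ({a, b, c, d} \ {e} : Set D.V) ∈ D.cx.triangles := by
    have e1 : ({a, b, c, d} \ {d} : Set D.V) = {a, b, c} := by grind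
    have e2 : ({a, b, c, d} \ {c} : Set D.V) = {a, b, d} := by grind
    have e3 : ({a, b, c, d} \ {b} : Set D.V) = {a, c, d} := by grind
    have e4 : ({a, b, c, d} \ {a} : Set D.V) = {b, c, d} := by grind
    rintro e (rfl | rfl | rfl | rfl)
    · rwa [e4]
    · rwa [e3]
    · rwa [e2]
    · rwa [e1]
  refine not_closed_subsurface
    (S := (fun e => ({a, b, c, d} \ {e} : Set D.V)) '' {a, b, c, d}) ?_ ⟨_, a, by simp, rfl⟩ ?_
  · rintro _ ⟨e, he, rfl⟩
    exact mem e he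
  · rintro _ ⟨e, he, rfl⟩ x hx y hy hxy
    -- For the face opposite `e` and its edge `x y`, the other face at this edge is opposite the
    -- remaining vertex `g`.
    obtain ⟨g, hg, h1, h2, h3⟩ : ∃ g ∈ ({a, b, c, d} : Set D.V), g ≠ e ∧ g ≠ x ∧ g ≠ y := by
      by_contra! hn
      replace hn : ∀ g ∈ ({a, b, c, d} : Set D.V), g = e ∨ g = x ∨ g = y := fun g hg => by
        have := hn g hg
        tauto
      have ha := hn a (by simp)
      have hb := hn b (by simp)
      have hc := hn c (by simp)
      have hd := hn d (by simp)
      clear hn mem hx hy he h₁ h₂ h₃ h₄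
      grind
    exact ⟨_, ⟨g, hg, rfl⟩, fun h => by
      have : g ∈ ({a, b, c, d} \ {e} : Set D.V) := ⟨hg, h1⟩
      exact ((Set.ext_iff.1 h g).2 this).2 rfl, ⟨hx.1, h2.symm⟩, ⟨hy.1, h3.symm⟩⟩

end SingularDisc

/-! ### Parity in the link of a vertex. -/

namespace SingularDisc

variable {n : ℕ} {D : SingularDisc.{u} n}

theorem reflTransGen_symm {α : Type*} {r : α → α → Prop} (hr : ∀ a b, r a b → r b a) {a b : α}
    (h : Relation.ReflTransGen r a b) : Relation.ReflTransGen r b a := by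
  induction h with
  | refl => exact .refl
  | tail _ h ih => exact .head (hr _ _ h) ih

theorem reflTransGen_lift {α β : Type*} {r : α → α → Prop} {p : β → β → Prop} (g : α → β)
    (hg : ∀ a b, r a b → Relation.ReflTransGen p (g a) (g b)) {a b : α}
    (h : Relation.ReflTransGen r a b) : Relation.ReflTransGen p (g a) (g b) := by
  induction h with
  | refl => exact .refl
  | tail _ h ih => exact ih.trans (hg _ _ h)

theorem sum_neighbors [Fintype D.V] [DecidableEq D.V] {t : Set D.V} (ht : t ∈ D.cx.triangles)
    {x p q : D.V} (e : t = {x, p, q}) (χ : D.V → ZMod 2) [DecidablePred (· ∈ t)] :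
    (∑ y, if y ∈ t ∧ y ≠ x then χ y else 0) = χ p + χ q := by
  subst e
  obtain ⟨h₁, h₂, h₃⟩ := TwoComplex.ne_of_triangle ht
  rw [← Finset.sum_filter, ← Finset.sum_pair h₂]
  refine Finset.sum_congr ?_ fun _ _ => rfl
  ext y
  simp only [Finset.mem_filter, Finset.mem_univ, true_and, Set.mem_insert_iff,
    Set.mem_singleton_iff, Finset.mem_insert, Finset.mem_singleton]
  grind

open Classical in
/-- Handshake in the link of a vertex: every neighbour has exactly two sides. -/
theorem sum_link_eq_zero [NeZero n] [Fintype D.V] (x : D.V) (χ : D.V → ZMod 2) :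
    (∑ t : Set D.V, if t ∈ D.cx.triangles ∧ x ∈ t then
        ∑ y, if y ∈ t ∧ y ≠ x then χ y else 0 else 0) +
      ∑ i : ZMod n, (if D.bd (i + 1) = x then χ (D.bd i) + χ (D.bd (i + 2)) else 0) = 0 := by
  -- Double counting: after exchanging the sums, `χ y` is counted once for each triangle at the edge
  -- `x y`. The boundary sum likewise counts it once for each passage, and the total number of sides
  -- is two.
  have h₁ : (∑ t : Set D.V, if t ∈ D.cx.triangles ∧ x ∈ t then
        ∑ y, if y ∈ t ∧ y ≠ x then χ y else 0 else 0) =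
      ∑ y, if D.cx.graph.Adj x y then ((D.trianglesAt x y).ncard : ZMod 2) * χ y else 0 := by
    have : ∀ t : Set D.V, (if t ∈ D.cx.triangles ∧ x ∈ t then
        ∑ y, if y ∈ t ∧ y ≠ x then χ y else 0 else 0) =
        ∑ y, if D.cx.graph.Adj x y then if t ∈ D.trianglesAt x y then χ y else 0 else 0 := by
      intro t
      split_ifs with h
      · refine Finset.sum_congr rfl fun y _ => ?_
        by_cases hy : y ∈ t ∧ y ≠ x
        · have hadj := TwoComplex.adj_of_mem_triangle h.1 h.2 hy.1 hy.2.symm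
          have ht : t ∈ D.trianglesAt x y := ⟨h.1, h.2, hy.1⟩
          rw [if_pos hy, if_pos hadj, if_pos ht]
        · rw [if_neg hy]
          split_ifs with h₁ h₂
          · exact absurd ⟨h₂.2.2, h₁.ne'⟩ hy
          · rfl
          · rfl
      · symm
        refine Finset.sum_eq_zero fun y _ => ?_
        split_ifs with h₁ h₂
        · exact absurd ⟨h₂.1, h₂.2.1⟩ h
        · rfl
        · rfl
    rw [Finset.sum_congr rfl fun t _ => this t, Finset.sum_comm]
    refine Finset.sum_congr rfl fun y _ => ?_
    split_ifs with h
    · rw [← Finset.sum_filter, Finset.sum_const, nsmul_eq_mul]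
      congr 2
      rw [Set.ncard_eq_toFinset_card']
      congr 1
      ext t
      simp
    · simp
  have h₂ : (∑ i : ZMod n, (if D.bd (i + 1) = x then χ (D.bd i) + χ (D.bd (i + 2)) else 0)) =
      ∑ y, if D.cx.graph.Adj x y then ((D.passages x y).ncard : ZMod 2) * χ y else 0 := by
    have e₁ : (∑ i : ZMod n, (if D.bd (i + 1) = x then χ (D.bd i) + χ (D.bd (i + 2)) else 0)) =
        ∑ i : ZMod n, ((if D.bd (i + 1) = x then χ (D.bd i) else 0) +
          if D.bd i = x then χ (D.bd (i + 1)) else 0) := by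
      -- A passage through the vertex `x` is split into its two edges; shifting the index of the
      -- outgoing one lets each edge passage be counted at its own index.
      rw [Finset.sum_add_distrib, ← Equiv.sum_comp (Equiv.addRight (1 : ZMod n))
        (fun i => if D.bd i = x then χ (D.bd (i + 1)) else 0), ← Finset.sum_add_distrib]
      refine Finset.sum_congr rfl fun i _ => ?_
      simp only [Equiv.coe_addRight, add_assoc, one_add_one_eq_two]
      split_ifs <;> simp
    have e₂ : ∀ i : ZMod n, ((if D.bd (i + 1) = x then χ (D.bd i) else 0) +
          if D.bd i = x then χ (D.bd (i + 1)) else 0) =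
        ∑ y, if D.cx.graph.Adj x y then if i ∈ D.passages x y then χ y else 0 else 0 := by
      intro i
      have hi := D.bd_adj i
      have aux : ∀ z, D.cx.graph.Adj x z → (∀ y, i ∈ D.passages x y ↔ y = z) →
          (∑ y, if D.cx.graph.Adj x y then if i ∈ D.passages x y then χ y else 0 else 0) = χ z := by
        intro z hz h
        rw [Finset.sum_eq_single z]
        · rw [if_pos hz, if_pos ((h z).2 rfl)]
        · intro y _ hy
          rw [if_neg (fun h' => hy ((h y).1 h')), ite_self]
        · simp
      by_cases h₁ : D.bd (i + 1) = x
      · have h₂ : D.bd i ≠ x := fun h => hi.ne (h.trans h₁.symm)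
        rw [if_pos h₁, if_neg h₂, add_zero, aux (D.bd i) (h₁ ▸ hi.symm)]
        intro y
        change s(_, _) = s(_, _) ↔ _
        rw [Sym2.eq_iff]
        grind
      · by_cases h₂ : D.bd i = x
        · rw [if_neg h₁, if_pos h₂, zero_add, aux (D.bd (i + 1)) (h₂ ▸ hi)]
          intro y
          change s(_, _) = s(_, _) ↔ _
          rw [Sym2.eq_iff]
          grind
        · rw [if_neg h₁, if_neg h₂, add_zero, Finset.sum_eq_zero]
          intro y _
          split_ifs with _ h₃
          · revert h₃
            change s(_, _) = s(_, _) → _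
            rw [Sym2.eq_iff]
            grind
          · rfl
          · rfl
    rw [e₁, Finset.sum_congr rfl fun i _ => e₂ i, Finset.sum_comm]
    refine Finset.sum_congr rfl fun y _ => ?_
    split_ifs with h
    · rw [← Finset.sum_filter, Finset.sum_const, nsmul_eq_mul]
      congr 2
      rw [Set.ncard_eq_toFinset_card']
      congr 1
      ext t
      simp
    · simp
  rw [h₁, h₂, ← Finset.sum_add_distrib]
  refine Finset.sum_eq_zero fun y _ => ?_
  split_ifs with h
  · rw [← add_mul, ← Nat.cast_add, ncard_add_ncard h]
    have : ((2 : ℕ) : ZMod 2) = 0 := by decide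
    rw [this, zero_mul]
  · simp

/-- Deleting an interior edge from the link of one of its endpoints leaves the link connected. -/
theorem link_connected_delete [NeZero n] {x y : D.V} (hxy : D.cx.graph.Adj x y)
    (hp : D.passages x y = ∅) {p q : D.V} (hp' : D.cx.graph.Adj x p) (hq' : D.cx.graph.Adj x q)
    (hpy : p ≠ y) (hqy : q ≠ y) :
    Relation.ReflTransGen (fun p q => D.LinkRel x p q ∧ p ≠ y ∧ q ≠ y) p q := by
  classical
  have := D.finite
  have := Fintype.ofFinite D.V
  set r : D.V → D.V → Prop := fun p q => D.LinkRel x p q ∧ p ≠ y ∧ q ≠ y with hr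
  have r_symm : ∀ {c d}, Relation.ReflTransGen r c d → Relation.ReflTransGen r d c :=
    reflTransGen_symm fun p q h => ⟨h.1.symm, h.2.2, h.2.1⟩
  obtain ⟨a, b, hab, e⟩ := exists_two_triangles hxy hp
  have ta : ({x, y, a} : Set D.V) ∈ D.trianglesAt x y := by simp [e]
  have tb : ({x, y, b} : Set D.V) ∈ D.trianglesAt x y := by simp [e]
  obtain ⟨-, hya, -⟩ := TwoComplex.ne_of_triangle ta.1
  obtain ⟨-, hyb, -⟩ := TwoComplex.ne_of_triangle tb.1
  have stays : ∀ {c d}, Relation.ReflTransGen r c d → c ≠ y → d ≠ y := by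
    intro c d h hc
    rcases Relation.ReflTransGen.cases_tail h with rfl | ⟨_, _, h⟩
    · exact hc
    · exact h.2.2
  have at_y : ∀ c, D.LinkRel x y c → c = a ∨ c = b := by
    intro c hc
    rcases hc.triangle_or_passages with h | h
    · have : ({x, y, c} : Set D.V) ∈ D.trianglesAt x y := ⟨h, by simp, by simp⟩
      rw [e] at this
      have h₁ := TwoComplex.ne_of_triangle h
      have hc : c ∈ ({x, y, c} : Set D.V) := by simp
      rcases this with h | h <;> rw [h] at hc <;> simp at hc <;> grind
    · simp [hp] at h
  have hne : ({x, y, a} : Set D.V) ≠ {x, y, b} := by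
    intro h
    have ha : a ∈ ({x, y, b} : Set D.V) := by rw [← h]; simp
    have := TwoComplex.ne_of_triangle ta.1
    simp at ha
    grind
  -- Handshake argument. Let `χ` be the indicator of the component of `a` after deletion of `y`.
  -- Link edges away from `y` contribute zero, so only the two triangles at `y` remain. If `b` lay
  -- in another component, the total would be `χ a + χ b = 1` instead of zero.
  have rab : Relation.ReflTransGen r a b := by
    by_contra hn
    let χ : D.V → ZMod 2 := fun c => if Relation.ReflTransGen r a c then 1 else 0
    have χ_y : χ y = 0 := if_neg fun h => stays h hya.symm rfl
    have χ_a : χ a = 1 := if_pos .refl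
    have χ_b : χ b = 0 := if_neg hn
    have χ_eq : ∀ c d, r c d → χ c = χ d := by
      intro c d hcd
      have : Relation.ReflTransGen r a c ↔ Relation.ReflTransGen r a d :=
        ⟨fun h => h.tail hcd, fun h => h.tail ⟨hcd.1.symm, hcd.2.2, hcd.2.1⟩⟩
      simp only [χ, this]
    have two : ∀ z : ZMod 2, z + z = 0 := by decide
    have h := sum_link_eq_zero (D := D) x χ
    rw [Finset.sum_eq_zero (s := Finset.univ (α := ZMod n)), add_zero,
      Finset.sum_eq_add {x, y, a} {x, y, b} hne] at h
    · rw [if_pos ⟨ta.1, by simp⟩, if_pos ⟨tb.1, by simp⟩, sum_neighbors ta.1 rfl,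
        sum_neighbors tb.1 rfl, χ_y, χ_a, χ_b] at h
      revert h
      decide
    · intro t _ ht
      split_ifs with h'
      · obtain ⟨c, d, rfl⟩ := TwoComplex.exists_other_two h'.1 h'.2
        rw [sum_neighbors h'.1 rfl]
        have hc : c ≠ y := by
          rintro rfl
          have : ({x, c, d} : Set D.V) ∈ D.trianglesAt x c := ⟨h'.1, by simp, by simp⟩
          rw [e] at this
          rcases this with h | h
          · exact ht.1 h
          · exact ht.2 h
        have hd : d ≠ y := by
          rintro rfl
          have : ({x, c, d} : Set D.V) ∈ D.trianglesAt x d := ⟨h'.1, by simp, by simp⟩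
          rw [e] at this
          rcases this with h | h
          · exact ht.1 h
          · exact ht.2 h
        rw [χ_eq c d ⟨.inl h'.1, hc, hd⟩, two]
      · rfl
    · simp
    · simp
    · intro i _
      split_ifs with h'
      · have hl : D.LinkRel x (D.bd i) (D.bd (i + 2)) := .inr ⟨i, h', rfl⟩
        have no : ∀ c d, D.LinkRel x c d → s(c, d) = s(D.bd i, D.bd (i + 2)) → c ≠ y := by
          rintro c d hcd e' rfl
          have := D.bd_adj i
          have h₂ := D.mem_passages_succ i
          rw [h'] at h₂
          rcases Sym2.eq_iff.1 e' with ⟨rfl, rfl⟩ | ⟨rfl, rfl⟩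
          · have h₁ : i ∈ D.passages x (D.bd i) := by rw [passages_comm, ← h']; rfl
            rw [hp] at h₁
            exact h₁
          · rw [hp] at h₂
            exact h₂
        rw [χ_eq _ _ ⟨hl, no _ _ hl rfl, no _ _ hl.symm Sym2.eq_swap⟩, two]
      · rfl
  -- A path in the full link is rerouted: while it visits `y`, the invariant records that `a` is
  -- reachable, and the connection from `a` to `b` replaces a passage through `y`.
  have main : ∀ c, Relation.ReflTransGen (D.LinkRel x) p c →
      (c ≠ y → Relation.ReflTransGen r p c) ∧ (c = y → Relation.ReflTransGen r p a) := by
    intro c hc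
    induction hc with
    | refl => exact ⟨fun _ => .refl, fun h => absurd h hpy⟩
    | @tail c d _ hcd ih =>
      by_cases hc : c = y
      · subst hc
        have := ih.2 rfl
        rcases at_y d hcd with rfl | rfl
        · exact ⟨fun _ => this, fun _ => this⟩
        · exact ⟨fun _ => this.trans rab, fun _ => this⟩
      · have := ih.1 hc
        refine ⟨fun hd => this.tail ⟨hcd, hc, hd⟩, ?_⟩
        rintro rfl
        rcases at_y c hcd.symm with rfl | rfl
        · exact this
        · exact this.trans (r_symm rab)
  exact (main q (D.link_connected x p q hp' hq')).1 hqy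

end SingularDisc

/-! ### Simple connectivity of simplicial images. -/

namespace TwoComplex

variable {V V' : Type u} {K : TwoComplex V} {K' : TwoComplex V'}

theorem connected_of_surjective (hK : K.graph.Connected) (g : V → V')
    (hg : Function.Surjective g)
    (h : ∀ a b, K.graph.Adj a b → K'.graph.Reachable (g a) (g b)) : K'.graph.Connected := by
  obtain ⟨a₀⟩ := hK.nonempty
  have : Nonempty V' := ⟨g a₀⟩
  refine ⟨fun x y => ?_⟩
  obtain ⟨a, rfl⟩ := hg x
  obtain ⟨b, rfl⟩ := hg y
  obtain ⟨p⟩ := hK.preconnected a b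
  induction p with
  | nil => exact .refl _
  | cons hab _ ih => exact (h _ _ hab).trans ih

open Classical in
/-- A criterion for the image of a simply connected complex under a simplicial map `g` to be simply
connected. The map `e` is a section of `g` on the vertices. -/
theorem SimplyConnected.map (hK : K.SimplyConnected) (g : V → V') (e : V' → V)
    (hge : ∀ x, g (e x) = x)
    (hadj : ∀ a b, K.graph.Adj a b → g a = g b ∨ K'.graph.Adj (g a) (g b))
    (htri : ∀ a b c, ({a, b, c} : Set V) ∈ K.triangles → g a ≠ g b → g b ≠ g c → g a ≠ g c →
      ({g a, g b, g c} : Set V') ∈ K'.triangles)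
    (hlift : ∀ x y, K'.graph.Adj x y → ∃ a b, K.graph.Adj a b ∧ g a = x ∧ g b = y ∧
      (a = e x ∨ K.graph.Adj a (e x)) ∧ (b = e y ∨ K.graph.Adj b (e y))) :
    K'.SimplyConnected := by
  refine simplyConnected_of_isCoboundary
    (connected_of_surjective hK.1 g (fun x => ⟨e x, hge x⟩) fun a b hab => ?_) ?_
  · rcases hadj a b hab with h | h
    · rw [h]
    · exact h.reachable
  intro G _ φ' hφ'
  -- The cocycle is pulled back along `g`, with trivial value on collapsed edges.
  let φ : V → V → G := fun a b => if g a = g b then 1 else φ' (g a) (g b)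
  have φ_eq : ∀ {a b}, g a = g b → φ a b = 1 := fun h => if_pos h
  have φ_ne : ∀ {a b}, g a ≠ g b → φ a b = φ' (g a) (g b) := fun h => if_neg h
  have hφ : K.IsCocycle φ := by
    have swap : ∀ a b, K.graph.Adj a b → φ a b * φ b a = 1 := by
      intro a b hab
      by_cases h : g a = g b
      · rw [φ_eq h, φ_eq h.symm, one_mul]
      · rw [φ_ne h, φ_ne (Ne.symm h)]
        exact hφ'.mul_swap _ _ ((hadj a b hab).resolve_left h)
    refine ⟨swap, fun a b c ht => ?_⟩
    by_cases h₁ : g a = g b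
    · rw [φ_eq h₁, one_mul]
      simp only [φ, h₁]
    by_cases h₂ : g b = g c
    · rw [φ_eq h₂, mul_one]
      simp only [φ, h₂]
    by_cases h₃ : g a = g c
    · rw [φ_eq h₃]
      have hab := adj_of_mem_triangle ht (a := a) (b := b) (by simp) (by simp) (ne_of_triangle ht).1
      rw [← swap a b hab]
      simp only [φ, h₃]
    · rw [φ_ne h₁, φ_ne h₂, φ_ne h₃]
      exact hφ'.mul_triangle _ _ _ (htri a b c ht h₁ h₂ h₃)
  obtain ⟨h, hh⟩ := hK.isCoboundary hφ
  -- The potential upstairs does not change along collapsed edges. Hence it agrees at a vertex of a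
  -- fibre and at the section, whenever these are equal or adjacent, and it descends through the
  -- section.
  have fib : ∀ a x, g a = x → (a = e x ∨ K.graph.Adj a (e x)) → h a = h (e x) := by
    rintro a _ rfl (h' | h')
    · exact congrArg h h'
    · have := hh _ _ h'
      rw [φ_eq (hge _).symm] at this
      rw [← mul_one (h a), this, mul_inv_cancel_left]
  refine ⟨fun x => h (e x), fun x y hxy => ?_⟩
  obtain ⟨a, b, hab, ha, hb, ha', hb'⟩ := hlift x y hxy
  have := hh a b hab
  rw [φ_ne (by rw [ha, hb]; exact hxy.ne), ha, hb, fib a x ha ha', fib b y hb hb'] at this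
  exact this

theorem exists_of_image_eq {α β : Type*} {e : α → β} (he : Function.Injective e) {t : Set α}
    {a b c : β} (h : e '' t = {a, b, c}) :
    ∃ a' b' c', e a' = a ∧ e b' = b ∧ e c' = c ∧ t = {a', b', c'} := by
  obtain ⟨a', -, ha⟩ : a ∈ e '' t := by simp [h]
  obtain ⟨b', -, hb⟩ : b ∈ e '' t := by simp [h]
  obtain ⟨c', -, hc⟩ : c ∈ e '' t := by simp [h]
  refine ⟨a', b', c', ha, hb, hc, he.image_injective ?_⟩
  rw [h, Set.image_insert_eq, Set.image_insert_eq, Set.image_singleton, ha, hb, hc]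

end TwoComplex

/-! ### Removing the inside of an empty triangle (A-moves). -/

namespace SingularDisc

variable {n : ℕ} {D : SingularDisc.{u} n}

/-- The vertices in the interior of the region `R` bounded by the triangle `u v w`. -/
def innerVertices (R : Set (Set D.V)) (u v w : D.V) : Set D.V :=
  {x | x ∉ ({u, v, w} : Set D.V) ∧ ∃ t ∈ R, x ∈ t}

/-- A triple of pairwise adjacent vertices which does not bound a triangle, and its inside. -/
structure IsEmptyTriangle (R : Set (Set D.V)) (u v w : D.V) : Prop where
  huv : D.cx.graph.Adj u v
  hvw : D.cx.graph.Adj v w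
  huw : D.cx.graph.Adj u w
  not_mem : ({u, v, w} : Set D.V) ∉ D.cx.triangles
  region : D.cx.IsRegion R {s(u, v), s(v, w), s(u, w)}

namespace IsEmptyTriangle

variable {R : Set (Set D.V)} {u v w : D.V}

theorem mem_edges_iff {a b : D.V} (hab : a ≠ b) :
    s(a, b) ∈ ({s(u, v), s(v, w), s(u, w)} : Set (Sym2 D.V)) ↔
      a ∈ ({u, v, w} : Set D.V) ∧ b ∈ ({u, v, w} : Set D.V) := by
  simp only [Set.mem_insert_iff, Set.mem_singleton_iff, Sym2.eq_iff]
  grind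

theorem region_eq (R : Set (Set D.V)) (hR : R ⊆ D.cx.triangles) (a b : D.V) :
    {t ∈ R | a ∈ t ∧ b ∈ t} = D.trianglesAt a b ∩ R := by
  ext t
  exact ⟨fun h => ⟨⟨hR h.1, h.2⟩, h.1⟩, fun h => ⟨h.2, h.1.2⟩⟩

theorem odd_iff (h : IsEmptyTriangle R u v w) {a b : D.V} (hab : D.cx.graph.Adj a b) :
    Odd (D.trianglesAt a b ∩ R).ncard ↔
      a ∈ ({u, v, w} : Set D.V) ∧ b ∈ ({u, v, w} : Set D.V) := by
  rw [← mem_edges_iff hab.ne, ← h.region.2 a b hab, region_eq R h.region.1]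

/-- Away from the three bounding edges, an edge lies in an even number of triangles of the region.
If there is one, there are two, and they occupy both sides of the edge. -/
theorem edge_of_region [NeZero n] (h : IsEmptyTriangle R u v w) {a b : D.V}
    (hab : D.cx.graph.Adj a b)
    (hne : ¬ (a ∈ ({u, v, w} : Set D.V) ∧ b ∈ ({u, v, w} : Set D.V))) {t : Set D.V} (ht : t ∈ R)
    (ha : a ∈ t) (hb : b ∈ t) : D.passages a b = ∅ ∧ D.trianglesAt a b ⊆ R := by
  have h₁ := ncard_add_ncard hab
  rw [← h.odd_iff hab] at hne
  have h₂ : 0 < (D.trianglesAt a b ∩ R).ncard :=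
    (Set.ncard_pos ((D.finite_trianglesAt a b).inter_of_left R)).2 ⟨t, ⟨h.region.1 ht, ha, hb⟩, ht⟩
  have h₃ : (D.trianglesAt a b ∩ R).ncard ≤ (D.trianglesAt a b).ncard :=
    Set.ncard_le_ncard Set.inter_subset_left (D.finite_trianglesAt a b)
  rw [Nat.not_odd_iff_even] at hne
  obtain ⟨k, hk⟩ := hne
  refine ⟨(Set.ncard_eq_zero (D.finite_passages a b)).1 (by omega), ?_⟩
  rw [← Set.inter_eq_left]
  exact Set.eq_of_subset_of_ncard_le Set.inter_subset_left (by omega) (D.finite_trianglesAt a b)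

/-- No bounding edge ends at an inner vertex, so going around its connected link from one triangle
of the region never leaves the region and never meets the boundary of the disc. -/
theorem star_subset [NeZero n] (h : IsEmptyTriangle R u v w) {x : D.V}
    (hx : x ∈ innerVertices R u v w) {b : D.V} (hb : D.cx.graph.Adj x b) :
    (∃ t ∈ R, x ∈ t ∧ b ∈ t) ∧ D.passages x b = ∅ ∧ D.trianglesAt x b ⊆ R := by
  obtain ⟨hxn, t, ht, hxt⟩ := hx
  have key : ∀ b, D.cx.graph.Adj x b → ∃ t ∈ R, x ∈ t ∧ b ∈ t := by
    intro b hb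
    have ht' := h.region.1 ht
    obtain ⟨a, c, rfl⟩ := TwoComplex.exists_other_two ht' hxt
    have := D.link_connected x a b
      (TwoComplex.adj_of_mem_triangle ht' (by simp) (by simp) (TwoComplex.ne_of_triangle ht').1) hb
    induction this with
    | refl => exact ⟨_, ht, by simp, by simp⟩
    | @tail p q _ hpq ih =>
      have hpq : D.LinkRel x p q := hpq
      obtain ⟨s, hs, hxs, hps⟩ := ih hpq.adj.1
      obtain ⟨h₁, h₂⟩ := h.edge_of_region hpq.adj.1 (fun h => hxn h.1) hs hxs hps
      rcases hpq.triangle_or_passages with h' | h'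
      · exact ⟨_, h₂ ⟨h', by simp, by simp⟩, by simp, by simp⟩
      · simp [h₁] at h'
  obtain ⟨s, hs, hxs, hbs⟩ := key b hb
  exact ⟨⟨s, hs, hxs, hbs⟩, h.edge_of_region hb (fun h => hxn h.1) hs hxs hbs⟩

theorem mem_region_of_inner [NeZero n] (h : IsEmptyTriangle R u v w) {t : Set D.V}
    (ht : t ∈ D.cx.triangles) {x : D.V} (hx : x ∈ innerVertices R u v w) (hxt : x ∈ t) : t ∈ R := by
  obtain ⟨a, c, rfl⟩ := TwoComplex.exists_other_two ht hxt
  have hadj := TwoComplex.adj_of_mem_triangle ht (a := x) (b := a) (by simp) (by simp)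
    (TwoComplex.ne_of_triangle ht).1
  exact (h.star_subset hx hadj).2.2 ⟨ht, by simp, by simp⟩

/-- Otherwise the triangle would have only corners as vertices and so would be the missing triangle
itself. -/
theorem exists_inner (h : IsEmptyTriangle R u v w) {t : Set D.V} (ht : t ∈ R) :
    ∃ x ∈ t, x ∈ innerVertices R u v w := by
  by_contra! hn
  have hsub : t ⊆ {u, v, w} := fun x hx => by
    by_contra hx'
    exact hn x hx ⟨hx', t, ht, hx⟩
  obtain ⟨a, b, c, hab, hbc, hac, rfl⟩ := D.cx.is_triangle t (h.region.1 ht)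
  apply h.not_mem
  rw [← Set.eq_of_subset_of_ncard_le hsub]
  · exact h.region.1 ht
  · rw [Set.ncard_eq_three.2 ⟨a, b, c, hab.ne, hac.ne, hbc.ne, rfl⟩,
      Set.ncard_eq_three.2 ⟨u, v, w, h.huv.ne, h.huw.ne, h.hvw.ne, rfl⟩]

theorem inner_or_mem (t : Set D.V) (ht : t ∈ R) {y : D.V} (hy : y ∈ t) :
    y ∈ innerVertices R u v w ∨ y ∈ ({u, v, w} : Set D.V) := by
  by_cases h : y ∈ ({u, v, w} : Set D.V)
  · exact .inr h
  · exact .inl ⟨h, t, ht, hy⟩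

theorem corner_notMem (R : Set (Set D.V)) {x : D.V} (hx : x ∈ ({u, v, w} : Set D.V)) :
    x ∉ innerVertices R u v w := fun h => h.1 hx

theorem bd_notMem [NeZero n] (h : IsEmptyTriangle R u v w) (i : ZMod n) :
    D.bd i ∉ innerVertices R u v w := by
  intro hi
  have h₁ := (h.star_subset hi (D.bd_adj i)).2.1
  have : i ∈ D.passages (D.bd i) (D.bd (i + 1)) := rfl
  simp only [h₁] at this
  exact this

/-- The triangles that remain together with the new one. -/
def newTriangles (R : Set (Set D.V)) (u v w : D.V) : Set (Set D.V) :=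
  insert {u, v, w} (D.cx.triangles \ R)

theorem mem_newTriangles_iff [NeZero n] (h : IsEmptyTriangle R u v w)
    (t : Set {x // x ∉ innerVertices R u v w}) :
    Subtype.val '' t ∈ newTriangles R u v w ↔
      Subtype.val '' t ∈ D.cx.triangles ∨ Subtype.val '' t = {u, v, w} := by
  constructor
  · rintro (h' | h')
    · exact .inr h'
    · exact .inl h'.1
  · rintro (h' | h')
    · refine .inr ⟨h', fun hR => ?_⟩
      obtain ⟨_, ⟨y, -, rfl⟩, hy⟩ := h.exists_inner hR
      exact y.2 hy
    · exact .inl h'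

theorem notMem_inner_of_newTriangles [NeZero n] (h : IsEmptyTriangle R u v w) {t : Set D.V}
    (ht : t ∈ newTriangles R u v w) {x : D.V} (hx : x ∈ t) : x ∉ innerVertices R u v w := by
  rcases ht with rfl | ht
  · exact corner_notMem R hx
  · exact fun hx' => ht.2 (h.mem_region_of_inner ht.1 hx' hx)

/-- The count can change only at the three bounding edges. Such an edge lies in an odd number of
removed triangles, at most two and hence exactly one, for which the new triangle substitutes. -/
theorem ncard_newTriangles [NeZero n] (h : IsEmptyTriangle R u v w) {a b : D.V}
    (hab : D.cx.graph.Adj a b) (ha : a ∉ innerVertices R u v w) (hb : b ∉ innerVertices R u v w) :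
    {t ∈ newTriangles R u v w | a ∈ t ∧ b ∈ t}.ncard = (D.trianglesAt a b).ncard := by
  have hfin := D.finite_trianglesAt a b
  by_cases hE : a ∈ ({u, v, w} : Set D.V) ∧ b ∈ ({u, v, w} : Set D.V)
  · have hodd := (h.odd_iff hab).2 hE
    have h₃ := Set.ncard_inter_add_ncard_sdiff_eq_ncard (D.trianglesAt a b) R hfin
    have h₁ := ncard_add_ncard hab
    have e : {t ∈ newTriangles R u v w | a ∈ t ∧ b ∈ t} =
        insert {u, v, w} (D.trianglesAt a b \ R) := by
      ext t
      constructor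
      · rintro ⟨rfl | h₁, h₂⟩
        · exact .inl rfl
        · exact .inr ⟨⟨h₁.1, h₂⟩, h₁.2⟩
      · rintro (rfl | h₁)
        · exact ⟨.inl rfl, hE⟩
        · exact ⟨.inr ⟨h₁.1.1, h₁.2⟩, h₁.1.2⟩
    rw [e, Set.ncard_insert_of_notMem (fun h' => h.not_mem h'.1.1) hfin.sdiff]
    obtain ⟨k, hk⟩ := hodd
    omega
  · congr 1
    ext t
    constructor
    · rintro ⟨rfl | h₁, h₂⟩
      · exact absurd h₂ hE
      · exact ⟨h₁.1, h₂⟩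
    · rintro ⟨h₁, h₂⟩
      refine ⟨.inr ⟨h₁, fun hR => hE ?_⟩, h₂⟩
      exact ⟨(inner_or_mem t hR h₂.1).resolve_left ha, (inner_or_mem t hR h₂.2).resolve_left hb⟩

/-- The complex resulting from the removal of the inside of an empty triangle. -/
def fillComplex (h : IsEmptyTriangle R u v w) : TwoComplex {x // x ∉ innerVertices R u v w} where
  graph := D.cx.graph.comap Subtype.val
  triangles := {t | Subtype.val '' t ∈ D.cx.triangles ∨ Subtype.val '' t = {u, v, w}}
  is_triangle := by
    rintro t (ht | ht)
    · obtain ⟨a, b, c, hab, hbc, hac, e⟩ := D.cx.is_triangle _ ht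
      obtain ⟨a', b', c', rfl, rfl, rfl, ht⟩ := TwoComplex.exists_of_image_eq
        Subtype.val_injective e
      exact ⟨a', b', c', hab, hbc, hac, ht⟩
    · obtain ⟨a', b', c', ha, hb, hc, ht⟩ := TwoComplex.exists_of_image_eq
        Subtype.val_injective ht
      refine ⟨a', b', c', ?_, ?_, ?_, ht⟩
      · change D.cx.graph.Adj _ _; rw [ha, hb]; exact h.huv
      · change D.cx.graph.Adj _ _; rw [hb, hc]; exact h.hvw
      · change D.cx.graph.Adj _ _; rw [ha, hc]; exact h.huw

theorem fillComplex_triangle (h : IsEmptyTriangle R u v w)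
    {a b c : {x // x ∉ innerVertices R u v w}}
    (ht : ({a.1, b.1, c.1} : Set D.V) ∈ D.cx.triangles ∨
      ({a.1, b.1, c.1} : Set D.V) = {u, v, w}) :
    ({a, b, c} : Set {x // x ∉ innerVertices R u v w}) ∈ h.fillComplex.triangles := by
  change Subtype.val '' _ ∈ _ ∨ Subtype.val '' _ = _
  rwa [Set.image_insert_eq, Set.image_insert_eq, Set.image_singleton]

theorem eq_corners (h : IsEmptyTriangle R u v w) {a b c : D.V} (ha : a ∈ ({u, v, w} : Set D.V))
    (hb : b ∈ ({u, v, w} : Set D.V)) (hc : c ∈ ({u, v, w} : Set D.V)) (hab : a ≠ b) (hbc : b ≠ c)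
    (hac : a ≠ c) : ({a, b, c} : Set D.V) = {u, v, w} := by
  refine Set.eq_of_subset_of_ncard_le (by grind) ?_
  rw [Set.ncard_eq_three.2 ⟨a, b, c, hab, hac, hbc, rfl⟩,
      Set.ncard_eq_three.2 ⟨u, v, w, h.huv.ne, h.huw.ne, h.hvw.ne, rfl⟩]

open Classical in
-- The simplicial map sending all inner vertices to the corner `u` and fixing the others is a
-- retraction onto the new complex. A triangle of the region is sent into the corners, hence
-- degenerates or becomes the new triangle.
theorem simplyConnected_fillComplex [NeZero n] (h : IsEmptyTriangle R u v w) :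
    h.fillComplex.SimplyConnected := by
  let u' : {x // x ∉ innerVertices R u v w} := ⟨u, corner_notMem R (by simp)⟩
  let g : D.V → {x // x ∉ innerVertices R u v w} :=
    fun x => if hx : x ∈ innerVertices R u v w then u' else ⟨x, hx⟩
  have g_pos : ∀ {x}, x ∈ innerVertices R u v w → g x = u' := fun hx => dif_pos hx
  have g_neg : ∀ {x} (hx : x ∉ innerVertices R u v w), g x = ⟨x, hx⟩ := fun hx => dif_neg hx
  have g_corner : ∀ {t}, t ∈ R → ∀ {x}, x ∈ t → (g x).1 ∈ ({u, v, w} : Set D.V) := by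
    intro t ht x hx
    rcases inner_or_mem (u := u) (v := v) (w := w) t ht hx with h' | h'
    · rw [g_pos h']; simp [u']
    · rw [g_neg (corner_notMem R h')]; exact h'
  have adj_corner : ∀ {x y : D.V}, x ∈ ({u, v, w} : Set D.V) → y ∈ ({u, v, w} : Set D.V) →
      x = y ∨ D.cx.graph.Adj x y := by
    have h₁ := h.huv
    have h₂ := h.hvw
    have h₃ := h.huw
    have h₄ := h.huv.symm
    have h₅ := h.hvw.symm
    have h₆ := h.huw.symm
    rintro x y (rfl | rfl | rfl) (rfl | rfl | rfl) <;> simp [*]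
  refine D.simplyConnected.map g Subtype.val (fun x => ?_) ?_ ?_ ?_
  · exact g_neg x.2
  · intro a b hab
    have key : (∃ t ∈ R, a ∈ t ∧ b ∈ t) → g a = g b ∨ h.fillComplex.graph.Adj (g a) (g b) := by
      rintro ⟨t, ht, hat, hbt⟩
      rcases adj_corner (g_corner ht hat) (g_corner ht hbt) with h' | h'
      · exact .inl (Subtype.ext h')
      · exact .inr h'
    by_cases ha : a ∈ innerVertices R u v w
    · exact key (h.star_subset ha hab).1
    · by_cases hb : b ∈ innerVertices R u v w
      · obtain ⟨t, ht, h₁, h₂⟩ := (h.star_subset hb hab.symm).1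
        exact key ⟨t, ht, h₂, h₁⟩
      · rw [g_neg ha, g_neg hb]
        exact .inr hab
  · intro a b c ht hab hbc hac
    apply fillComplex_triangle
    by_cases hR : ({a, b, c} : Set D.V) ∈ R
    · right
      exact h.eq_corners (g_corner hR (by simp)) (g_corner hR (by simp)) (g_corner hR (by simp))
        (fun h => hab (Subtype.ext h)) (fun h => hbc (Subtype.ext h))
        (fun h => hac (Subtype.ext h))
    · have hn : ∀ x ∈ ({a, b, c} : Set D.V), x ∉ innerVertices R u v w :=
        fun x hx hx' => hR (h.mem_region_of_inner ht hx' hx)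
      left
      rw [g_neg (hn a (by simp)), g_neg (hn b (by simp)), g_neg (hn c (by simp))]
      exact ht
  · intro x y hxy
    exact ⟨x, y, hxy, g_neg x.2, g_neg y.2, .inl rfl, .inl rfl⟩

open Classical in
-- Link paths of the old disc are projected by sending the inner vertices to one corner. That corner
-- must differ from `x`, so that its image lies in the new link even if `x` is itself a corner.
theorem link_connected_fillComplex [NeZero n] (h : IsEmptyTriangle R u v w)
    (bd : ZMod n → {x // x ∉ innerVertices R u v w}) (hbd : ∀ i, (bd i).1 = D.bd i)
    (x a b : {x // x ∉ innerVertices R u v w}) (ha : D.cx.graph.Adj x a)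
    (hb : D.cx.graph.Adj x b) :
    Relation.ReflTransGen (fun p q => ({x, p, q} : Set _) ∈ h.fillComplex.triangles ∨
      ∃ i, bd (i + 1) = x ∧ s(bd i, bd (i + 2)) = s(p, q)) a b := by
  obtain ⟨o, ho, hox⟩ : ∃ o ∈ ({u, v, w} : Set D.V), o ≠ x.1 := by
    by_cases hx : u = x.1
    · exact ⟨v, by simp, fun h' => h.huv.ne (hx.trans h'.symm)⟩
    · exact ⟨u, by simp, hx⟩
  let g : D.V → {x // x ∉ innerVertices R u v w} :=
    fun x => if hx : x ∈ innerVertices R u v w then ⟨o, corner_notMem R ho⟩ else ⟨x, hx⟩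
  have g_pos : ∀ {x}, x ∈ innerVertices R u v w → g x = ⟨o, corner_notMem R ho⟩ :=
    fun hx => dif_pos hx
  have g_neg : ∀ {x} (hx : x ∉ innerVertices R u v w), g x = ⟨x, hx⟩ := fun hx => dif_neg hx
  have symm : ∀ p q : {x // x ∉ innerVertices R u v w},
      (({x, p, q} : Set _) ∈ h.fillComplex.triangles ∨
        ∃ i, bd (i + 1) = x ∧ s(bd i, bd (i + 2)) = s(p, q)) →
      (({x, q, p} : Set _) ∈ h.fillComplex.triangles ∨
        ∃ i, bd (i + 1) = x ∧ s(bd i, bd (i + 2)) = s(q, p)) := by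
    rintro p q (h | ⟨i, h, e⟩)
    · exact .inl (by rwa [TwoComplex.pair_mem_triangle_comm])
    · exact .inr ⟨i, h, e.trans Sym2.eq_swap⟩
  have inner : ∀ p q, D.LinkRel x p q → p ∈ innerVertices R u v w →
      Relation.ReflTransGen (fun p q => ({x, p, q} : Set _) ∈ h.fillComplex.triangles ∨
        ∃ i, bd (i + 1) = x ∧ s(bd i, bd (i + 2)) = s(p, q)) (g p) (g q) := by
    intro p q hpq hp
    obtain ⟨-, h₁, -⟩ := h.star_subset hp hpq.adj.1.symm
    rcases hpq.triangle_or_passages with ht | ht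
    · have hR := h.mem_region_of_inner ht hp (by simp)
      by_cases hq : q ∈ innerVertices R u v w
      · rw [g_pos hp, g_pos hq]
      · rw [g_pos hp, g_neg hq]
        -- A step between an inner and an outer vertex lies in a triangle of the region, so `x` and
        -- `q` are both corners; the projected step is either constant or lies in the new triangle.
        have hx := (inner_or_mem (u := u) (v := v) (w := w) _ hR (y := x.1) (by simp)).resolve_left x.2
        have hq' := (inner_or_mem (u := u) (v := v) (w := w) _ hR (y := q) (by simp)).resolve_left hq
        by_cases hoq : o = q
        · subst hoq; exact .refl
        · refine .single (.inl (h.fillComplex_triangle (.inr ?_)))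
          exact h.eq_corners hx ho hq' hox.symm hoq (TwoComplex.ne_of_triangle ht).2.2
    · rw [passages_comm, h₁] at ht
      simp at ht
  have := D.link_connected x a b ha hb
  have h₂ := reflTransGen_lift (r := D.LinkRel x) g (p := fun p q =>
    ({x, p, q} : Set _) ∈ h.fillComplex.triangles ∨
      ∃ i, bd (i + 1) = x ∧ s(bd i, bd (i + 2)) = s(p, q)) ?_ this
  · rwa [g_neg a.2, g_neg b.2] at h₂
  · intro p q hpq
    by_cases hp : p ∈ innerVertices R u v w
    · exact inner p q hpq hp
    · by_cases hq : q ∈ innerVertices R u v w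
      · exact reflTransGen_symm symm (inner q p hpq.symm hq)
      · rw [g_neg hp, g_neg hq]
        refine .single ?_
        rcases hpq with ht | ⟨i, hi, e⟩
        · exact .inl (h.fillComplex_triangle (.inl ht))
        · refine .inr ⟨i, Subtype.ext ((hbd _).trans hi), ?_⟩
          have e₁ : bd i = ⟨D.bd i, h.bd_notMem i⟩ := Subtype.ext (hbd i)
          have e₂ : bd (i + 2) = ⟨D.bd (i + 2), h.bd_notMem _⟩ := Subtype.ext (hbd _)
          rw [e₁, e₂]
          rcases Sym2.eq_iff.1 e with ⟨rfl, rfl⟩ | ⟨rfl, rfl⟩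
          · rfl
          · exact Sym2.eq_swap

/-- The singular disc resulting from the removal of the inside of an empty triangle. -/
def fill [NeZero n] (h : IsEmptyTriangle R u v w) : SingularDisc.{u} n where
  V := {x // x ∉ innerVertices R u v w}
  finite := have := D.finite; inferInstance
  cx := h.fillComplex
  bd i := ⟨D.bd i, h.bd_notMem i⟩
  simplyConnected := h.simplyConnected_fillComplex
  bd_adj := D.bd_adj
  two_sides a b hab := by
    have h₁ := ncard_add_ncard (D := D) hab
    rw [← h.ncard_newTriangles hab a.2 b.2] at h₁
    rw [← h₁]
    congr 1
    · rw [← Set.ncard_image_of_injective _ (Set.image_injective.2 Subtype.val_injective)]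
      congr 1
      ext t
      constructor
      · rintro ⟨s, ⟨hs, ha, hb⟩, rfl⟩
        exact ⟨(h.mem_newTriangles_iff s).2 hs, ⟨a, ha, rfl⟩, ⟨b, hb, rfl⟩⟩
      · rintro ⟨ht, ha, hb⟩
        have e : Subtype.val '' (Subtype.val ⁻¹' t : Set {x // x ∉ innerVertices R u v w}) = t := by
          rw [Set.image_preimage_eq_iff]
          intro x hx
          exact ⟨⟨x, h.notMem_inner_of_newTriangles ht hx⟩, rfl⟩
        refine ⟨Subtype.val ⁻¹' t, ⟨?_, ha, hb⟩, e⟩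
        refine (h.mem_newTriangles_iff _).1 ?_
        rwa [e]
    · congr 1
      ext i
      change s(_, _) = s(_, _) ↔ s(_, _) = s(_, _)
      simp only [Sym2.eq_iff, Subtype.ext_iff]
  link_connected := h.link_connected_fillComplex (fun i => ⟨D.bd i, h.bd_notMem i⟩) fun _ => rfl

/-- At least two triangles are exchanged for one. A triangle of the region at the edge `u v` has an
inner vertex `x`, and both triangles at the edge `x u` belong to the region. -/
theorem ncard_fill_lt [NeZero n] (h : IsEmptyTriangle R u v w) :
    h.fill.cx.triangles.ncard < D.cx.triangles.ncard := by
  have e : h.fill.cx.triangles.ncard ≤ (newTriangles R u v w).ncard := by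
    change h.fillComplex.triangles.ncard ≤ _
    rw [← Set.ncard_image_of_injective _ (Set.image_injective.2 Subtype.val_injective)]
    refine Set.ncard_le_ncard ?_ (D.finite_triangles.sdiff.insert _)
    rintro _ ⟨s, hs, rfl⟩
    exact (h.mem_newTriangles_iff s).2 hs
  refine e.trans_lt ?_
  have hodd : Odd (D.trianglesAt u v ∩ R).ncard := (h.odd_iff h.huv).2 (by simp)
  obtain ⟨t, ht⟩ : (D.trianglesAt u v ∩ R).Nonempty := by
    rw [← Set.ncard_pos ((D.finite_trianglesAt u v).inter_of_left R)]
    exact hodd.pos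
  obtain ⟨x, hx, hxI⟩ := h.exists_inner ht.2
  have hux : u ≠ x := fun e => hxI.1 (by simp [e])
  have hvx : v ≠ x := fun e => hxI.1 (by simp [e])
  have hadj := TwoComplex.adj_of_mem_triangle ht.1.1 ht.1.2.1 hx hux
  obtain ⟨-, h₁, h₂⟩ := h.star_subset hxI hadj.symm
  obtain ⟨c, d, hcd, e'⟩ := exists_two_triangles hadj.symm h₁
  have hc : ({x, u, c} : Set D.V) ∈ R := h₂ (by rw [e']; simp)
  have hd : ({x, u, d} : Set D.V) ∈ R := h₂ (by rw [e']; simp)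
  have hne : ({x, u, c} : Set D.V) ≠ {x, u, d} := by
    intro he
    have h₃ := TwoComplex.ne_of_triangle (h.region.1 hc)
    have : c ∈ ({x, u, d} : Set D.V) := by rw [← he]; simp
    simp at this
    grind
  have h₄ : 2 ≤ R.ncard := by
    rw [← Set.ncard_pair hne]
    exact Set.ncard_le_ncard (by grind) (D.finite_triangles.subset h.region.1)
  have h₅ := Set.ncard_sdiff_add_ncard_of_subset h.region.1 D.finite_triangles
  have h₆ := Set.ncard_insert_le ({u, v, w} : Set D.V) (D.cx.triangles \ R)
  change (insert _ _ : Set _).ncard < _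
  omega

end IsEmptyTriangle

end SingularDisc

namespace DiscDiagram

variable {W : Type v} {X : MetricComplex W} {n : ℕ} {C : ZMod n → W}

/-- The second diagram uses no new vertices. -/
def UsesNoNewVertices (D D' : DiscDiagram.{u} X C) : Prop :=
  ∃ i : D'.V → D.V, Function.Injective i ∧ ∀ x, D'.f x = D.f (i x)

/-- An A-move is possible at every empty triangle, and it decreases the area. -/
theorem exists_aMove [NeZero n] (D : DiscDiagram.{u} X C) (hD : ¬ D.cx.NoEmptyTriangle) :
    ∃ D' : DiscDiagram.{u} X C, AMove D D' ∧ UsesNoNewVertices D D' ∧ D'.area < D.area := by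
  unfold TwoComplex.NoEmptyTriangle at hD
  push Not at hD
  obtain ⟨u, v, w, huv, hvw, huw, hn⟩ := hD
  have := D.finite
  obtain ⟨R, hR⟩ := D.simplyConnected.exists_isRegion huv hvw huw
  have h : SingularDisc.IsEmptyTriangle R u v w := ⟨huv, hvw, huw, hn, hR⟩
  refine ⟨{ toSingularDisc := h.fill
            f := fun x => D.f x.1
            simplicial := fun a b hab => D.simplicial _ _ hab
            f_bd := fun i => D.f_bd i },
    ⟨u, v, w, huv, hvw, huw, hn, R, hR, Subtype.val, Subtype.val_injective, ?_, fun _ => rfl,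
      fun _ => rfl, fun _ _ => Iff.rfl, fun _ => Iff.rfl⟩,
    ⟨Subtype.val, Subtype.val_injective, fun _ => rfl⟩, h.ncard_fill_lt⟩
  have key : ∀ x : D.V, x ∈ Set.range (Subtype.val :
      {x // x ∉ SingularDisc.innerVertices R u v w} → D.V) ↔
      x ∈ ({u, v, w} : Set D.V) ∨ ∀ t ∈ R, x ∉ t := by
    intro x
    have h₁ : x ∉ SingularDisc.innerVertices R u v w ↔
        x ∈ ({u, v, w} : Set D.V) ∨ ∀ t ∈ R, x ∉ t := by
      change ¬ (_ ∧ _) ↔ _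
      push Not
      tauto
    rw [← h₁]
    exact ⟨fun ⟨y, hy⟩ => hy ▸ y.2, fun hx => ⟨⟨x, hx⟩, rfl⟩⟩
  exact key

end DiscDiagram

/-! ### Flipping an edge (B- and D-moves). -/

namespace TwoComplex

variable {V : Type u} {K : TwoComplex V}

theorem sym2_eq_of_triple_eq {x p q v w : V} (hp : x ≠ p) (hq : x ≠ q) (hv : x ≠ v) (hw : x ≠ w)
    (h : ({x, p, q} : Set V) = {x, v, w}) : s(p, q) = s(v, w) := by
  have h₁ : p ∈ ({x, v, w} : Set V) := by rw [← h]; simp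
  have h₂ : q ∈ ({x, v, w} : Set V) := by rw [← h]; simp
  have h₃ : v ∈ ({x, p, q} : Set V) := by rw [h]; simp
  have h₄ : w ∈ ({x, p, q} : Set V) := by rw [h]; simp
  simp only [Set.mem_insert_iff, Set.mem_singleton_iff] at h₁ h₂ h₃ h₄
  rw [Sym2.eq_iff]
  grind

/-- It suffices to check the cocycle condition for one enumeration of each triangle. -/
theorem IsCocycle.of_enumeration {G : Type*} [Group G] {φ : V → V → G}
    (hs : ∀ a b, K.graph.Adj a b → φ a b * φ b a = 1)
    (ht : ∀ t ∈ K.triangles, ∃ a b c, t = {a, b, c} ∧ φ a b * φ b c = φ a c) :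
    K.IsCocycle φ := by
  refine ⟨hs, fun a b c h => ?_⟩
  obtain ⟨x, y, z, e, hxyz⟩ := ht _ h
  obtain ⟨n₁, n₂, n₃⟩ := ne_of_triangle h
  have h' := h
  rw [e] at h'
  obtain ⟨m₁, m₂, m₃⟩ := ne_of_triangle h'
  have i₁ := eq_inv_of_mul_eq_one_right
    (hs x y (adj_of_mem_triangle h' (by simp) (by simp) m₁))
  have i₂ := eq_inv_of_mul_eq_one_right
    (hs y z (adj_of_mem_triangle h' (by simp) (by simp) m₂))
  have i₃ := eq_inv_of_mul_eq_one_right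
    (hs x z (adj_of_mem_triangle h' (by simp) (by simp) m₃))
  have ha : a ∈ ({x, y, z} : Set V) := by rw [← e]; simp
  have hb : b ∈ ({x, y, z} : Set V) := by rw [← e]; simp
  have hc : c ∈ ({x, y, z} : Set V) := by rw [← e]; simp
  rw [← hxyz] at i₃
  rcases ha with rfl | rfl | rfl <;> rcases hb with rfl | rfl | rfl <;>
    rcases hc with rfl | rfl | rfl <;>
    first
    | exact absurd rfl n₁
    | exact absurd rfl n₂
    | exact absurd rfl n₃
    | exact hxyz
    | simp [i₁, i₂, i₃, ← hxyz, mul_assoc]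

end TwoComplex

namespace SingularDisc

variable {n : ℕ} {D : SingularDisc.{u} n}

/-- Two triangles sharing the edge `u v` whose opposite vertices are not adjacent. -/
structure IsFlippable (D : SingularDisc.{u} n) (u v w z : D.V) : Prop where
  left : ({u, v, w} : Set D.V) ∈ D.cx.triangles
  right : ({u, v, z} : Set D.V) ∈ D.cx.triangles
  ne : w ≠ z
  not_adj : ¬ D.cx.graph.Adj w z

namespace IsFlippable

variable {u v w z : D.V}

theorem swap₁ (h : IsFlippable D u v w z) : IsFlippable D v u w z :=
  ⟨Set.insert_comm u v _ ▸ h.left, Set.insert_comm u v _ ▸ h.right, h.ne, h.not_adj⟩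

theorem swap₂ (h : IsFlippable D u v w z) : IsFlippable D u v z w :=
  ⟨h.right, h.left, h.ne.symm, fun h' => h.not_adj h'.symm⟩

theorem distinct (h : IsFlippable D u v w z) : u ≠ v ∧ u ≠ w ∧ u ≠ z ∧ v ≠ w ∧ v ≠ z ∧ w ≠ z := by
  obtain ⟨h₁, h₂, h₃⟩ := TwoComplex.ne_of_triangle h.left
  obtain ⟨-, h₄, h₅⟩ := TwoComplex.ne_of_triangle h.right
  exact ⟨h₁, h₃, h₅, h₂, h₄, h.ne⟩

theorem adj_left (h : IsFlippable D u v w z) : D.cx.graph.Adj u w :=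
  TwoComplex.adj_of_mem_triangle h.left (by simp) (by simp) h.distinct.2.1

theorem triangles_ne (h : IsFlippable D u v w z) : ({u, v, w} : Set D.V) ≠ {u, v, z} := by
  obtain ⟨-, h₂, -, h₄, -, h₆⟩ := h.distinct
  intro e
  have : w ∈ ({u, v, z} : Set D.V) := by rw [← e]; simp
  simp only [Set.mem_insert_iff, Set.mem_singleton_iff] at this
  grind

theorem trianglesAt_eq (h : IsFlippable D u v w z) :
    D.trianglesAt u v = {{u, v, w}, {u, v, z}} :=
  trianglesAt_eq_pair h.distinct.1 ⟨h.left, by simp, by simp⟩ ⟨h.right, by simp, by simp⟩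
    h.triangles_ne

theorem passages_eq [NeZero n] (h : IsFlippable D u v w z) : D.passages u v = ∅ :=
  passages_eq_empty_of_two h.distinct.1 ⟨h.left, by simp, by simp⟩ ⟨h.right, by simp, by simp⟩
    h.triangles_ne

/-- The triangles not affected by the flip. -/
def kept (D : SingularDisc.{u} n) (u v w z : D.V) : Set (Set D.V) :=
  {t | t ∈ D.cx.triangles ∧ t ≠ {u, v, w} ∧ t ≠ {u, v, z}}

/-- The triangles after the flip. -/
def newTriangles (D : SingularDisc.{u} n) (u v w z : D.V) : Set (Set D.V) :=
  {t | (t ∈ D.cx.triangles ∧ t ≠ {u, v, w} ∧ t ≠ {u, v, z}) ∨ t = {u, w, z} ∨ t = {v, w, z}}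

theorem newTriangles_swap₁ (D : SingularDisc.{u} n) (u v w z : D.V) :
    newTriangles D v u w z = newTriangles D u v w z := by
  ext t
  simp only [newTriangles, Set.insert_comm v u, Set.mem_ofPred_eq]
  tauto

theorem newTriangles_swap₂ (D : SingularDisc.{u} n) (u v w z : D.V) :
    newTriangles D u v z w = newTriangles D u v w z := by
  ext t
  simp only [newTriangles, Set.pair_comm z w, Set.mem_ofPred_eq]
  tauto

theorem not_edge_of_kept (h : IsFlippable D u v w z) {t : Set D.V} (ht : t ∈ kept D u v w z) :
    ¬ (u ∈ t ∧ v ∈ t) := by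
  intro hm
  have : t ∈ D.trianglesAt u v := ⟨ht.1, hm⟩
  rw [h.trianglesAt_eq] at this
  rcases this with h' | h'
  · exact ht.2.1 h'
  · exact ht.2.2 h'

theorem not_opposite (h : IsFlippable D u v w z) {t : Set D.V} (ht : t ∈ D.cx.triangles) :
    ¬ (w ∈ t ∧ z ∈ t) :=
  fun hm => h.not_adj (TwoComplex.adj_of_mem_triangle ht hm.1 hm.2 h.ne)

/-- At a side of the quadrilateral, the old triangle on the inner side is exchanged for a new one.
-/
theorem ncard_side (h : IsFlippable D u v w z) :
    {t ∈ newTriangles D u v w z | u ∈ t ∧ w ∈ t}.ncard = (D.trianglesAt u w).ncard := by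
  obtain ⟨h₁, h₂, h₃, h₄, h₅, h₆⟩ := h.distinct
  let A : Set (Set D.V) := {t ∈ kept D u v w z | u ∈ t ∧ w ∈ t}
  have hA : A.Finite := D.finite_triangles.subset fun t ht => ht.1.1
  have e₁ : {t ∈ newTriangles D u v w z | u ∈ t ∧ w ∈ t} = insert {u, w, z} A := by
    ext t
    constructor
    · rintro ⟨h' | rfl | rfl, hm⟩
      · exact .inr ⟨h', hm⟩
      · exact .inl rfl
      · have := hm.1
        simp only [Set.mem_insert_iff, Set.mem_singleton_iff] at this
        grind
    · rintro (rfl | h')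
      · exact ⟨.inr (.inl rfl), by simp, by simp⟩
      · exact ⟨.inl h'.1, h'.2⟩
  have e₂ : D.trianglesAt u w = insert {u, v, w} A := by
    ext t
    constructor
    · rintro ⟨ht, hm⟩
      by_cases h' : t = {u, v, w}
      · exact .inl h'
      · refine .inr ⟨⟨ht, h', ?_⟩, hm⟩
        rintro rfl
        have := hm.2
        simp only [Set.mem_insert_iff, Set.mem_singleton_iff] at this
        grind
    · rintro (rfl | h')
      · exact ⟨h.left, by simp, by simp⟩
      · exact ⟨h'.1.1, h'.2⟩
  rw [e₁, e₂, Set.ncard_insert_of_notMem _ hA, Set.ncard_insert_of_notMem _ hA]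
  · exact fun h' => h'.1.2.1 rfl
  · exact fun h' => h.not_opposite h'.1.1 ⟨by simp, by simp⟩

/-- The two symmetries of the quadrilateral carry each of its four sides to `u w`. An edge that is
neither a side nor a diagonal lies in none of the four triangles involved. -/
theorem ncard_newTriangles_at (h : IsFlippable D u v w z) {a b : D.V} (hab : a ≠ b)
    (h₁ : s(a, b) ≠ s(u, v)) (h₂ : s(a, b) ≠ s(w, z)) :
    {t ∈ newTriangles D u v w z | a ∈ t ∧ b ∈ t}.ncard = (D.trianglesAt a b).ncard := by
  have side : ∀ u v w z : D.V, IsFlippable D u v w z → s(a, b) = s(u, w) →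
      {t ∈ newTriangles D u v w z | a ∈ t ∧ b ∈ t}.ncard = (D.trianglesAt a b).ncard := by
    intro u v w z h e
    rcases Sym2.eq_iff.1 e with ⟨rfl, rfl⟩ | ⟨rfl, rfl⟩
    · exact h.ncard_side
    · rw [trianglesAt_comm, ← h.ncard_side]
      simp only [and_comm]
  by_cases e₁ : s(a, b) = s(u, w)
  · exact side u v w z h e₁
  by_cases e₂ : s(a, b) = s(v, w)
  · rw [← newTriangles_swap₁]
    exact side v u w z h.swap₁ e₂
  by_cases e₃ : s(a, b) = s(u, z)
  · rw [← newTriangles_swap₂]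
    exact side u v z w h.swap₂ e₃
  by_cases e₄ : s(a, b) = s(v, z)
  · rw [← newTriangles_swap₁, ← newTriangles_swap₂]
    exact side v u z w h.swap₁.swap₂ e₄
  have key : ∀ p q r : D.V, s(a, b) ≠ s(p, q) → s(a, b) ≠ s(q, r) → s(a, b) ≠ s(p, r) →
      ¬ (a ∈ ({p, q, r} : Set D.V) ∧ b ∈ ({p, q, r} : Set D.V)) := by
    rintro p q r n₁ n₂ n₃ ⟨ha, hb⟩
    simp only [Set.mem_insert_iff, Set.mem_singleton_iff] at ha hb
    rw [ne_eq, Sym2.eq_iff] at n₁ n₂ n₃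
    grind
  congr 1
  ext t
  constructor
  · rintro ⟨h' | rfl | rfl, hm⟩
    · exact ⟨h'.1, hm⟩
    · exact absurd hm (key _ _ _ e₁ h₂ e₃)
    · exact absurd hm (key _ _ _ e₂ h₂ e₄)
  · rintro ⟨ht, hm⟩
    refine ⟨.inl ⟨ht, ?_, ?_⟩, hm⟩
    · rintro rfl; exact key _ _ _ h₁ e₂ e₁ hm
    · rintro rfl; exact key _ _ _ h₁ e₄ e₃ hm

theorem ncard_newTriangles_diagonal (h : IsFlippable D u v w z) :
    {t ∈ newTriangles D u v w z | w ∈ t ∧ z ∈ t}.ncard = 2 := by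
  obtain ⟨h₁, h₂, h₃, h₄, h₅, h₆⟩ := h.distinct
  rw [Set.ncard_eq_two]
  refine ⟨{u, w, z}, {v, w, z}, ?_, ?_⟩
  · intro e
    have : u ∈ ({v, w, z} : Set D.V) := by rw [← e]; simp
    simp only [Set.mem_insert_iff, Set.mem_singleton_iff] at this
    grind
  · ext t
    constructor
    · rintro ⟨h' | h', hm⟩
      · exact absurd hm (h.not_opposite h'.1)
      · exact h'
    · rintro (rfl | rfl)
      · exact ⟨.inr (.inl rfl), by simp, by simp⟩
      · exact ⟨.inr (.inr rfl), by simp, by simp⟩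

theorem ncard_newTriangles (h : IsFlippable D u v w z) :
    (newTriangles D u v w z).ncard = D.cx.triangles.ncard := by
  obtain ⟨h₁, h₂, h₃, h₄, h₅, h₆⟩ := h.distinct
  have hA : (kept D u v w z).Finite := D.finite_triangles.subset fun t ht => ht.1
  have e₁ : newTriangles D u v w z = insert {u, w, z} (insert {v, w, z} (kept D u v w z)) := by
    ext t
    simp only [newTriangles, kept, Set.mem_insert_iff, Set.mem_ofPred_eq]
    tauto
  have e₂ : D.cx.triangles = insert {u, v, w} (insert {u, v, z} (kept D u v w z)) := by
    ext t
    have := h.left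
    have := h.right
    simp only [kept, Set.mem_insert_iff, Set.mem_ofPred_eq]
    grind
  rw [e₁, e₂, Set.ncard_insert_of_notMem _ (hA.insert _), Set.ncard_insert_of_notMem _ hA,
    Set.ncard_insert_of_notMem _ (hA.insert _), Set.ncard_insert_of_notMem _ hA]
  · exact fun h' => h'.2.2 rfl
  · rintro (h' | h')
    · exact h.triangles_ne h'
    · exact h'.2.1 rfl
  · exact fun h' => h.not_opposite h'.1 ⟨by simp, by simp⟩
  · rintro (h' | h')
    · have : u ∈ ({v, w, z} : Set D.V) := by rw [← h']; simp
      simp only [Set.mem_insert_iff, Set.mem_singleton_iff] at this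
      grind
    · exact h.not_opposite h'.1 ⟨by simp, by simp⟩

/-- The complex after the flip. -/
def flipComplex (h : IsFlippable D u v w z) : TwoComplex D.V where
  graph :=
    { Adj := fun a b => (D.cx.graph.Adj a b ∧ s(a, b) ≠ s(u, v)) ∨ s(a, b) = s(w, z)
      symm := ⟨fun a b hab => by rwa [D.cx.graph.adj_comm, Sym2.eq_swap (a := b)]⟩
      loopless := ⟨fun a ha => by
        rcases ha with ha | ha
        · exact ha.1.ne rfl
        · have := h.ne
          rw [Sym2.eq_iff] at ha
          grind⟩ }
  triangles := newTriangles D u v w z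
  is_triangle := by
    obtain ⟨h₁, h₂, h₃, h₄, h₅, h₆⟩ := h.distinct
    rintro t (ht | rfl | rfl)
    · have hn := h.not_edge_of_kept ht
      obtain ⟨a, b, c, hab, hbc, hac, rfl⟩ := D.cx.is_triangle t ht.1
      have key : ∀ x y : D.V, x ∈ ({a, b, c} : Set D.V) → y ∈ ({a, b, c} : Set D.V) →
          s(x, y) ≠ s(u, v) := by
        intro x y hx hy e
        rcases Sym2.eq_iff.1 e with ⟨rfl, rfl⟩ | ⟨rfl, rfl⟩
        · exact hn ⟨hx, hy⟩
        · exact hn ⟨hy, hx⟩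
      exact ⟨a, b, c, .inl ⟨hab, key _ _ (by simp) (by simp)⟩,
        .inl ⟨hbc, key _ _ (by simp) (by simp)⟩, .inl ⟨hac, key _ _ (by simp) (by simp)⟩, rfl⟩
    · refine ⟨u, w, z, .inl ⟨h.adj_left, ?_⟩, .inr rfl, .inl ⟨h.swap₂.adj_left, ?_⟩, rfl⟩ <;>
      · rw [ne_eq, Sym2.eq_iff]; grind
    · refine ⟨v, w, z, .inl ⟨h.swap₁.adj_left, ?_⟩, .inr rfl,
        .inl ⟨h.swap₁.swap₂.adj_left, ?_⟩, rfl⟩ <;>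
      · rw [ne_eq, Sym2.eq_iff]; grind

theorem mem_uwz (h : IsFlippable D u v w z) : ({u, w, z} : Set D.V) ∈ h.flipComplex.triangles :=
  .inr (.inl rfl)

theorem mem_vwz (h : IsFlippable D u v w z) : ({v, w, z} : Set D.V) ∈ h.flipComplex.triangles :=
  .inr (.inr rfl)

open Classical in
-- A cocycle on the new complex is transferred to the old one by giving the deleted edge `u v` its
-- value along `u w v`. The condition at `u v w` is then immediate, and that at `u v z` combines the
-- two new triangles. The resulting potential also fits the new diagonal, whose value is computed
-- along `w u z`.
theorem simplyConnected_flipComplex (h : IsFlippable D u v w z) :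
    h.flipComplex.SimplyConnected := by
  obtain ⟨h₁, h₂, h₃, h₄, h₅, h₆⟩ := h.distinct
  have huw : h.flipComplex.graph.Adj u w :=
    TwoComplex.adj_of_mem_triangle h.mem_uwz (by simp) (by simp) h₂
  have huz : h.flipComplex.graph.Adj u z :=
    TwoComplex.adj_of_mem_triangle h.mem_uwz (by simp) (by simp) h₃
  have hvw : h.flipComplex.graph.Adj v w :=
    TwoComplex.adj_of_mem_triangle h.mem_vwz (by simp) (by simp) h₄
  have hvz : h.flipComplex.graph.Adj v z :=
    TwoComplex.adj_of_mem_triangle h.mem_vwz (by simp) (by simp) h₅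
  have hwz : h.flipComplex.graph.Adj w z := .inr rfl
  refine TwoComplex.simplyConnected_of_isCoboundary
    (TwoComplex.connected_of_surjective D.simplyConnected.1 id Function.surjective_id ?_) ?_
  · intro a b hab
    by_cases e : s(a, b) = s(u, v)
    · rcases Sym2.eq_iff.1 e with ⟨rfl, rfl⟩ | ⟨rfl, rfl⟩
      · exact huw.reachable.trans hvw.symm.reachable
      · exact hvw.reachable.trans huw.symm.reachable
    · exact SimpleGraph.Adj.reachable (.inl ⟨hab, e⟩)
  intro G _ φ' hφ'
  let φ : D.V → D.V → G := fun a b =>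
    if a = u ∧ b = v then φ' u w * φ' w v else if a = v ∧ b = u then φ' v w * φ' w u else φ' a b
  have φ_uv : φ u v = φ' u w * φ' w v := if_pos ⟨rfl, rfl⟩
  have φ_vu : φ v u = φ' v w * φ' w u :=
    (if_neg fun e => h₁ e.2).trans (if_pos ⟨rfl, rfl⟩)
  have φ_ne : ∀ {a b}, s(a, b) ≠ s(u, v) → φ a b = φ' a b := by
    intro a b hn
    rw [ne_eq, Sym2.eq_iff] at hn
    simp only [φ]
    rw [if_neg (by tauto), if_neg (by tauto)]
  have suw := hφ'.mul_swap _ _ huw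
  have svw := hφ'.mul_swap _ _ hvw
  have swu := hφ'.mul_swap _ _ huw.symm
  have swv := hφ'.mul_swap _ _ hvw.symm
  have svz := hφ'.mul_swap _ _ hvz
  have szv := hφ'.mul_swap _ _ hvz.symm
  have hφ : D.cx.IsCocycle φ := by
    refine TwoComplex.IsCocycle.of_enumeration (fun a b hab => ?_) (fun t ht => ?_)
    · by_cases e : s(a, b) = s(u, v)
      · rcases Sym2.eq_iff.1 e with ⟨rfl, rfl⟩ | ⟨rfl, rfl⟩
        · rw [φ_uv, φ_vu, mul_assoc, ← mul_assoc (φ' w _), swv, one_mul, suw]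
        · rw [φ_uv, φ_vu, mul_assoc, ← mul_assoc (φ' w _), swu, one_mul, svw]
      · rw [φ_ne e, φ_ne (by rwa [Sym2.eq_swap])]
        exact hφ'.mul_swap _ _ (.inl ⟨hab, e⟩)
    · by_cases e₁ : t = {u, v, w}
      · refine ⟨u, v, w, e₁, ?_⟩
        rw [φ_uv, φ_ne (by rw [ne_eq, Sym2.eq_iff]; grind),
          φ_ne (by rw [ne_eq, Sym2.eq_iff]; grind), mul_assoc, swv, mul_one]
      · by_cases e₂ : t = {u, v, z}
        · refine ⟨u, v, z, e₂, ?_⟩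
          rw [φ_uv, φ_ne (by rw [ne_eq, Sym2.eq_iff]; grind),
            φ_ne (by rw [ne_eq, Sym2.eq_iff]; grind), mul_assoc]
          have t₁ := hφ'.mul_triangle u w z h.mem_uwz
          have t₂ := hφ'.mul_triangle w v z (by rw [Set.insert_comm]; exact h.mem_vwz)
          rw [t₂, t₁]
        · have hn := h.not_edge_of_kept ⟨ht, e₁, e₂⟩
          obtain ⟨a, b, c, hab, hbc, hac, rfl⟩ := D.cx.is_triangle t ht
          have key : ∀ x y : D.V, x ∈ ({a, b, c} : Set D.V) → y ∈ ({a, b, c} : Set D.V) →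
              s(x, y) ≠ s(u, v) := by
            intro x y hx hy e
            rcases Sym2.eq_iff.1 e with ⟨rfl, rfl⟩ | ⟨rfl, rfl⟩
            · exact hn ⟨hx, hy⟩
            · exact hn ⟨hy, hx⟩
          refine ⟨a, b, c, rfl, ?_⟩
          rw [φ_ne (key _ _ (by simp) (by simp)), φ_ne (key _ _ (by simp) (by simp)),
            φ_ne (key _ _ (by simp) (by simp))]
          exact hφ'.mul_triangle a b c (.inl ⟨ht, e₁, e₂⟩)
  obtain ⟨k, hk⟩ := D.simplyConnected.isCoboundary hφ
  have kwz : φ' w z = (k w)⁻¹ * k z := by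
    have t₁ := hφ'.mul_triangle w u z (by rw [Set.insert_comm]; exact h.mem_uwz)
    have k₁ := hk w u h.adj_left.symm
    have k₂ := hk u z h.swap₂.adj_left
    rw [φ_ne (by rw [ne_eq, Sym2.eq_iff]; grind)] at k₁ k₂
    rw [← t₁, k₁, k₂]
    group
  refine ⟨k, fun a b hab => ?_⟩
  rcases hab with ⟨hab, hn⟩ | e
  · rw [← hk a b hab, φ_ne hn]
  · rcases Sym2.eq_iff.1 e with ⟨rfl, rfl⟩ | ⟨rfl, rfl⟩
    · exact kwz
    · have := eq_inv_of_mul_eq_one_right (hφ'.mul_swap _ _ hwz)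
      rw [this, kwz]
      group

/-- Two neighbours of `x` are consecutive in the link of `x` after the flip. -/
def FlipLinkRel (h : IsFlippable D u v w z) (x p q : D.V) : Prop :=
  ({x, p, q} : Set D.V) ∈ h.flipComplex.triangles ∨
    ∃ i, D.bd (i + 1) = x ∧ s(D.bd i, D.bd (i + 2)) = s(p, q)

theorem FlipLinkRel.symm (h : IsFlippable D u v w z) {x p q : D.V} (hpq : h.FlipLinkRel x p q) :
    h.FlipLinkRel x q p := by
  rcases hpq with h' | ⟨i, h', e⟩
  · exact .inl (by rwa [TwoComplex.pair_mem_triangle_comm])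
  · exact .inr ⟨i, h', e.trans Sym2.eq_swap⟩

theorem FlipLinkRel.of_eq (h : IsFlippable D u v w z) {x p q a b : D.V} (e : s(p, q) = s(a, b))
    (hab : Relation.ReflTransGen (h.FlipLinkRel x) a b) :
    Relation.ReflTransGen (h.FlipLinkRel x) p q := by
  rcases Sym2.eq_iff.1 e with ⟨rfl, rfl⟩ | ⟨rfl, rfl⟩
  · exact hab
  · exact reflTransGen_symm (fun _ _ => FlipLinkRel.symm h) hab

open Classical in
-- Old link paths are adapted to the flip. At `u` and `v`, the lost neighbour is replaced by `w`. At
-- `w`, the step from `u` to `v` is subdivided by the new neighbour `z`, and at `z` it is subdivided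
-- by `w`.
theorem link_connected_flip [NeZero n] (h : IsFlippable D u v w z) (x a b : D.V)
    (ha : h.flipComplex.graph.Adj x a) (hb : h.flipComplex.graph.Adj x b) :
    Relation.ReflTransGen (h.FlipLinkRel x) a b := by
  obtain ⟨h₁, h₂, h₃, h₄, h₅, h₆⟩ := h.distinct
  have symm : ∀ {p q}, Relation.ReflTransGen (h.FlipLinkRel x) p q →
      Relation.ReflTransGen (h.FlipLinkRel x) q p :=
    reflTransGen_symm fun _ _ => FlipLinkRel.symm h
  let g : D.V → D.V := fun c => if s(x, c) = s(u, v) then w else c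
  have g_pos : ∀ {c}, s(x, c) = s(u, v) → g c = w := fun e => if_pos e
  have g_neg : ∀ {c}, s(x, c) ≠ s(u, v) → g c = c := fun e => if_neg e
  have step : ∀ p q, D.LinkRel x p q →
      Relation.ReflTransGen (h.FlipLinkRel x) (g p) (g q) := by
    have gen : ∀ p q : D.V, ∀ {a b : D.V}, s(p, q) = s(a, b) →
        Relation.ReflTransGen (h.FlipLinkRel x) (g a) (g b) →
        Relation.ReflTransGen (h.FlipLinkRel x) (g p) (g q) := by
      intro p q a b e hab
      refine FlipLinkRel.of_eq h ?_ hab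
      rcases Sym2.eq_iff.1 e with ⟨rfl, rfl⟩ | ⟨rfl, rfl⟩
      · rfl
      · exact Sym2.eq_swap
    have guv : x = u → g v = w := fun e => g_pos (by rw [e])
    have gvu : x = v → g u = w := fun e => g_pos (by rw [e, Sym2.eq_swap])
    have gw : x = u ∨ x = v → g w = w := fun e => g_neg (by rw [ne_eq, Sym2.eq_iff]; grind)
    have gz : x = u ∨ x = v → g z = z := fun e => g_neg (by rw [ne_eq, Sym2.eq_iff]; grind)
    have gu : x = w ∨ x = z → g u = u := fun e => g_neg (by rw [ne_eq, Sym2.eq_iff]; grind)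
    have gv : x = w ∨ x = z → g v = v := fun e => g_neg (by rw [ne_eq, Sym2.eq_iff]; grind)
    intro p q hpq
    rcases hpq with ht | ⟨i, hi, e⟩
    · obtain ⟨m₁, m₂, m₃⟩ := TwoComplex.ne_of_triangle ht
      by_cases e₁ : ({x, p, q} : Set D.V) = {u, v, w}
      · have hx : x ∈ ({u, v, w} : Set D.V) := by rw [← e₁]; simp
        rcases hx with hx | hx | hx
        · subst hx
          refine gen p q (TwoComplex.sym2_eq_of_triple_eq m₁ m₃ h₁ h₂ e₁) ?_
          rw [guv rfl, gw (.inl rfl)]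
        · subst hx
          rw [Set.insert_comm u] at e₁
          refine gen p q (TwoComplex.sym2_eq_of_triple_eq m₁ m₃ h₁.symm h₄ e₁) ?_
          rw [gvu rfl, gw (.inr rfl)]
        · rw [Set.mem_singleton_iff] at hx
          subst hx
          have e₂ : ({u, v, x} : Set D.V) = {x, u, v} := by
            rw [Set.pair_comm, Set.insert_comm]
          refine gen p q (TwoComplex.sym2_eq_of_triple_eq m₁ m₃ h₂.symm h₄.symm (e₁.trans e₂)) ?_
          rw [gu (.inl rfl), gv (.inl rfl)]
          refine .tail (.single (b := z) (.inl ?_)) (.inl ?_)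
          · rw [Set.insert_comm]; exact h.mem_uwz
          · rw [Set.pair_comm, Set.insert_comm]; exact h.mem_vwz
      by_cases e₂ : ({x, p, q} : Set D.V) = {u, v, z}
      · have hx : x ∈ ({u, v, z} : Set D.V) := by rw [← e₂]; simp
        rcases hx with hx | hx | hx
        · subst hx
          refine gen p q (TwoComplex.sym2_eq_of_triple_eq m₁ m₃ h₁ h₃ e₂) ?_
          rw [guv rfl, gz (.inl rfl)]
          exact .single (.inl h.mem_uwz)
        · subst hx
          rw [Set.insert_comm u] at e₂
          refine gen p q (TwoComplex.sym2_eq_of_triple_eq m₁ m₃ h₁.symm h₅ e₂) ?_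
          rw [gvu rfl, gz (.inr rfl)]
          exact .single (.inl h.mem_vwz)
        · rw [Set.mem_singleton_iff] at hx
          subst hx
          have e₃ : ({u, v, x} : Set D.V) = {x, u, v} := by
            rw [Set.pair_comm, Set.insert_comm]
          refine gen p q (TwoComplex.sym2_eq_of_triple_eq m₁ m₃ h₃.symm h₅.symm (e₂.trans e₃)) ?_
          rw [gu (.inr rfl), gv (.inr rfl)]
          refine .tail (.single (b := w) (.inl ?_)) (.inl ?_)
          · rw [Set.insert_comm, Set.pair_comm]; exact h.mem_uwz
          · rw [Set.insert_comm, Set.pair_comm, Set.insert_comm]; exact h.mem_vwz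
      · have hk : ({x, p, q} : Set D.V) ∈ kept D u v w z := ⟨ht, e₁, e₂⟩
        have hn := h.not_edge_of_kept hk
        have key : ∀ c ∈ ({x, p, q} : Set D.V), s(x, c) ≠ s(u, v) := by
          intro c hc e
          rcases Sym2.eq_iff.1 e with ⟨rfl, rfl⟩ | ⟨rfl, rfl⟩
          · exact hn ⟨by simp, hc⟩
          · exact hn ⟨hc, by simp⟩
        rw [g_neg (key p (by simp)), g_neg (key q (by simp))]
        exact .single (.inl (.inl hk))
    · obtain ⟨hp, hq⟩ := passages_nonempty_of_bd hi e
      have key : ∀ c, (D.passages x c).Nonempty → s(x, c) ≠ s(u, v) := by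
        intro c hc e
        have : D.passages x c = D.passages u v := by simp only [passages, e]
        rw [this, h.passages_eq] at hc
        simp at hc
      rw [g_neg (key p hp), g_neg (key q hq)]
      exact .single (.inr ⟨i, hi, e⟩)
  -- The neighbour gained along the new diagonal is joined in the link to the old neighbour `u`, so
  -- only old neighbours have to be connected.
  have old : ∀ a, h.flipComplex.graph.Adj x a → ∃ a', D.cx.graph.Adj x a' ∧ g a' = a' ∧
      Relation.ReflTransGen (h.FlipLinkRel x) a a' := by
    rintro a (⟨hxa, hn⟩ | e)
    · exact ⟨a, hxa, g_neg hn, .refl⟩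
    · rcases Sym2.eq_iff.1 e with ⟨rfl, rfl⟩ | ⟨rfl, rfl⟩
      · refine ⟨u, h.adj_left.symm, g_neg (by rw [ne_eq, Sym2.eq_iff]; grind), .single (.inl ?_)⟩
        rw [Set.pair_comm, Set.insert_comm]; exact h.mem_uwz
      · refine ⟨u, h.swap₂.adj_left.symm, g_neg (by rw [ne_eq, Sym2.eq_iff]; grind),
          .single (.inl ?_)⟩
        rw [Set.pair_comm, Set.insert_comm, Set.pair_comm]; exact h.mem_uwz
  obtain ⟨a', ha₁, ha₂, ha₃⟩ := old a ha
  obtain ⟨b', hb₁, hb₂, hb₃⟩ := old b hb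
  have := reflTransGen_lift (r := D.LinkRel x) g step (D.link_connected x a' b' ha₁ hb₁)
  rw [ha₂, hb₂] at this
  exact (ha₃.trans this).trans (symm hb₃)

/-- The singular disc after the flip. -/
def flip [NeZero n] (h : IsFlippable D u v w z) : SingularDisc.{u} n where
  V := D.V
  finite := D.finite
  cx := h.flipComplex
  bd := D.bd
  simplyConnected := h.simplyConnected_flipComplex
  bd_adj i := by
    refine .inl ⟨D.bd_adj i, fun e => ?_⟩
    have : i ∈ D.passages u v := e
    rw [h.passages_eq] at this
    exact this
  two_sides a b hab := by
    by_cases e : s(a, b) = s(w, z)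
    · have h₁ : {i | s(D.bd i, D.bd (i + 1)) = s(a, b)} = ∅ := by
        rw [Set.eq_empty_iff_forall_notMem]
        intro i (hi : s(D.bd i, D.bd (i + 1)) = s(a, b))
        have hadj := D.bd_adj i
        rw [← SimpleGraph.mem_edgeSet, hi, e, SimpleGraph.mem_edgeSet] at hadj
        exact h.not_adj hadj
      have h₂ : {t ∈ newTriangles D u v w z | a ∈ t ∧ b ∈ t}.ncard = 2 := by
        rw [← h.ncard_newTriangles_diagonal]
        rcases Sym2.eq_iff.1 e with ⟨rfl, rfl⟩ | ⟨rfl, rfl⟩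
        · rfl
        · simp only [and_comm]
      rw [h₁, Set.ncard_empty]
      exact h₂
    · obtain ⟨hab', hn⟩ := hab.resolve_right e
      have := ncard_add_ncard hab'
      rw [← h.ncard_newTriangles_at hab'.ne hn e] at this
      exact this
  link_connected := h.link_connected_flip

end IsFlippable

end SingularDisc

namespace DiscDiagram

variable {W : Type v} {X : MetricComplex W} {n : ℕ} {C : ZMod n → W}

/-- The edge `u v` may be flipped if the opposite vertices are not adjacent and the new edge has
adjacent or equal endpoints in `X`. -/
theorem exists_flip [NeZero n] (D : DiscDiagram.{u} X C) {u v w z : D.V}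
    (h : SingularDisc.IsFlippable D.toSingularDisc u v w z)
    (hf : X.graph.Adj (D.f w) (D.f z) ∨ D.f w = D.f z) :
    ∃ D' : DiscDiagram.{u} X C, IsFlip D D' u v w z ∧ D'.area = D.area := by
  refine ⟨{ toSingularDisc := h.flip
            f := D.f
            simplicial := ?_
            f_bd := D.f_bd }, ⟨Equiv.refl _, fun _ => rfl, fun _ => rfl, fun _ _ => Iff.rfl, ?_⟩,
    h.ncard_newTriangles⟩
  · rintro a b (hab | e)
    · exact D.simplicial a b hab.1
    · have e' : s(D.f a, D.f b) = s(D.f w, D.f z) := congrArg (Sym2.map D.f) e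
      rcases Sym2.eq_iff.1 e' with ⟨e₁, e₂⟩ | ⟨e₁, e₂⟩
      · rw [e₁, e₂]; exact hf
      · rw [e₁, e₂]; exact hf.imp SimpleGraph.Adj.symm Eq.symm
  · intro t
    have : (fun x : D.V => (Equiv.refl D.V) x) '' t = t := by simp
    change (fun x : D.V => (Equiv.refl D.V) x) '' t ∈ _ ↔ _
    rw [this]
    exact Iff.rfl

theorem IsFlip.usesNoNewVertices {D D' : DiscDiagram.{u} X C} {u v w z : D.V}
    (h : IsFlip D D' u v w z) : UsesNoNewVertices D D' := by
  obtain ⟨e, he, -⟩ := h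
  exact ⟨e.symm, e.symm.injective, fun x => by rw [← he, e.apply_symm_apply]⟩

end DiscDiagram

/-! ### Collapsing an edge (C-moves). -/

namespace SingularDisc

variable {n : ℕ} {D : SingularDisc.{u} n}

/-- An interior edge all of whose common neighbours span a triangle with it. -/
structure IsCollapsible (D : SingularDisc.{u} n) (u₁ u₂ : D.V) : Prop where
  adj : D.cx.graph.Adj u₁ u₂
  passages_eq : D.passages u₁ u₂ = ∅
  noEmptyTriangle : D.cx.NoEmptyTriangle

namespace IsCollapsible

variable {u₁ u₂ : D.V}

theorem symm (h : IsCollapsible D u₁ u₂) : IsCollapsible D u₂ u₁ :=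
  ⟨h.adj.symm, by rw [passages_comm]; exact h.passages_eq, h.noEmptyTriangle⟩

open Classical in
/-- The quotient map on the vertices. -/
noncomputable def quot (h : IsCollapsible D u₁ u₂) (x : D.V) : {x : D.V // x ≠ u₂} :=
  if hx : x = u₂ then ⟨u₁, h.adj.ne⟩ else ⟨x, hx⟩

theorem quot_right (h : IsCollapsible D u₁ u₂) : h.quot u₂ = ⟨u₁, h.adj.ne⟩ := dif_pos rfl

theorem quot_of_ne (h : IsCollapsible D u₁ u₂) {x : D.V} (hx : x ≠ u₂) : h.quot x = ⟨x, hx⟩ :=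
  dif_neg hx

theorem quot_val (h : IsCollapsible D u₁ u₂) (x : {x : D.V // x ≠ u₂}) : h.quot x.1 = x :=
  h.quot_of_ne x.2

theorem quot_eq_iff (h : IsCollapsible D u₁ u₂) {a : D.V} {x : {x : D.V // x ≠ u₂}} :
    h.quot a = x ↔ a = x.1 ∨ (a = u₂ ∧ x.1 = u₁) := by
  obtain ⟨x, hx⟩ := x
  by_cases ha : a = u₂
  · subst ha
    rw [h.quot_right, Subtype.mk_eq_mk]
    constructor
    · rintro rfl; exact .inr ⟨rfl, rfl⟩
    · rintro (h' | h')
      · exact absurd h'.symm hx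
      · exact h'.2.symm
  · rw [h.quot_of_ne ha, Subtype.mk_eq_mk]
    tauto

theorem quot_eq_quot_iff (h : IsCollapsible D u₁ u₂) {a b : D.V} :
    h.quot a = h.quot b ↔ a = b ∨ s(a, b) = s(u₁, u₂) := by
  rw [Sym2.eq_iff]
  by_cases hb : b = u₂
  · subst hb
    rw [h.quot_right, h.quot_eq_iff]
    have := h.adj.ne
    grind
  · rw [h.quot_of_ne hb, h.quot_eq_iff]
    grind

/-- The triangles that survive the collapse. -/
def kept (D : SingularDisc.{u} n) (u₁ u₂ : D.V) : Set (Set D.V) :=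
  {s | s ∈ D.cx.triangles ∧ ¬ (u₁ ∈ s ∧ u₂ ∈ s)}

theorem triangle_of_common (h : IsCollapsible D u₁ u₂) {y : D.V} (h₁ : D.cx.graph.Adj u₁ y)
    (h₂ : D.cx.graph.Adj u₂ y) : ({u₁, u₂, y} : Set D.V) ∈ D.cx.triangles :=
  h.noEmptyTriangle _ _ _ h.adj h₂ h₁

theorem injOn_quot_right (h : IsCollapsible D u₁ u₂) : Set.InjOn h.quot {x | x ≠ u₂} := by
  intro a (ha : a ≠ u₂) b (hb : b ≠ u₂) e
  rcases h.quot_eq_quot_iff.1 e with h' | h'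
  · exact h'
  · rw [Sym2.eq_iff] at h'; grind

theorem injOn_quot_left (h : IsCollapsible D u₁ u₂) : Set.InjOn h.quot {x | x ≠ u₁} := by
  intro a (ha : a ≠ u₁) b (hb : b ≠ u₁) e
  rcases h.quot_eq_quot_iff.1 e with h' | h'
  · exact h'
  · rw [Sym2.eq_iff] at h'; grind

theorem kept_subset (D : SingularDisc.{u} n) (u₁ u₂ : D.V) : kept D u₁ u₂ ⊆ D.cx.triangles :=
  fun _ h => h.1

/-- Suppose two surviving triangles with the same image used different ends of the collapsed edge.
They would then have the form `u₁ p r` and `u₂ p r`. As there are no empty triangles, `u₁ u₂ p` and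
`u₁ u₂ r` are triangles too, and the four form the boundary of a tetrahedron. -/
theorem not_mixed [NeZero n] (h : IsCollapsible D u₁ u₂) {s t : Set D.V}
    (hs : s ∈ kept D u₁ u₂) (ht : t ∈ kept D u₁ u₂) (e : h.quot '' s = h.quot '' t) (hus : u₂ ∈ s) :
    u₂ ∈ t := by
  by_contra hut
  have h₁s : u₁ ∉ s := fun h' => hs.2 ⟨h', hus⟩
  obtain ⟨p, r, rfl⟩ := TwoComplex.exists_other_two hs.1 hus
  obtain ⟨n₁, n₂, n₃⟩ := TwoComplex.ne_of_triangle hs.1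
  have hp₁ : p ≠ u₁ := fun h' => h₁s (by simp [h'])
  have hr₁ : r ≠ u₁ := fun h' => h₁s (by simp [h'])
  have e' : h.quot '' {u₁, p, r} = h.quot '' t := by
    rw [← e]
    simp only [Set.image_insert_eq, Set.image_singleton]
    rw [h.quot_right, h.quot_of_ne h.adj.ne]
  have et : ({u₁, p, r} : Set D.V) = t := by
    refine (h.injOn_quot_right.image_eq_image_iff ?_ ?_).1 e'
    · rintro x (rfl | rfl | rfl)
      · exact h.adj.ne
      · exact n₁.symm
      · exact n₃.symm
    · intro x hx h'
      exact hut (h' ▸ hx)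
  have ht' := ht.1
  rw [← et] at ht'
  have adj := fun {a b : D.V} {t : Set D.V} => TwoComplex.adj_of_mem_triangle (K := D.cx)
    (a := a) (b := b) (t := t)
  exact not_tetrahedron
    (h.triangle_of_common (y := p) (adj ht' (by simp) (by simp) hp₁.symm)
      (adj hs.1 (by simp) (by simp) n₁))
    (h.triangle_of_common (y := r) (adj ht' (by simp) (by simp) hr₁.symm)
      (adj hs.1 (by simp) (by simp) n₃)) ht' hs.1

/-- By `not_mixed`, both triangles avoid `u₁` or both avoid `u₂`, and the quotient map is injective
off either end. -/
theorem injOn_image [NeZero n] (h : IsCollapsible D u₁ u₂) :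
    Set.InjOn (fun s => h.quot '' s) (kept D u₁ u₂) := by
  intro s hs t ht e
  by_cases hus : u₂ ∈ s
  · have hut := h.not_mixed hs ht e hus
    refine (h.injOn_quot_left.image_eq_image_iff ?_ ?_).1 e
    · rintro x hx rfl
      exact hs.2 ⟨hx, hus⟩
    · rintro x hx rfl
      exact ht.2 ⟨hx, hut⟩
  · have hut : u₂ ∉ t := fun h' => hus (h.not_mixed ht hs e.symm h')
    refine (h.injOn_quot_right.image_eq_image_iff ?_ ?_).1 e
    · rintro x hx rfl
      exact hus hx
    · rintro x hx rfl
      exact hut hx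

/-- The complex after the collapse. -/
def collapseComplex (h : IsCollapsible D u₁ u₂) : TwoComplex {x : D.V // x ≠ u₂} where
  graph :=
    { Adj := fun x y => x ≠ y ∧ ∃ a b, D.cx.graph.Adj a b ∧ h.quot a = x ∧ h.quot b = y
      symm := ⟨fun _ _ ⟨hne, a, b, hab, ha, hb⟩ => ⟨hne.symm, b, a, hab.symm, hb, ha⟩⟩
      loopless := ⟨fun _ hx => hx.1 rfl⟩ }
  triangles := {t | ∃ s ∈ D.cx.triangles, ¬ (u₁ ∈ s ∧ u₂ ∈ s) ∧ t = h.quot '' s}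
  is_triangle := by
    rintro t ⟨s, hs, hn, rfl⟩
    obtain ⟨a, b, c, hab, hbc, hac, rfl⟩ := D.cx.is_triangle s hs
    have key : ∀ x y : D.V, x ∈ ({a, b, c} : Set D.V) → y ∈ ({a, b, c} : Set D.V) → x ≠ y →
        h.quot x ≠ h.quot y := by
      intro x y hx hy hxy e
      rcases h.quot_eq_quot_iff.1 e with e | e
      · exact hxy e
      · rcases Sym2.eq_iff.1 e with ⟨rfl, rfl⟩ | ⟨rfl, rfl⟩
        · exact hn ⟨hx, hy⟩
        · exact hn ⟨hy, hx⟩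
    refine ⟨h.quot a, h.quot b, h.quot c, ⟨key _ _ (by simp) (by simp) hab.ne, a, b, hab, rfl, rfl⟩,
      ⟨key _ _ (by simp) (by simp) hbc.ne, b, c, hbc, rfl, rfl⟩,
      ⟨key _ _ (by simp) (by simp) hac.ne, a, c, hac, rfl, rfl⟩, ?_⟩
    rw [Set.image_insert_eq, Set.image_insert_eq, Set.image_singleton]

theorem triangle_quot (h : IsCollapsible D u₁ u₂) {a b c : D.V}
    (ht : ({a, b, c} : Set D.V) ∈ kept D u₁ u₂) :
    ({h.quot a, h.quot b, h.quot c} : Set _) ∈ h.collapseComplex.triangles :=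
  ⟨_, ht.1, ht.2, by rw [Set.image_insert_eq, Set.image_insert_eq, Set.image_singleton]⟩

theorem simplyConnected_collapseComplex (h : IsCollapsible D u₁ u₂) :
    h.collapseComplex.SimplyConnected := by
  refine D.simplyConnected.map h.quot Subtype.val h.quot_val ?_ ?_ ?_
  · intro a b hab
    by_cases e : h.quot a = h.quot b
    · exact .inl e
    · exact .inr ⟨e, a, b, hab, rfl, rfl⟩
  · intro a b c ht hab hbc hac
    refine h.triangle_quot ⟨ht, fun hm => ?_⟩
    have e : h.quot u₁ = h.quot u₂ := by rw [h.quot_right, h.quot_of_ne h.adj.ne]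
    have := h.adj.ne
    simp only [Set.mem_insert_iff, Set.mem_singleton_iff] at hm
    rcases hm with ⟨rfl | rfl | rfl, rfl | rfl | rfl⟩ <;> first
      | exact this rfl
      | exact hab e
      | exact hab e.symm
      | exact hbc e
      | exact hbc e.symm
      | exact hac e
      | exact hac e.symm
  · rintro x y ⟨-, a, b, hab, ha, hb⟩
    have key : ∀ a (x : {x : D.V // x ≠ u₂}), h.quot a = x → a = x.1 ∨ D.cx.graph.Adj a x.1 := by
      intro a x e
      rcases h.quot_eq_iff.1 e with e | ⟨rfl, e⟩
      · exact .inl e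
      · rw [e]; exact .inr h.adj.symm
    exact ⟨a, b, hab, ha, hb, key a x ha, key b y hb⟩

/-- The collapse removes from the edge `u₁ y` exactly the triangle `u₁ u₂ y`, present precisely when
`y` is a common neighbour. The last summand is the indicator of this. -/
theorem ncard_link (h : IsCollapsible D u₁ u₂) {y : D.V} (h₁ : D.cx.graph.Adj u₁ y) (hy : y ≠ u₂) :
    (D.trianglesAt u₁ y ∩ kept D u₁ u₂).ncard + (D.passages u₁ y).ncard +
      {z | z = y ∧ D.cx.graph.Adj u₂ y}.ncard = 2 := by
  rw [← ncard_add_ncard h₁]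
  by_cases h₂ : D.cx.graph.Adj u₂ y
  · have e : D.trianglesAt u₁ y = insert {u₁, u₂, y} (D.trianglesAt u₁ y ∩ kept D u₁ u₂) := by
      ext t
      constructor
      · intro ht
        by_cases hu : u₂ ∈ t
        · left
          obtain ⟨c, rfl⟩ := TwoComplex.exists_third ht.1 ht.2.1 ht.2.2 h₁.ne
          have := h.adj.ne
          simp only [Set.mem_insert_iff, Set.mem_singleton_iff] at hu
          have : c = u₂ := by grind
          rw [this, Set.pair_comm]
        · exact .inr ⟨ht, ht.1, fun h' => hu h'.2⟩
      · rintro (rfl | ht)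
        · exact ⟨h.triangle_of_common h₁ h₂, by simp, by simp⟩
        · exact ht.1
    have e' : {z | z = y ∧ D.cx.graph.Adj u₂ y} = {y} := by ext z; simp [h₂]
    rw [e', Set.ncard_singleton]
    conv_rhs => rw [e]
    rw [Set.ncard_insert_of_notMem (fun h' => h'.2.2 (by simp))
      ((D.finite_trianglesAt _ _).inter_of_left _)]
    omega
  · have e' : {z | z = y ∧ D.cx.graph.Adj u₂ y} = ∅ := by ext z; simp [h₂]
    have e : D.trianglesAt u₁ y ∩ kept D u₁ u₂ = D.trianglesAt u₁ y := by
      rw [Set.inter_eq_left]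
      intro t ht
      refine ⟨ht.1, fun hm => h₂ ?_⟩
      exact TwoComplex.adj_of_mem_triangle ht.1 hm.2 ht.2.2 hy.symm
    rw [e', Set.ncard_empty, e, add_zero]

theorem kept_symm (D : SingularDisc.{u} n) (u₁ u₂ : D.V) : kept D u₂ u₁ = kept D u₁ u₂ := by
  simp only [kept, and_comm (a := u₁ ∈ _)]

/-- If `y` is a common neighbour, each of its two edges keeps one side and they are glued together;
otherwise the single edge keeps both of its sides. -/
theorem ncard_link_add [NeZero n] (h : IsCollapsible D u₁ u₂) {y : D.V} (hy₁ : y ≠ u₁) (hy₂ : y ≠ u₂)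
    (hy : D.cx.graph.Adj u₁ y ∨ D.cx.graph.Adj u₂ y) :
    (D.trianglesAt u₁ y ∩ kept D u₁ u₂).ncard + (D.trianglesAt u₂ y ∩ kept D u₁ u₂).ncard +
      ((D.passages u₁ y).ncard + (D.passages u₂ y).ncard) = 2 := by
  have zero : ∀ x, x ≠ y → ¬ D.cx.graph.Adj x y →
      (D.trianglesAt x y ∩ kept D u₁ u₂).ncard = 0 ∧ (D.passages x y).ncard = 0 := by
    intro x hxy hn
    have e₁ : D.trianglesAt x y = ∅ := by
      rw [Set.eq_empty_iff_forall_notMem]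
      exact fun t ht => hn (TwoComplex.adj_of_mem_triangle ht.1 ht.2.1 ht.2.2 hxy)
    have e₂ : D.passages x y = ∅ := by
      rw [Set.eq_empty_iff_forall_notMem]
      intro i (hi : s(D.bd i, D.bd (i + 1)) = s(x, y))
      have hadj := D.bd_adj i
      rw [← SimpleGraph.mem_edgeSet, hi, SimpleGraph.mem_edgeSet] at hadj
      exact hn hadj
    simp [e₁, e₂]
  have one : ∀ p : Prop, p → {z | z = y ∧ p}.ncard = 1 := by
    intro p hp
    simp [hp]
  have none : ∀ p : Prop, ¬ p → {z | z = y ∧ p}.ncard = 0 := by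
    intro p hp
    simp [hp]
  by_cases h₁ : D.cx.graph.Adj u₁ y <;> by_cases h₂ : D.cx.graph.Adj u₂ y
  · have e₁ := h.ncard_link h₁ hy₂
    have e₂ := h.symm.ncard_link h₂ hy₁
    rw [kept_symm, one _ h₁] at e₂
    rw [one _ h₂] at e₁
    omega
  · have e₁ := h.ncard_link h₁ hy₂
    rw [none _ h₂] at e₁
    have := zero u₂ hy₂.symm h₂
    omega
  · have e₂ := h.symm.ncard_link h₂ hy₁
    rw [kept_symm, none _ h₁] at e₂
    have := zero u₁ hy₁.symm h₁
    omega
  · tauto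

theorem mem_image_quot_iff (h : IsCollapsible D u₁ u₂) {x : {x : D.V // x ≠ u₂}} {s : Set D.V} :
    x ∈ h.quot '' s ↔ x.1 ∈ s ∨ (u₂ ∈ s ∧ x.1 = u₁) := by
  constructor
  · rintro ⟨a, ha, e⟩
    rcases h.quot_eq_iff.1 e with rfl | ⟨rfl, e⟩
    · exact .inl ha
    · exact .inr ⟨ha, e⟩
  · rintro (hx | ⟨hu, e⟩)
    · exact ⟨x.1, hx, h.quot_val x⟩
    · exact ⟨u₂, hu, h.quot_eq_iff.2 (.inr ⟨rfl, e⟩)⟩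

/-- Surviving triangles correspond bijectively to their images, so sides may be counted upstairs.
Only edges at the merged vertex need the combined count of `ncard_link_add`. -/
theorem two_sides_collapse [NeZero n] (h : IsCollapsible D u₁ u₂) {x y : {x : D.V // x ≠ u₂}}
    (hxy : h.collapseComplex.graph.Adj x y) :
    {t ∈ h.collapseComplex.triangles | x ∈ t ∧ y ∈ t}.ncard +
      {i | s(h.quot (D.bd i), h.quot (D.bd (i + 1))) = s(x, y)}.ncard = 2 := by
  have e₁ : {t ∈ h.collapseComplex.triangles | x ∈ t ∧ y ∈ t} =
      (fun s => h.quot '' s) '' {s ∈ kept D u₁ u₂ | x ∈ h.quot '' s ∧ y ∈ h.quot '' s} := by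
    ext t
    constructor
    · rintro ⟨⟨s, hs, hn, rfl⟩, hm⟩
      exact ⟨s, ⟨⟨hs, hn⟩, hm⟩, rfl⟩
    · rintro ⟨s, ⟨⟨hs, hn⟩, hm⟩, rfl⟩
      exact ⟨⟨s, hs, hn, rfl⟩, hm⟩
  rw [e₁, (h.injOn_image.mono fun s hs => hs.1).ncard_image]
  clear e₁
  have main : ∀ x y : {x : D.V // x ≠ u₂}, x.1 = u₁ → h.collapseComplex.graph.Adj x y →
      {s ∈ kept D u₁ u₂ | x ∈ h.quot '' s ∧ y ∈ h.quot '' s}.ncard +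
        {i | s(h.quot (D.bd i), h.quot (D.bd (i + 1))) = s(x, y)}.ncard = 2 := by
    rintro x y hx ⟨hne, a, b, hab, ha, hb⟩
    have hy₁ : y.1 ≠ u₁ := fun e => hne (Subtype.ext (hx.trans e.symm))
    have hb' : b = y.1 := (h.quot_eq_iff.1 hb).resolve_right fun e => hy₁ e.2
    rw [hb'] at hab
    have hadj : D.cx.graph.Adj u₁ y.1 ∨ D.cx.graph.Adj u₂ y.1 := by
      rcases h.quot_eq_iff.1 ha with e | e
      · left; rwa [← hx, ← e]
      · right; rw [e.1] at hab; exact hab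
    rw [← h.ncard_link_add hy₁ y.2 hadj]
    congr 1
    · rw [← Set.ncard_union_eq ?_ ((D.finite_trianglesAt _ _).inter_of_left _)
        ((D.finite_trianglesAt _ _).inter_of_left _)]
      · congr 1
        ext s
        rw [Set.mem_ofPred_eq, h.mem_image_quot_iff, h.mem_image_quot_iff, hx]
        constructor
        · rintro ⟨hs, h₁, h₂⟩
          have h₂ := h₂.resolve_right fun e => hy₁ e.2
          rcases h₁ with h₁ | h₁
          · exact .inl ⟨⟨hs.1, h₁, h₂⟩, hs⟩
          · exact .inr ⟨⟨hs.1, h₁.1, h₂⟩, hs⟩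
        · rintro (⟨h₁, hs⟩ | ⟨h₁, hs⟩)
          · exact ⟨hs, .inl h₁.2.1, .inl h₁.2.2⟩
          · exact ⟨hs, .inr ⟨h₁.2.1, rfl⟩, .inl h₁.2.2⟩
      · rw [Set.disjoint_left]
        intro s h₁ h₂
        exact h₁.2.2 ⟨h₁.1.2.1, h₂.1.2.1⟩
    · rw [← Set.ncard_union_eq]
      · congr 1
        ext i
        change s(_, _) = s(_, _) ↔ s(_, _) = s(_, _) ∨ s(_, _) = s(_, _)
        simp only [Sym2.eq_iff, h.quot_eq_iff]
        grind
      · rw [Set.disjoint_left]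
        intro i (h₁ : s(_, _) = s(_, _)) (h₂ : s(_, _) = s(_, _))
        rw [h₁, Sym2.eq_iff] at h₂
        have := h.adj.ne
        grind
  by_cases hx : x.1 = u₁
  · exact main x y hx hxy
  by_cases hy : y.1 = u₁
  · rw [← main y x hy hxy.symm, Sym2.eq_swap (a := x)]
    simp only [and_comm]
  obtain ⟨hne, a, b, hab, ha, hb⟩ := hxy
  have ha' : a = x.1 := (h.quot_eq_iff.1 ha).resolve_right fun e => hx e.2
  have hb' : b = y.1 := (h.quot_eq_iff.1 hb).resolve_right fun e => hy e.2
  rw [ha', hb'] at hab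
  rw [← ncard_add_ncard hab]
  congr 2
  · ext s
    rw [Set.mem_ofPred_eq, h.mem_image_quot_iff, h.mem_image_quot_iff]
    constructor
    · rintro ⟨hs, h₁, h₂⟩
      exact ⟨hs.1, h₁.resolve_right fun e => hx e.2, h₂.resolve_right fun e => hy e.2⟩
    · rintro ⟨hs, h₁, h₂⟩
      refine ⟨⟨hs, fun hm => ?_⟩, .inl h₁, .inl h₂⟩
      obtain ⟨c, rfl⟩ := TwoComplex.exists_third hs h₁ h₂ hab.ne
      have h₃ := x.2
      have h₄ := y.2
      have h₅ := h.adj.ne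
      obtain ⟨m₁, m₂⟩ := hm
      simp only [Set.mem_insert_iff, Set.mem_singleton_iff] at m₁ m₂
      grind
  · ext i
    change s(_, _) = s(_, _) ↔ s(_, _) = s(_, _)
    simp only [Sym2.eq_iff, h.quot_eq_iff]
    grind

/-- At the merged vertex, the links of `u₁` and `u₂`, each without the other end, remain connected
by `link_connected_delete`, and they share a common neighbour `p`. At any other vertex the old link
is projected, and a step along the collapsed edge becomes constant. -/
theorem link_connected_collapse [NeZero n] (h : IsCollapsible D u₁ u₂)
    (x y z : {x : D.V // x ≠ u₂}) (hy : h.collapseComplex.graph.Adj x y)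
    (hz : h.collapseComplex.graph.Adj x z) :
    Relation.ReflTransGen (fun p q => ({x, p, q} : Set _) ∈ h.collapseComplex.triangles ∨
      ∃ i, h.quot (D.bd (i + 1)) = x ∧
        s(h.quot (D.bd i), h.quot (D.bd (i + 2))) = s(p, q)) y z := by
  set r := (fun p q : {x : D.V // x ≠ u₂} => ({x, p, q} : Set _) ∈ h.collapseComplex.triangles ∨
      ∃ i, h.quot (D.bd (i + 1)) = x ∧
        s(h.quot (D.bd i), h.quot (D.bd (i + 2))) = s(p, q)) with hr
  have symm : ∀ {p q}, Relation.ReflTransGen r p q → Relation.ReflTransGen r q p := by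
    refine reflTransGen_symm fun p q hpq => ?_
    rcases hpq with h' | ⟨i, h', e⟩
    · exact .inl (by rwa [TwoComplex.pair_mem_triangle_comm])
    · exact .inr ⟨i, h', e.trans Sym2.eq_swap⟩
  have step : ∀ w a b, h.quot w = x → D.LinkRel w a b → ¬ (u₁ ∈ ({w, a, b} : Set D.V) ∧
      u₂ ∈ ({w, a, b} : Set D.V)) → r (h.quot a) (h.quot b) := by
    rintro w a b rfl (hab | ⟨i, rfl, e⟩) hn
    · exact .inl (h.triangle_quot ⟨hab, hn⟩)
    · exact .inr ⟨i, rfl, congrArg (Sym2.map h.quot) e⟩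
  obtain ⟨hxy, a, b, hab, ha, rfl⟩ := hy
  obtain ⟨hxz, c, d, hcd, hc, rfl⟩ := hz
  by_cases hx : x.1 = u₁
  · obtain ⟨p, p', -, e⟩ := exists_two_triangles h.adj h.passages_eq
    have tp : ({u₁, u₂, p} : Set D.V) ∈ D.trianglesAt u₁ u₂ := by rw [e]; simp
    obtain ⟨-, n₂, n₃⟩ := TwoComplex.ne_of_triangle tp.1
    have adj₁ : D.cx.graph.Adj u₁ p := TwoComplex.adj_of_mem_triangle tp.1 (by simp) (by simp) n₃
    have adj₂ : D.cx.graph.Adj u₂ p := TwoComplex.adj_of_mem_triangle tp.1 (by simp) (by simp) n₂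
    have eu₁ : h.quot u₁ = x := h.quot_eq_iff.2 (.inl hx.symm)
    have eu₂ : h.quot u₂ = x := h.quot_eq_iff.2 (.inr ⟨rfl, hx⟩)
    have key : ∀ a b, h.quot a = x → D.cx.graph.Adj a b → x ≠ h.quot b →
        Relation.ReflTransGen r (h.quot b) (h.quot p) := by
      intro a b ha hab hb
      have hb₁ : b ≠ u₁ := fun e => hb (by rw [e, eu₁])
      have hb₂ : b ≠ u₂ := fun e => hb (by rw [e, eu₂])
      rcases h.quot_eq_iff.1 ha with rfl | ⟨rfl, -⟩
      · rw [hx] at hab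
        refine reflTransGen_lift _ ?_
          (link_connected_delete h.adj h.passages_eq hab adj₁ hb₂ n₂.symm)
        rintro s t ⟨hst, hs, ht⟩
        refine .single (step u₁ s t eu₁ hst fun hm => ?_)
        have := hm.2
        have := h.adj.ne
        simp only [Set.mem_insert_iff, Set.mem_singleton_iff] at hm
        grind
      · refine reflTransGen_lift _ ?_
          (link_connected_delete h.symm.adj h.symm.passages_eq hab adj₂ hb₁ n₃.symm)
        rintro s t ⟨hst, hs, ht⟩
        refine .single (step _ s t eu₂ hst fun hm => ?_)
        have := hm.2
        have := h.adj.ne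
        simp only [Set.mem_insert_iff, Set.mem_singleton_iff] at hm
        grind
    exact (key a b ha hab hxy).trans (symm (key c d hc hcd hxz))
  · have ha' : a = x.1 := (h.quot_eq_iff.1 ha).resolve_right fun e => hx e.2
    have hc' : c = x.1 := (h.quot_eq_iff.1 hc).resolve_right fun e => hx e.2
    rw [ha'] at hab
    rw [hc'] at hcd
    refine reflTransGen_lift (r := D.LinkRel x.1) _ ?_ (D.link_connected x.1 b d hab hcd)
    intro s t hst
    by_cases hm : u₁ ∈ ({x.1, s, t} : Set D.V) ∧ u₂ ∈ ({x.1, s, t} : Set D.V)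
    · have e : h.quot s = h.quot t := by
        rw [h.quot_eq_quot_iff, Sym2.eq_iff]
        have h₁ := x.2
        have h₂ := h.adj.ne
        simp only [Set.mem_insert_iff, Set.mem_singleton_iff] at hm
        grind
      rw [e]
    · exact .single (step _ s t (h.quot_val x) hst hm)

/-- The singular disc after the collapse. -/
noncomputable def collapse [NeZero n] (h : IsCollapsible D u₁ u₂) : SingularDisc.{u} n where
  V := {x : D.V // x ≠ u₂}
  finite := have := D.finite; inferInstance
  cx := h.collapseComplex
  bd i := h.quot (D.bd i)
  simplyConnected := h.simplyConnected_collapseComplex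
  bd_adj i := by
    refine ⟨fun e => ?_, _, _, D.bd_adj i, rfl, rfl⟩
    rcases h.quot_eq_quot_iff.1 e with e | e
    · exact (D.bd_adj i).ne e
    · have : i ∈ D.passages u₁ u₂ := e
      rw [h.passages_eq] at this
      exact this
  two_sides _ _ hxy := h.two_sides_collapse hxy
  link_connected := h.link_connected_collapse

theorem ncard_collapse_lt [NeZero n] (h : IsCollapsible D u₁ u₂) :
    h.collapseComplex.triangles.ncard < D.cx.triangles.ncard := by
  obtain ⟨p, p', -, e⟩ := exists_two_triangles h.adj h.passages_eq
  have tp : ({u₁, u₂, p} : Set D.V) ∈ D.trianglesAt u₁ u₂ := by rw [e]; simp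
  have hfin : (kept D u₁ u₂).Finite := D.finite_triangles.subset (kept_subset D u₁ u₂)
  have e₁ : h.collapseComplex.triangles = (fun s => h.quot '' s) '' kept D u₁ u₂ := by
    ext t
    constructor
    · rintro ⟨s, hs, hn, rfl⟩
      exact ⟨s, ⟨hs, hn⟩, rfl⟩
    · rintro ⟨s, ⟨hs, hn⟩, rfl⟩
      exact ⟨s, hs, hn, rfl⟩
  rw [e₁]
  refine (Set.ncard_image_le hfin).trans_lt (Set.ncard_lt_ncard ?_ D.finite_triangles)
  refine ⟨kept_subset D u₁ u₂, fun hsub => ?_⟩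
  exact (hsub tp.1).2 ⟨by simp, by simp⟩

end IsCollapsible

end SingularDisc

namespace DiscDiagram

variable {W : Type v} {X : MetricComplex W} {n : ℕ} {C : ZMod n → W}

/-- A C-move is possible at every edge whose endpoints have the same image, and it decreases the
area. -/
theorem exists_cMove [NeZero n] (D : DiscDiagram.{u} X C) (hC : X.IsCycle C)
    (hD : D.cx.NoEmptyTriangle) {u₁ u₂ : D.V} (hadj : D.cx.graph.Adj u₁ u₂)
    (hf : D.f u₁ = D.f u₂) :
    ∃ D' : DiscDiagram.{u} X C, CMove D D' ∧ UsesNoNewVertices D D' ∧ D'.area < D.area := by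
  have h : SingularDisc.IsCollapsible D.toSingularDisc u₁ u₂ := by
    refine ⟨hadj, ?_, hD⟩
    rw [Set.eq_empty_iff_forall_notMem]
    intro i (hi : s(D.bd i, D.bd (i + 1)) = s(u₁, u₂))
    apply (hC i).ne
    -- The collapsed edge is not on the boundary, since consecutive vertices of the cycle in X are
    -- adjacent and therefore distinct.
    rw [← D.f_bd, ← D.f_bd]
    rcases Sym2.eq_iff.1 hi with ⟨e₁, e₂⟩ | ⟨e₁, e₂⟩
    · rw [e₁, e₂, hf]
    · rw [e₁, e₂, hf]
  have f_quot : ∀ x, D.f (h.quot x).1 = D.f x := by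
    intro x
    by_cases hx : x = u₂
    · rw [hx, h.quot_right, hf]
    · rw [h.quot_of_ne hx]
  refine ⟨{ toSingularDisc := h.collapse
            f := fun x => D.f x.1
            simplicial := ?_
            f_bd := fun i => (f_quot _).trans (D.f_bd i) },
    ⟨hD, u₁, u₂, hadj, hf, h.quot, fun x => ⟨x.1, h.quot_val x⟩, fun _ _ => h.quot_eq_quot_iff,
      f_quot, fun _ => rfl, fun _ _ => Iff.rfl, fun _ => Iff.rfl⟩,
    ⟨Subtype.val, Subtype.val_injective, fun _ => rfl⟩, h.ncard_collapse_lt⟩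
  rintro x y ⟨-, a, b, hab, rfl, rfl⟩
  rw [f_quot, f_quot]
  exact D.simplicial a b hab

end DiscDiagram

/-! ### Short cycles in the links of a metrically systolic complex. -/

/-- The enumeration of the natural numbers that leaves out `j`. -/
def skip (j t : ℕ) : ℕ := if t < j then t else t + 1

theorem skip_of_lt {j t : ℕ} (h : t < j) : skip j t = t := if_pos h

theorem skip_of_le {j t : ℕ} (h : j ≤ t) : skip j t = t + 1 := if_neg (not_lt.2 h)

theorem add_skip (s j t : ℕ) : s + skip j t = skip (s + j) (s + t) := by
  unfold skip
  split_ifs <;> omega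

/-- Omitting `c (p + 1)` merges two consecutive terms of the sum into one, which the assumed
triangle inequality bounds by their sum. -/
theorem sum_skip_le {α : Type*} (g : α → α → ℝ) (c : ℕ → α) {p m : ℕ} (hp : p + 2 ≤ m)
    (h : g (c p) (c (p + 2)) ≤ g (c p) (c (p + 1)) + g (c (p + 1)) (c (p + 2))) :
    ∑ i ∈ Finset.range (m - 1), g (c (skip (p + 1) i)) (c (skip (p + 1) (i + 1))) ≤
      ∑ i ∈ Finset.range m, g (c i) (c (i + 1)) := by
  obtain ⟨q, rfl⟩ := Nat.exists_eq_add_of_le hp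
  rw [show p + 2 + q - 1 = p + 1 + q by omega, Finset.sum_range_add _ (p + 1) q,
    Finset.sum_range_add _ (p + 2) q, Finset.sum_range_succ, Finset.sum_range_succ,
    Finset.sum_range_succ]
  rw [skip_of_lt (by omega : p < p + 1), skip_of_le (le_refl (p + 1))]
  have e₁ : ∑ i ∈ Finset.range p, g (c (skip (p + 1) i)) (c (skip (p + 1) (i + 1))) =
      ∑ i ∈ Finset.range p, g (c i) (c (i + 1)) := by
    refine Finset.sum_congr rfl fun i hi => ?_
    rw [Finset.mem_range] at hi
    rw [skip_of_lt (by omega), skip_of_lt (by omega)]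
  have e₂ : ∑ i ∈ Finset.range q,
        g (c (skip (p + 1) (p + 1 + i))) (c (skip (p + 1) (p + 1 + i + 1))) =
      ∑ i ∈ Finset.range q, g (c (p + 2 + i)) (c (p + 2 + i + 1)) := by
    refine Finset.sum_congr rfl fun i _ => ?_
    rw [skip_of_le (by omega), skip_of_le (by omega)]
    congr 2 <;> omega
  rw [e₁, e₂]
  have e₃ : p + 1 + 1 = p + 2 := rfl
  rw [e₃]
  linarith

theorem apply_natCast_val {α : Type*} {k : ℕ} [NeZero k] {c : ℕ → α} (hc : c k = c 0) {i : ℕ}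
    (hi : i ≤ k) : c ((i : ZMod k).val) = c i := by
  rw [ZMod.val_natCast]
  rcases hi.lt_or_eq with h | rfl
  · rw [Nat.mod_eq_of_lt h]
  · rw [Nat.mod_self, hc]

namespace MetricComplex

variable {W : Type v} {X : MetricComplex W}

theorem angle_nonneg (X : MetricComplex W) (x a b : W) : 0 ≤ X.angle x a b :=
  Real.arccos_nonneg _

/-- The strict triangle inequality makes the cosine of the angle less than one. -/
theorem angle_pos {x a b : W} (ha : X.graph.Adj x a) (hb : X.graph.Adj x b)
    (hab : X.graph.Adj a b) : 0 < X.angle x a b := by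
  have h₁ := X.len_pos _ _ ha
  have h₂ := X.len_pos _ _ hb
  have h₃ := X.len_triangle x b a hb hab.symm ha
  have h₄ := X.len_triangle x a b ha hab hb
  rw [Sym2.eq_swap (a := b) (b := a)] at h₃
  rw [angle, euclideanAngle, Real.arccos_pos, div_lt_one (by positivity)]
  nlinarith

theorem angle_le_add {x a b c : W} (ha : X.graph.Adj x a) (hb : X.graph.Adj x b)
    (hc : X.graph.Adj x c) (hab : X.graph.Adj a b) (hbc : X.graph.Adj b c)
    (hac : X.graph.Adj a c) : X.angle x a c ≤ X.angle x a b + X.angle x b c :=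
  X.angle_triangle x a b c ha hb hc hab hbc hac

/-- A cycle shorter than 2π is not 2-full. Enumeration by natural numbers separates the chord around
an inner index from the two chords around the ends of the last edge. -/
theorem LocallyLarge.exists_adj (hX : X.LocallyLarge) (x : W) {k : ℕ} (hk : 4 ≤ k) {c : ℕ → W}
    (hc : c k = c 0) (hinj : Set.InjOn c (Set.Iio k)) (hx : ∀ i < k, X.graph.Adj x (c i))
    (hadj : ∀ i < k, X.graph.Adj (c i) (c (i + 1)))
    (hlen : ∑ i ∈ Finset.range k, X.angle x (c i) (c (i + 1)) < 2 * Real.pi) :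
    (∃ p, p + 2 < k ∧ X.graph.Adj (c p) (c (p + 2))) ∨ X.graph.Adj (c (k - 2)) (c 0) ∨
      X.graph.Adj (c (k - 1)) (c 1) := by
  have : NeZero k := ⟨by omega⟩
  have val : ∀ i : ZMod k, ∃ a : ℕ, a < k ∧ (a : ZMod k) = i := fun i =>
    ⟨i.val, i.val_lt, ZMod.natCast_zmod_val i⟩
  by_contra! hn
  refine absurd hlen (not_lt.2 ?_)
  have := hX x k (fun i => c i.val) hk ?_ (fun i => hx _ i.val_lt) ?_ ?_
  · refine this.trans_eq ?_
    rw [angularLength, ← Finset.range_eq_Ico]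
    refine Finset.sum_congr rfl fun i hi => ?_
    rw [Finset.mem_range] at hi
    have e : ((i : ZMod k) + 1) = ((i + 1 : ℕ) : ZMod k) := by push_cast; rfl
    rw [e, apply_natCast_val hc hi.le, apply_natCast_val hc hi]
  · intro i j hij
    exact ZMod.val_injective k (hinj i.val_lt j.val_lt hij)
  · intro i
    obtain ⟨a, ha, rfl⟩ := val i
    have e : ((a : ZMod k) + 1) = ((a + 1 : ℕ) : ZMod k) := by push_cast; rfl
    rw [e, apply_natCast_val hc ha.le, apply_natCast_val hc ha]
    exact hadj a ha
  · intro i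
    obtain ⟨a, ha, rfl⟩ := val i
    have e : ((a : ZMod k) + 2) = ((a + 2 : ℕ) : ZMod k) := by push_cast; rfl
    rw [apply_natCast_val hc ha.le, e]
    by_cases h₁ : a + 2 ≤ k
    · rw [apply_natCast_val hc h₁]
      rcases h₁.lt_or_eq with h₁ | h₁
      · exact hn.1 a h₁
      · rw [h₁, hc, show a = k - 2 by omega]
        exact hn.2.1
    · have e' : ((a + 2 : ℕ) : ZMod k) = ((1 : ℕ) : ZMod k) := by
        rw [show a + 2 = 1 + k by omega]
        simp
      rw [e', apply_natCast_val hc (by omega), show a = k - 1 by omega]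
      exact hn.2.2

/-- In a simple cycle of angular length less than `2π` in a link, there is a vertex different from
the two endpoints of a given edge (the last one) whose two neighbours are adjacent. -/
theorem LocallyLarge.exists_ear (hX : X.LocallyLarge) (x : W) {m : ℕ} (hm : 3 ≤ m) :
    ∀ c : ℕ → W, c m = c 0 → Set.InjOn c (Set.Iio m) → (∀ i < m, X.graph.Adj x (c i)) →
      (∀ i < m, X.graph.Adj (c i) (c (i + 1))) →
      ∑ i ∈ Finset.range m, X.angle x (c i) (c (i + 1)) < 2 * Real.pi →
      ∃ p, p + 2 < m ∧ X.graph.Adj (c p) (c (p + 2)) := by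
  induction m, hm using Nat.le_induction with
  | base =>
    intro c hc _ _ hadj _
    have := hadj 2 (by omega)
    rw [hc] at this
    exact ⟨0, by omega, this.symm⟩
  | succ m hm ih =>
    intro c hc hinj hx hadj hlen
    rcases hX.exists_adj x (by omega) hc hinj hx hadj hlen with h | h | h
    · exact h
    · have e : m + 1 - 2 = m - 1 := by omega
      rw [e] at h
      have hlast : c (m - 1 + 2) = c 0 := by rw [← hc]; congr 1; omega
      have hm₁ : m - 1 + 1 = m := by omega
      have hxc : X.graph.Adj x (c (m - 1 + 2)) := by rw [hlast]; exact hx 0 (by omega)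
      have hsum := sum_skip_le (X.angle x) c (p := m - 1) (m := m + 1) (by omega)
        (angle_le_add (hx _ (by omega)) (hx _ (by omega)) hxc (hadj _ (by omega))
          (hadj _ (by omega)) (by rw [hlast]; exact h))
      rw [hm₁, Nat.add_sub_cancel] at hsum
      have lt : ∀ {i}, i < m → c (skip m i) = c i := fun hi => by rw [skip_of_lt hi]
      have top : c (skip m m) = c 0 := by rw [skip_of_le le_rfl, hc]
      obtain ⟨p, hp, hpadj⟩ := ih (fun i => c (skip m i)) (by rw [top, lt (by omega)]) (by
          intro i (hi : i < m) j (hj : j < m) hij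
          have hij : c (skip m i) = c (skip m j) := hij
          rw [lt hi, lt hj] at hij
          exact hinj (Nat.lt_succ_of_lt hi) (Nat.lt_succ_of_lt hj) hij)
        (fun i hi => by rw [lt hi]; exact hx i (by omega)) (fun i hi => by
          rw [lt hi]
          rcases Nat.lt_or_ge (i + 1) m with h' | h'
          · rw [lt h']; exact hadj i (by omega)
          · rw [show i + 1 = m by omega, top, show i = m - 1 by omega]
            exact h) (hsum.trans_lt hlen)
      rw [lt (by omega), lt (by omega)] at hpadj
      exact ⟨p, by omega, hpadj⟩
    · rw [Nat.add_sub_cancel] at h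
      -- Here the chord cuts off `c 0`; the indices are shifted by one so that it again becomes the
      -- last edge.
      let d : ℕ → W := fun i => if i < m then c (i + 1) else c 1
      have lt : ∀ {i}, i < m → d i = c (i + 1) := fun hi => if_pos hi
      have top : d m = c 1 := if_neg (lt_irrefl m)
      have hsum : ∑ i ∈ Finset.range m, X.angle x (d i) (d (i + 1)) ≤
          ∑ i ∈ Finset.range (m + 1), X.angle x (c i) (c (i + 1)) := by
        obtain ⟨q, rfl⟩ : ∃ q, m = q + 1 := ⟨m - 1, by omega⟩
        rw [Finset.sum_range_succ, Finset.sum_range_succ (n := q + 1), Finset.sum_range_succ',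
          top, lt (by omega)]
        have e : ∑ i ∈ Finset.range q, X.angle x (d i) (d (i + 1)) =
            ∑ i ∈ Finset.range q, X.angle x (c (i + 1)) (c (i + 1 + 1)) := by
          refine Finset.sum_congr rfl fun i hi => ?_
          rw [Finset.mem_range] at hi
          rw [lt (by omega), lt (by omega)]
        have h0 := hadj (q + 1) (by omega)
        rw [hc] at h0
        have := angle_le_add (hx (q + 1) (by omega)) (hx 0 (by omega)) (hx 1 (by omega)) h0
          (hadj 0 (by omega)) h
        rw [e, hc]
        linarith
      obtain ⟨p, hp, hpadj⟩ := ih d (by rw [top, lt (by omega)]) (by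
          intro i (hi : i < m) j (hj : j < m) hij
          rw [lt hi, lt hj] at hij
          have := hinj (Nat.succ_lt_succ hi) (Nat.succ_lt_succ hj) hij
          omega)
        (fun i hi => by rw [lt hi]; exact hx _ (by omega)) (fun i hi => by
          rw [lt hi]
          rcases Nat.lt_or_ge (i + 1) m with h' | h'
          · rw [lt h']; exact hadj _ (by omega)
          · rw [show i + 1 = m by omega, top]
            exact h) (hsum.trans_lt hlen)
      rw [lt (by omega), lt (by omega)] at hpadj
      exact ⟨p + 1, by omega, hpadj⟩

end MetricComplex

/-! ### Links as finite sequences, and their change under a flip. -/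

namespace TwoComplex

variable {V : Type u} {K : TwoComplex V}

/-- The link of `x` is a cycle, enumerated by `L 0, …, L (k - 1), L k = L 0`. -/
structure IsLinkPath (K : TwoComplex V) (x : V) (k : ℕ) (L : ℕ → V) : Prop where
  three_le : 3 ≤ k
  closed : L k = L 0
  injOn : Set.InjOn L (Set.Iio k)
  adj_iff : ∀ a, K.graph.Adj x a ↔ ∃ i < k, L i = a
  triangle_iff : ∀ a b, ({x, a, b} : Set V) ∈ K.triangles ↔ ∃ i < k, s(a, b) = s(L i, L (i + 1))

theorem IsLinkCycle.isLinkPath {x : V} {k : ℕ} {l : ZMod k → V} (h : K.IsLinkCycle x l) :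
    K.IsLinkPath x k (fun i => l (i : ZMod k)) := by
  have := h.three_le
  have : NeZero k := ⟨by omega⟩
  have val : ∀ i : ZMod k, ∃ a : ℕ, a < k ∧ (a : ZMod k) = i := fun i =>
    ⟨i.val, i.val_lt, ZMod.natCast_zmod_val i⟩
  refine ⟨h.three_le, by simp, ?_, fun a => ?_, fun a b => ?_⟩
  · intro i hi j hj hij
    have := congrArg ZMod.val (h.injective hij)
    rwa [ZMod.val_cast_of_lt hi, ZMod.val_cast_of_lt hj] at this
  · rw [h.adj_iff]
    constructor
    · rintro ⟨i, rfl⟩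
      obtain ⟨a, ha, rfl⟩ := val i
      exact ⟨a, ha, rfl⟩
    · rintro ⟨i, -, rfl⟩
      exact ⟨i, rfl⟩
  · rw [h.triangle_iff]
    constructor
    · rintro ⟨i, e⟩
      obtain ⟨a, ha, rfl⟩ := val i
      exact ⟨a, ha, by push_cast; exact e⟩
    · rintro ⟨i, -, e⟩
      refine ⟨i, ?_⟩
      push_cast at e
      exact e

namespace IsLinkPath

variable {x : V} {k : ℕ} {L : ℕ → V}

theorem isInterior (h : K.IsLinkPath x k L) : K.IsInterior x := by
  have := h.three_le
  have : NeZero k := ⟨by omega⟩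
  have val : ∀ i : ZMod k, ∃ a : ℕ, a < k ∧ (a : ZMod k) = i := fun i =>
    ⟨i.val, i.val_lt, ZMod.natCast_zmod_val i⟩
  have succ : ∀ a : ℕ, ((a : ZMod k) + 1) = ((a + 1 : ℕ) : ZMod k) := fun a => by push_cast; rfl
  refine ⟨k, fun i => L i.val, h.three_le, ?_, fun a => ?_, fun a b => ?_⟩
  · intro i j hij
    exact ZMod.val_injective k (h.injOn i.val_lt j.val_lt hij)
  · rw [h.adj_iff]
    constructor
    · rintro ⟨i, hi, rfl⟩
      exact ⟨i, apply_natCast_val h.closed hi.le⟩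
    · rintro ⟨i, rfl⟩
      exact ⟨i.val, i.val_lt, rfl⟩
  · rw [h.triangle_iff]
    constructor
    · rintro ⟨i, hi, e⟩
      refine ⟨i, ?_⟩
      rw [succ, apply_natCast_val h.closed hi.le, apply_natCast_val h.closed hi]
      exact e
    · rintro ⟨i, e⟩
      obtain ⟨a, ha, rfl⟩ := val i
      rw [succ, apply_natCast_val h.closed ha.le, apply_natCast_val h.closed ha] at e
      exact ⟨a, ha, e⟩

theorem eq_iff (h : K.IsLinkPath x k L) {i j : ℕ} (hi : i ≤ k) (hj : j ≤ k) :
    L i = L j ↔ i = j ∨ (i = 0 ∧ j = k) ∨ (i = k ∧ j = 0) := by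
  have h3 := h.three_le
  constructor
  · intro e
    rcases hi.lt_or_eq with hi | rfl <;> rcases hj.lt_or_eq with hj | rfl
    · exact .inl (h.injOn hi hj e)
    · rw [h.closed] at e
      exact .inr (.inl ⟨h.injOn hi (show 0 < j by omega) e, rfl⟩)
    · rw [h.closed] at e
      exact .inr (.inr ⟨rfl, (h.injOn (show 0 < i by omega) hj e).symm⟩)
    · exact .inl rfl
  · rintro (rfl | ⟨rfl, rfl⟩ | ⟨rfl, rfl⟩)
    · rfl
    · exact h.closed.symm
    · exact h.closed

theorem adj (h : K.IsLinkPath x k L) {i : ℕ} (hi : i ≤ k) : K.graph.Adj x (L i) := by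
  have h3 := h.three_le
  rw [h.adj_iff]
  rcases hi.lt_or_eq with hi | rfl
  · exact ⟨i, hi, rfl⟩
  · exact ⟨0, by omega, h.closed.symm⟩

theorem triangle (h : K.IsLinkPath x k L) {i : ℕ} (hi : i < k) :
    ({x, L i, L (i + 1)} : Set V) ∈ K.triangles :=
  (h.triangle_iff _ _).2 ⟨i, hi, rfl⟩

theorem adj_succ (h : K.IsLinkPath x k L) {i : ℕ} (hi : i < k) :
    K.graph.Adj (L i) (L (i + 1)) :=
  adj_of_mem_triangle (h.triangle hi) (by simp) (by simp) (ne_of_triangle (h.triangle hi)).2.1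

/-- Without empty triangles, such an edge would span a triangle with `x` and so be an edge of the
link, which is impossible in a link cycle with at least four vertices. -/
theorem not_adj (h : K.IsLinkPath x k L) (hK : K.NoEmptyTriangle) (hk : 4 ≤ k) {p : ℕ}
    (hp : p + 2 ≤ k) : ¬ K.graph.Adj (L p) (L (p + 2)) := by
  intro hadj
  obtain ⟨i, hi, e⟩ := (h.triangle_iff _ _).1 (hK _ _ _ (h.adj (i := p) (by omega)) hadj (h.adj hp))
  rw [Sym2.eq_iff, h.eq_iff (by omega) (by omega), h.eq_iff (by omega) (by omega),
    h.eq_iff (by omega) (by omega), h.eq_iff (by omega) (by omega)] at e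
  omega

end IsLinkPath

theorem triple_eq_iff {x a b p q : V} (hp : x ≠ p) (hq : x ≠ q) (hpq : p ≠ q) :
    ({x, a, b} : Set V) = {x, p, q} ↔ s(a, b) = s(p, q) := by
  constructor
  · intro h
    have h₁ : p ∈ ({x, a, b} : Set V) := by rw [h]; simp
    have h₂ : q ∈ ({x, a, b} : Set V) := by rw [h]; simp
    simp only [Set.mem_insert_iff, Set.mem_singleton_iff] at h₁ h₂
    rw [Sym2.eq_iff]
    grind
  · intro h
    rcases Sym2.eq_iff.1 h with ⟨rfl, rfl⟩ | ⟨rfl, rfl⟩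
    · rfl
    · rw [Set.pair_comm]

end TwoComplex

namespace DiscDiagram

variable {W : Type v} {X : MetricComplex W} {n : ℕ} {C : ZMod n → W}

/-- Flipping the edge from `x` to `L (p + 1)` removes this vertex from the link and joins its two
link neighbours directly. At least four vertices are needed for the result to be a cycle. -/
theorem IsFlip.isLinkPath {D D' : DiscDiagram.{u} X C} {x : D.V} {k : ℕ} {L : ℕ → D.V} {p : ℕ}
    (h : D.cx.IsLinkPath x k L) (hk : 4 ≤ k) (hp : p + 2 ≤ k) {e : D.V ≃ D'.V}
    (hadj : ∀ a b, D'.cx.graph.Adj (e a) (e b) ↔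
      (D.cx.graph.Adj a b ∧ s(a, b) ≠ s(x, L (p + 1))) ∨ s(a, b) = s(L p, L (p + 2)))
    (htri : ∀ t : Set D.V, e '' t ∈ D'.cx.triangles ↔
      (t ∈ D.cx.triangles ∧ t ≠ {x, L (p + 1), L p} ∧ t ≠ {x, L (p + 1), L (p + 2)}) ∨
        t = {x, L p, L (p + 2)} ∨ t = {L (p + 1), L p, L (p + 2)}) :
    D'.cx.IsLinkPath (e x) (k - 1) (fun i => e (L (skip (p + 1) i))) := by
  have nx : ∀ {i}, i ≤ k → x ≠ L i := fun hi => (h.adj hi).ne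
  have e₀ : skip (p + 1) 0 = 0 := skip_of_lt (by omega)
  have eq : ∀ {i j}, i ≤ k → j ≤ k → (L i = L j ↔ i = j ∨ (i = 0 ∧ j = k) ∨ (i = k ∧ j = 0)) :=
    fun hi hj => h.eq_iff hi hj
  refine ⟨by omega, ?_, ?_, fun a' => ?_, fun a' b' => ?_⟩
  · rw [skip_of_le (by omega), e₀, show k - 1 + 1 = k by omega, h.closed]
  · intro i (hi : i < k - 1) j (hj : j < k - 1) hij
    have hij := e.injective hij
    unfold skip at hij
    split_ifs at hij <;> rw [eq (by omega) (by omega)] at hij <;> omega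
  · obtain ⟨a, rfl⟩ := e.surjective a'
    rw [hadj]
    constructor
    · rintro (⟨h₁, h₂⟩ | h₁)
      · obtain ⟨i, hi, rfl⟩ := (h.adj_iff a).1 h₁
        have hne : i ≠ p + 1 := by rintro rfl; exact h₂ rfl
        rcases Nat.lt_or_ge i (p + 1) with h' | h'
        · exact ⟨i, by omega, by rw [skip_of_lt h']⟩
        · exact ⟨i - 1, by omega, by
            rw [skip_of_le (by omega), show i - 1 + 1 = i by omega]⟩
      · exfalso
        rcases Sym2.eq_iff.1 h₁ with h' | h'
        · exact nx (by omega) h'.1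
        · exact nx (by omega) h'.1
    · rintro ⟨i, hi, e'⟩
      obtain rfl := e.injective e'
      have hs : skip (p + 1) i < k := by unfold skip; split_ifs <;> omega
      refine .inl ⟨h.adj hs.le, fun h' => ?_⟩
      rw [Sym2.congr_right, eq hs.le (by omega)] at h'
      unfold skip at h'
      split_ifs at h' <;> omega
  · obtain ⟨a, rfl⟩ := e.surjective a'
    obtain ⟨b, rfl⟩ := e.surjective b'
    have img : ({e x, e a, e b} : Set D'.V) = e '' {x, a, b} := by
      rw [Set.image_insert_eq, Set.image_insert_eq, Set.image_singleton]
    have ne₁ : L (p + 1) ≠ L p := by rw [ne_eq, eq (by omega) (by omega)]; omega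
    have ne₂ : L (p + 1) ≠ L (p + 2) := by rw [ne_eq, eq (by omega) (by omega)]; omega
    have ne₃ : L p ≠ L (p + 2) := by rw [ne_eq, eq (by omega) (by omega)]; omega
    rw [img, htri, ne_eq, ne_eq, TwoComplex.triple_eq_iff (nx (by omega)) (nx (by omega)) ne₁,
      TwoComplex.triple_eq_iff (nx (by omega)) (nx (by omega)) ne₂,
      TwoComplex.triple_eq_iff (nx (by omega)) (nx (by omega)) ne₃, h.triangle_iff]
    have no : ({x, a, b} : Set D.V) ≠ {L (p + 1), L p, L (p + 2)} := by
      intro h'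
      have : x ∈ ({L (p + 1), L p, L (p + 2)} : Set D.V) := by rw [← h']; simp
      rcases this with h' | h' | h'
      · exact nx (by omega) h'
      · exact nx (by omega) h'
      · exact nx (by omega) h'
    have inj : Function.Injective (Sym2.map e) := Sym2.map.injective e.injective
    have map : ∀ i j : ℕ, s(e a, e b) = s(e (L i), e (L j)) ↔ s(a, b) = s(L i, L j) :=
      fun i j => inj.eq_iff (a := s(a, b)) (b := s(L i, L j))
    simp only [map, no, or_false]
    constructor
    · rintro (⟨⟨i, hi, e'⟩, h₁, h₂⟩ | h₁)
      · have hi₁ : i ≠ p := by rintro rfl; exact h₁ (e'.trans Sym2.eq_swap)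
        have hi₂ : i ≠ p + 1 := by rintro rfl; exact h₂ e'
        rcases Nat.lt_or_ge i p with h' | h'
        · exact ⟨i, by omega, by rwa [skip_of_lt (by omega), skip_of_lt (by omega)]⟩
        · refine ⟨i - 1, by omega, ?_⟩
          rwa [skip_of_le (by omega), skip_of_le (by omega), show i - 1 + 1 = i by omega]
      · exact ⟨p, by omega, by rwa [skip_of_lt (by omega), skip_of_le (by omega)]⟩
    · rintro ⟨i, hi, e'⟩
      rcases Nat.lt_trichotomy i p with h' | rfl | h'
      · rw [skip_of_lt (by omega), skip_of_lt (by omega)] at e'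
        refine .inl ⟨⟨i, by omega, e'⟩, ?_, ?_⟩
        · rw [e', Sym2.eq_iff, eq (by omega) (by omega), eq (by omega) (by omega),
            eq (by omega) (by omega), eq (by omega) (by omega)]
          omega
        · rw [e', Sym2.eq_iff, eq (by omega) (by omega), eq (by omega) (by omega),
            eq (by omega) (by omega), eq (by omega) (by omega)]
          omega
      · rw [skip_of_lt (by omega), skip_of_le (by omega)] at e'
        exact .inr e'
      · rw [skip_of_le (by omega), skip_of_le (by omega)] at e'
        refine .inl ⟨⟨i + 1, by omega, e'⟩, ?_, ?_⟩
        · rw [e', Sym2.eq_iff, eq (by omega) (by omega), eq (by omega) (by omega),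
            eq (by omega) (by omega), eq (by omega) (by omega)]
          omega
        · rw [e', Sym2.eq_iff, eq (by omega) (by omega), eq (by omega) (by omega),
            eq (by omega) (by omega), eq (by omega) (by omega)]
          omega

end DiscDiagram

/-! ### Decreasing the area of a diagram. -/

namespace DiscDiagram

variable {W : Type v} {X : MetricComplex W} {n : ℕ} {C : ZMod n → W}

theorem UsesNoNewVertices.refl (D : DiscDiagram.{u} X C) : UsesNoNewVertices D D :=
  ⟨id, Function.injective_id, fun _ => rfl⟩

theorem UsesNoNewVertices.trans {D₁ D₂ D₃ : DiscDiagram.{u} X C} (h : UsesNoNewVertices D₁ D₂)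
    (h' : UsesNoNewVertices D₂ D₃) : UsesNoNewVertices D₁ D₃ := by
  obtain ⟨i, hi, hf⟩ := h
  obtain ⟨j, hj, hg⟩ := h'
  exact ⟨i ∘ j, hi.comp hj, fun x => (hg x).trans (hf _)⟩

/-- The area can be decreased by a sequence of moves. -/
def Improvable (D : DiscDiagram.{u} X C) : Prop :=
  ∃ D' : DiscDiagram.{u} X C, Relation.ReflTransGen Move D D' ∧ UsesNoNewVertices D D' ∧
    D'.area < D.area

/-- This permits preparatory moves that keep the area, which is how flips enter. -/
theorem Improvable.of_move {D D' : DiscDiagram.{u} X C} (hm : Move D D')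
    (hv : UsesNoNewVertices D D') (ha : D'.area = D.area) (h : Improvable D') : Improvable D := by
  obtain ⟨D₂, h₁, h₂, h₃⟩ := h
  exact ⟨D₂, .head hm h₁, hv.trans h₂, ha ▸ h₃⟩

theorem adj_image {D : DiscDiagram.{u} X C} (hD : D.Nondegenerate) {a b : D.V}
    (hab : D.cx.graph.Adj a b) : X.graph.Adj (D.f a) (D.f b) :=
  (D.simplicial a b hab).resolve_right (hD a b hab)

theorem angularLength_eq_sum (D : DiscDiagram.{u} X C) (x : D.V) {k : ℕ} (l : ZMod k → D.V) :
    D.angularLength x l 0 k = ∑ i ∈ Finset.range k,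
      X.angle (D.f x) (D.f (l (i : ZMod k))) (D.f (l ((i + 1 : ℕ) : ZMod k))) := by
  rw [angularLength, MetricComplex.angularLength, ← Finset.range_eq_Ico]
  push_cast
  rfl

theorem sum_arc_le (X : MetricComplex W) (x : W) (c : ℕ → W) {i d k : ℕ} (h : i + d ≤ k) :
    ∑ t ∈ Finset.range d, X.angle x (c (i + t)) (c (i + (t + 1))) ≤
      ∑ t ∈ Finset.range k, X.angle x (c t) (c (t + 1)) := by
  obtain ⟨q, rfl⟩ := Nat.exists_eq_add_of_le h
  rw [add_assoc, Finset.sum_range_add _ i, Finset.sum_range_add _ d]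
  exact le_add_of_nonneg_of_le (Finset.sum_nonneg fun _ _ => X.angle_nonneg _ _ _)
    (le_add_of_nonneg_right (Finset.sum_nonneg fun _ _ => X.angle_nonneg _ _ _))

variable [NeZero n]

theorem improvable_of_emptyTriangle {D : DiscDiagram.{u} X C} (h : ¬ D.cx.NoEmptyTriangle) :
    D.Improvable := by
  obtain ⟨D', h₁, h₂, h₃⟩ := D.exists_aMove h
  exact ⟨D', .single (.inl h₁), h₂, h₃⟩

/-- C-moves require the absence of empty triangles; if there is one, an A-move decreases the area
instead. -/
theorem improvable_of_edge {D : DiscDiagram.{u} X C} (hC : X.IsCycle C) {a b : D.V}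
    (hab : D.cx.graph.Adj a b) (hf : D.f a = D.f b) : D.Improvable := by
  by_cases hD : D.cx.NoEmptyTriangle
  · obtain ⟨D', h₁, h₂, h₃⟩ := D.exists_cMove hC hD hab hf
    exact ⟨D', .single (.inr (.inr (.inl h₁))), h₂, h₃⟩
  · exact improvable_of_emptyTriangle hD

/-- The B-move does not change the area, but it creates an edge with equal end images. -/
theorem improvable_of_fold {D : DiscDiagram.{u} X C} (hC : X.IsCycle C) {u v w z : D.V}
    (h₁ : ({u, v, w} : Set D.V) ∈ D.cx.triangles) (h₂ : ({u, v, z} : Set D.V) ∈ D.cx.triangles)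
    (hwz : w ≠ z) (hf : D.f w = D.f z) : D.Improvable := by
  by_cases hD : D.cx.NoEmptyTriangle
  · by_cases hadj : D.cx.graph.Adj w z
    · exact improvable_of_edge hC hadj hf
    · obtain ⟨D', hflip, harea⟩ := D.exists_flip ⟨h₁, h₂, hwz, hadj⟩ (.inr hf)
      refine .of_move (.inr (.inl ⟨hD, u, v, w, z, h₁, h₂, hwz, hf, hflip⟩))
        hflip.usesNoNewVertices harea ?_
      obtain ⟨e, he, -, hadj', -⟩ := hflip
      exact improvable_of_edge hC ((hadj' w z).2 (.inr rfl)) (by rw [he, he, hf])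
  · exact improvable_of_emptyTriangle hD

/-- A D-move at an interior vertex shortens its link. -/
theorem exists_dMove {D : DiscDiagram.{u} X C} (hD : D.cx.NoEmptyTriangle) {x : D.V} {k : ℕ}
    {L : ℕ → D.V} (h : D.cx.IsLinkPath x k L) (hk : 4 ≤ k) {p : ℕ} (hp : p + 2 ≤ k)
    (hadj : X.graph.Adj (D.f (L p)) (D.f (L (p + 2)))) :
    ∃ (D' : DiscDiagram.{u} X C) (e : D.V ≃ D'.V), Move D D' ∧ UsesNoNewVertices D D' ∧
      D'.area = D.area ∧ (∀ y, D'.f (e y) = D.f y) ∧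
      D'.cx.IsLinkPath (e x) (k - 1) (fun i => e (L (skip (p + 1) i))) := by
  have hn := h.not_adj hD hk hp
  have hne : L p ≠ L (p + 2) := fun e => hadj.ne (congrArg D.f e)
  have t₁ : ({x, L (p + 1), L p} : Set D.V) ∈ D.cx.triangles := by
    rw [Set.pair_comm]; exact h.triangle (by omega)
  have t₂ : ({x, L (p + 1), L (p + 2)} : Set D.V) ∈ D.cx.triangles := h.triangle (by omega)
  obtain ⟨D', hflip, harea⟩ := D.exists_flip ⟨t₁, t₂, hne, hn⟩ (.inl hadj)
  have hv := hflip.usesNoNewVertices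
  have hm : Move D D' := .inr (.inr (.inr (.inl ⟨hD, x, L (p + 1), L p, L (p + 2), h.isInterior,
    t₁, t₂, hne, hadj, hflip⟩)))
  obtain ⟨e, he, -, hadj', htri⟩ := hflip
  exact ⟨D', e, hm, hv, harea, he, IsFlip.isLinkPath h hk hp hadj' htri⟩

/-- If the link of an interior vertex contains an arc of angular length less than `2π` whose
endpoints have the same image, then the area can be decreased. -/
theorem improvable_of_arc (hX : X.LocallyLarge) (hC : X.IsCycle C) (m : ℕ) :
    ∀ (D : DiscDiagram.{u} X C) (x : D.V) (k : ℕ) (L : ℕ → D.V) (s : ℕ),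
      D.cx.IsLinkPath x k L → 0 < m → m < k → s + m ≤ k → D.f (L s) = D.f (L (s + m)) →
      ∑ i ∈ Finset.range m, X.angle (D.f x) (D.f (L (s + i))) (D.f (L (s + (i + 1)))) <
        2 * Real.pi → D.Improvable := by
  induction m using Nat.strong_induction_on with
  | _ m ih =>
    intro D x k L s h hm hmk hsm hf hlen
    by_cases hD : D.cx.NoEmptyTriangle
    swap
    · exact improvable_of_emptyTriangle hD
    by_cases hN : D.Nondegenerate
    swap
    · unfold Nondegenerate at hN
      push Not at hN
      obtain ⟨a, b, hab, hf⟩ := hN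
      exact improvable_of_edge hC hab hf
    have hk := h.three_le
    -- The induction ends at arcs of one edge, which is degenerate, or of two edges, which is a
    -- fold.
    obtain rfl | rfl | hm₃ : m = 1 ∨ m = 2 ∨ 3 ≤ m := by omega
    · exact improvable_of_edge hC (h.adj_succ (by omega)) hf
    · refine improvable_of_fold hC (u := x) (v := L (s + 1)) (w := L s) (z := L (s + 2)) ?_ ?_ ?_ hf
      · rw [Set.pair_comm]
        exact h.triangle (by omega)
      · exact h.triangle (by omega)
      · rw [ne_eq, h.eq_iff (by omega) (by omega)]
        omega
    -- If the images repeat earlier, a proper subarc with equal end images is at most as long and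
    -- the induction applies. Otherwise the arc maps to a simple closed cycle in the link in X.
    by_cases hsub : ∃ i j, i < j ∧ j < m ∧ D.f (L (s + i)) = D.f (L (s + j))
    · obtain ⟨i, j, hij, hj, hf'⟩ := hsub
      obtain ⟨d, rfl⟩ := Nat.exists_eq_add_of_lt hij
      refine ih (d + 1) (by omega) D x k L (s + i) h (by omega) (by omega) (by omega) ?_ ?_
      · rw [hf']
        congr 2
        omega
      · refine lt_of_le_of_lt ?_ hlen
        obtain ⟨q, rfl⟩ := Nat.exists_eq_add_of_lt hj
        rw [show i + d + 1 + q + 1 = i + (d + 1 + (q + 1)) by omega, Finset.sum_range_add _ i,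
          Finset.sum_range_add _ (d + 1)]
        have e : ∑ t ∈ Finset.range (d + 1),
            X.angle (D.f x) (D.f (L (s + i + t))) (D.f (L (s + i + (t + 1)))) =
            ∑ t ∈ Finset.range (d + 1),
              X.angle (D.f x) (D.f (L (s + (i + t)))) (D.f (L (s + (i + t + 1)))) := by
          refine Finset.sum_congr rfl fun t _ => ?_
          rw [show s + i + t = s + (i + t) by omega, show s + i + (t + 1) = s + (i + t + 1) by omega]
        rw [e]
        refine le_add_of_nonneg_of_le ?_ (le_add_of_nonneg_right ?_) <;>
          exact Finset.sum_nonneg fun _ _ => X.angle_nonneg _ _ _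
    push Not at hsub
    have xadj : ∀ i, i ≤ m → X.graph.Adj (D.f x) (D.f (L (s + i))) := fun i hi =>
      adj_image hN (h.adj (by omega))
    have ladj : ∀ i, i < m → X.graph.Adj (D.f (L (s + i))) (D.f (L (s + (i + 1)))) := fun i hi =>
      adj_image hN (h.adj_succ (by omega))
    -- The ear is a vertex strictly inside the arc, so the D-move keeps both ends of the arc and
    -- shortens it by one edge.
    obtain ⟨p, hp, hpadj⟩ := hX.exists_ear (D.f x) hm₃ (fun i => D.f (L (s + i))) hf.symm
      (by
        intro i (hi : i < m) j (hj : j < m) hij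
        rcases Nat.lt_trichotomy i j with h' | h' | h'
        · exact absurd hij (hsub i j h' hj)
        · exact h'
        · exact absurd hij.symm (hsub j i h' hi)) (fun i hi => xadj i hi.le) ladj hlen
    obtain ⟨D', e, hmove, hv, harea, he, hL⟩ := exists_dMove hD h (by omega) (p := s + p) (by omega)
      hpadj
    refine .of_move hmove hv harea (ih (m - 1) (by omega) D' (e x) (k - 1) _ s hL (by omega)
      (by omega) (by omega) ?_ ?_)
    · rw [he, he, skip_of_lt (by omega), skip_of_le (by omega), hf]
      congr 2
      omega
    · refine lt_of_le_of_lt ?_ hlen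
      have := sum_skip_le (X.angle (D.f x)) (fun i => D.f (L (s + i))) (p := p) (m := m) hp.le
        (MetricComplex.angle_le_add (xadj _ (by omega)) (xadj _ (by omega)) (xadj _ (by omega))
          (ladj _ (by omega)) (ladj _ (by omega)) hpadj)
      simp only [add_skip] at this
      simp only [he]
      exact this

/-- If the map is injective on the link of an interior vertex of angular length less than `2π`,
then the area can be decreased. -/
theorem improvable_of_injOn (hX : X.LocallyLarge) (hC : X.IsCycle C) {k : ℕ} (hk : 3 ≤ k) :
    ∀ (D : DiscDiagram.{u} X C) (x : D.V) (L : ℕ → D.V), D.cx.IsLinkPath x k L →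
      Set.InjOn (fun i => D.f (L i)) (Set.Iio k) →
      ∑ i ∈ Finset.range k, X.angle (D.f x) (D.f (L i)) (D.f (L (i + 1))) < 2 * Real.pi →
      D.Improvable := by
  induction k, hk using Nat.le_induction with
  | base =>
    intro D x L h _ _
    refine improvable_of_emptyTriangle fun hD => ?_
    have h₀ := h.triangle (i := 0) (by omega)
    have h₁ := h.triangle (i := 1) (by omega)
    have h₂ := h.triangle (i := 2) (by omega)
    rw [h.closed, Set.pair_comm] at h₂
    have a₂ := h.adj_succ (i := 2) (by omega)
    rw [h.closed] at a₂
    -- The three neighbours are pairwise adjacent; if they bounded a triangle, it would form a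
    -- tetrahedron boundary with the star of `x`.
    exact SingularDisc.not_tetrahedron h₀ h₂ h₁
      (hD _ _ _ (h.adj_succ (i := 0) (by omega)) (h.adj_succ (i := 1) (by omega)) a₂.symm)
  | succ k hk ih =>
    intro D x L h hinj hlen
    by_cases hD : D.cx.NoEmptyTriangle
    swap
    · exact improvable_of_emptyTriangle hD
    by_cases hN : D.Nondegenerate
    swap
    · unfold Nondegenerate at hN
      push Not at hN
      obtain ⟨a, b, hab, hf⟩ := hN
      exact improvable_of_edge hC hab hf
    have xadj : ∀ i, i ≤ k + 1 → X.graph.Adj (D.f x) (D.f (L i)) := fun i hi =>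
      adj_image hN (h.adj hi)
    have ladj : ∀ i, i < k + 1 → X.graph.Adj (D.f (L i)) (D.f (L (i + 1))) := fun i hi =>
      adj_image hN (h.adj_succ hi)
    -- The link maps to a simple cycle shorter than 2π. The D-move at an ear keeps the map injective
    -- on the link and does not increase its length, so induction on the number of link vertices
    -- applies.
    obtain ⟨p, hp, hpadj⟩ := hX.exists_ear (D.f x) (by omega) (fun i => D.f (L i))
      (congrArg D.f h.closed) hinj (fun i hi => xadj i hi.le) ladj hlen
    obtain ⟨D', e, hmove, hv, harea, he, hL⟩ := exists_dMove hD h (by omega) hp.le hpadj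
    refine .of_move hmove hv harea (ih D' (e x) _ hL ?_ ?_)
    · intro i (hi : i < k) j (hj : j < k) hij
      simp only [he] at hij
      have hs : ∀ t, t < k → skip (p + 1) t < k + 1 := fun t ht => by
        unfold skip; split_ifs <;> omega
      have := hinj (hs i hi) (hs j hj) hij
      unfold skip at this
      split_ifs at this <;> omega
    · refine lt_of_le_of_lt ?_ hlen
      have := sum_skip_le (X.angle (D.f x)) (fun i => D.f (L i)) (p := p) (m := k + 1) hp.le
        (MetricComplex.angle_le_add (xadj _ (by omega)) (xadj _ (by omega)) (xadj _ (by omega))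
          (ladj _ (by omega)) (ladj _ (by omega)) hpadj)
      simpa only [he, Nat.add_sub_cancel] using this

/-- If two triangles on the edge `u v` have the same image, nondegeneracy forces their opposite
vertices to have the same image, giving a fold. -/
theorem improvable_of_not_reduced {D : DiscDiagram.{u} X C} (hC : X.IsCycle C)
    (hN : D.Nondegenerate) (hR : ¬ D.Reduced) : D.Improvable := by
  unfold Reduced at hR
  push Not at hR
  obtain ⟨s, hs, t, ht, hst, ⟨u, hu, v, hv, huv⟩, e⟩ := hR
  obtain ⟨w, rfl⟩ := TwoComplex.exists_third hs hu.1 hv.1 huv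
  obtain ⟨z, rfl⟩ := TwoComplex.exists_third ht hu.2 hv.2 huv
  have hwz : w ≠ z := by
    rintro rfl
    exact hst rfl
  refine improvable_of_fold hC hs ht hwz ?_
  obtain ⟨-, h₁, h₂⟩ := TwoComplex.ne_of_triangle hs
  have n₁ := hN _ _ (TwoComplex.adj_of_mem_triangle hs (a := v) (b := w) (by simp) (by simp) h₁)
  have n₂ := hN _ _ (TwoComplex.adj_of_mem_triangle hs (a := u) (b := w) (by simp) (by simp) h₂)
  have : D.f w ∈ D.f '' {u, v, z} := by
    rw [← e]
    exact ⟨w, by simp, rfl⟩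
  obtain ⟨y, rfl | rfl | rfl, hy⟩ := this
  · exact absurd hy n₂
  · exact absurd hy n₁
  · exact hy.symm

/-- A diagram which does not have the desired properties can be improved. -/
theorem improvable_of_not_flatInjectiveCAT0 (hX : X.LocallyLarge) (hC : X.IsCycle C)
    {D : DiscDiagram.{u} X C} (h : ¬ D.FlatInjectiveCAT0) : D.Improvable := by
  by_cases hN : D.Nondegenerate
  swap
  · unfold Nondegenerate at hN
    push Not at hN
    obtain ⟨a, b, hab, hf⟩ := hN
    exact improvable_of_edge hC hab hf
  by_cases hR : D.Reduced
  swap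
  · exact improvable_of_not_reduced hC hN hR
  by_cases h0 : D.IsCAT0
  swap
  · unfold IsCAT0 at h0
    push Not at h0
    obtain ⟨x, k, l, hl, hlen⟩ := h0
    have hL := hl.isLinkPath
    rw [angularLength_eq_sum] at hlen
    -- With total length below 2π, every arc is short, so a repeated image in the link suffices for
    -- `improvable_of_arc`.
    by_cases hinj : ∃ i j, i < j ∧ j < k ∧ D.f (l (i : ZMod k)) = D.f (l (j : ZMod k))
    · obtain ⟨i, j, hij, hj, hf⟩ := hinj
      obtain ⟨d, rfl⟩ := Nat.exists_eq_add_of_lt hij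
      rw [add_assoc] at hf
      refine improvable_of_arc hX hC (d + 1) D x k _ i hL (by omega) (by omega) (by omega) hf ?_
      exact (sum_arc_le X _ (fun i : ℕ => D.f (l (i : ZMod k))) (by omega)).trans_lt hlen
    · push Not at hinj
      refine improvable_of_injOn hX hC hL.three_le D x _ hL ?_ hlen
      intro i (hi : i < k) j (hj : j < k) hij
      rcases Nat.lt_trichotomy i j with h' | h' | h'
      · exact absurd hij (hinj i j h' hj)
      · exact h'
      · exact absurd hij.symm (hinj j i h' hi)
  have hflat : ¬ ∀ x, D.IsFlat x → D.InjectiveOnStar x := fun h' => h ⟨h0, hN, hR, h'⟩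
  push Not at hflat
  obtain ⟨x, ⟨k, l, hl, hlen⟩, hinj⟩ := hflat
  have hL := hl.isLinkPath
  have hk := hL.three_le
  rw [angularLength_eq_sum] at hlen
  unfold InjectiveOnStar Set.InjOn at hinj
  push Not at hinj
  obtain ⟨a, ha, b, hb, hf, hab⟩ := hinj
  rcases ha with rfl | ha
  · exact absurd hf (hN _ _ (hb.resolve_left hab.symm))
  rcases hb with rfl | hb
  · exact absurd hf.symm (hN _ _ ha)
  obtain ⟨i, hi, rfl⟩ := (hL.adj_iff a).1 ha
  obtain ⟨j, hj, rfl⟩ := (hL.adj_iff b).1 hb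
  have main : ∀ i j, i < j → j < k → D.f (l (i : ZMod k)) = D.f (l (j : ZMod k)) →
      D.Improvable := by
    intro i j hij hj hf
    obtain ⟨d, rfl⟩ := Nat.exists_eq_add_of_lt hij
    rw [add_assoc] at hf
    refine improvable_of_arc hX hC (d + 1) D x k _ i hL (by omega) (by omega) (by omega) hf ?_
    -- The arc from `i` to `j` does not contain the last edge of the link. That edge has positive
    -- angle, so the arc is strictly shorter than 2π although the whole link is not.
    obtain ⟨q, rfl⟩ : ∃ q, k = q + 1 := ⟨k - 1, by omega⟩
    refine (sum_arc_le X _ (fun i : ℕ => D.f (l (i : ZMod (q + 1)))) (k := q)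
      (by omega)).trans_lt ?_
    rw [← hlen, Finset.sum_range_succ]
    exact lt_add_of_pos_right _ (MetricComplex.angle_pos (adj_image hN (hL.adj (by omega)))
      (adj_image hN (hL.adj (i := q + 1) le_rfl)) (adj_image hN (hL.adj_succ (i := q) (by omega))))
  rcases Nat.lt_trichotomy i j with h' | rfl | h'
  · exact main i j h' hj hf
  · exact absurd rfl hab
  · exact main j i h' hi hf.symm

end DiscDiagram

/-! ### Induction on the area. -/

theorem theorem2p9 {W : Type v} (X : MetricComplex W) (hX : X.MetricallySystolic)
    {n : ℕ} [NeZero n] (C : ZMod n → W) (hC : X.IsCycle C) :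
    (∀ D : DiscDiagram.{u} X C, ∃ D' : DiscDiagram.{u} X C,
      Relation.ReflTransGen DiscDiagram.Move D D' ∧
      D'.FlatInjectiveCAT0 ∧
      (∃ i : D'.V → D.V, Function.Injective i ∧ ∀ x, D'.f x = D.f (i x)) ∧
      D'.area ≤ D.area) ∧
    (∀ D : DiscDiagram.{u} X C, D.Minimal → D.FlatInjectiveCAT0) := by
  refine ⟨fun D => ?_, fun D hD => ?_⟩
  · induction hk : D.area using Nat.strong_induction_on generalizing D with
    | _ k ih =>
      by_cases h : D.FlatInjectiveCAT0
      · exact ⟨D, .refl, h, DiscDiagram.UsesNoNewVertices.refl D, hk.le⟩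
      · obtain ⟨D₁, h₁, h₂, h₃⟩ := DiscDiagram.improvable_of_not_flatInjectiveCAT0 hX.2 hC h
        obtain ⟨D₂, h₄, h₅, h₆, h₇⟩ := ih _ (hk ▸ h₃) D₁ rfl
        exact ⟨D₂, h₁.trans h₄, h₅, DiscDiagram.UsesNoNewVertices.trans h₂ h₆,
          h₇.trans (hk ▸ h₃.le)⟩
  · by_contra h
    obtain ⟨D₁, -, -, h₃⟩ := DiscDiagram.improvable_of_not_flatInjectiveCAT0 hX.2 hC h
    exact absurd (hD D₁) (not_le.2 h₃)
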